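/- Let $d,s,p\ge 1$ be integers with $2p\le d$, and let $\eta=\mathrm{diag}(-1,1,\dots,1)$ be the metric of $d$-dimensional Minkowski space; write $x_m=\eta_{mn}x^n$, $x^2=x_mx^m$, $|x|=|x^2|^{1/2}$, and for $x^2\neq0$ $$I_{mn}(x)=\eta_{mn}-\frac{2x_mx_n}{x^2}.$$ A traceless tensor of type $\{s,p\}$ is a tensor $O_{i_1\dots i_s,\,m_1\dots m_{p-1}}$ that is symmetric in the $i$'s, antisymmetric in the $m$'s, vanishes when all the $i$'s and one of the $m$'s are symmetrized, and satisfies $\eta^{kl}O_{kl i_3\dots i_s,\,m_1\dots m_{p-1}}=0$ (if $s\ge2$). Let $U$ be the set of pairs $(x,y)$ with $(x-y)^2>0$, or the set of pairs with $(x-y)^2<0$, or the set of pairs with $(x-y)^2\ne0$. A conformally invariant two-point function on $U$ of two primaries of type $\{s,p\}$ and of the same dimension $\Delta\in\mathbb R$ is a differentiable complex-valued function $G_{A|B}(x,y)=\langle O_A(x)\,O'_B(y)\rangle$ on $U$ that is a traceless $\{s,p\}$ tensor in each of the multi-indices $A$ and $B$ and is invariant (a) under the transformations $$\delta_\xi O_{a_1a_2\dots}=-(\xi^l\partial_l+\Delta\,\sigma_\xi)O_{a_1a_2\dots}+\omega_{a_1n}O^{n}{}_{a_2\dots}+\omega_{a_2n}O_{a_1}{}^{n}{}_{\dots}+\cdots$$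 of both fields for every conformal Killing vector $\xi_m=P_m+\Lambda_{mn}x^n+Dx_m+K_mx^2-2x_m(Kx)$ with $\Lambda_{mn}=-\Lambda_{nm}$, where $\sigma_\xi=D-2(Kx)$ and $\omega_{mn}=\Lambda_{mn}+2(K_mx_n-K_nx_m)$; and (b) under the inversion $x\mapsto x'=x/x^2$, that is, $$G_{A|B}(x',y')=|x|^{2\Delta}|y|^{2\Delta}\,I_A{}^{A'}(x)\,I_B{}^{B'}(y)\,G_{A'|B'}(x,y)$$ whenever $(x,y),(x',y')\in U$ and $x^2,y^2\neq0$, where $I_A{}^{A'}$ is the product of one factor $I_a{}^{a'}$ for each index. With (anti)symmetrizations of unit weight over the first group of indices, let $$S_{i_1\dots i_t|j_1\dots j_t}=I_{(i_1j_1}\cdots I_{i_t)j_t},\qquad A_{m_1\dots m_t|n_1\dots n_t}=I_{[m_1n_1}\cdots I_{m_t]n_t}.$$ 1. There is, for $x^2\ne0$, exactly one function of the form $$\Pi_{i_1\dots i_s,\,m_1\dots m_{p-1}|j_1\dots j_s,\,n_1\dots n_{p-1}}(x)=S_{(i_1\dots i_{s-1}|(j_1\dots j_{s-1}}A_{i_s)m_1\dots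 m_{p-1}|j_s)n_1\dots n_{p-1}}+\eta\text{-terms}$$ (symmetrized over the $i$'s and over the $j$'s) that is a traceless $\{s,p\}$ tensor in each of the two groups of indices. Here the $\eta$-terms are a linear combination, with constant coefficients, of products over complete pairings of all the indices in which a pair within one group contributes $\eta$, a pair joining the two groups contributes $I(x)$, and at least one pair lies within one group. Moreover $\Pi(x)\neq0$ whenever $x^2\ne0$. 2. A function $G$ on $U$ is a conformally invariant two-point function of two primaries of type $\{s,p\}$ and dimension $\Delta$ if and only if there is a constant $C\in\mathbb C$ with $$G_{A|B}(x,y)=C\,\frac{\Pi_{A|B}(x-y)}{|x-y|^{2\Delta}}\qquad\text{for all }(x,y)\in U.$$ 3. For type $\{2,2\}$ and $d\ge4$, the function $4\,\Pi_{ij,k|mn,l}(x)$ equals $$\begin{aligned}\hat\Pi_{ij,k|mn,l}={}&(I_{im}I_{jn}+I_{in}I_{jm})I_{kl}-\tfrac12(I_{im}I_{kn}+I_{in}I_{km})I_{jl}\\&-\tfrac12(I_{jm}I_{kn}+I_{jn}I_{km})I_{il}-\tfrac{2}{d-1}T_{ij,k|mn,l},\end{aligned}$$ $$\begin{aligned}T_{ij,k|mn,l}={}&\eta_{ij}\eta_{mn}I_{kl}-\tfrac12\eta_{mn}(\eta_{ik}I_{jl}+\eta_{jk}I_{il})\\&-\tfrac12\eta_{ij}\eta_{ml}I_{kn}+\tfrac14\eta_{ml}(\eta_{ik}I_{jn}+\eta_{jk}I_{in})\\&-\tfrac12\eta_{ij}\eta_{nl}I_{km}+\tfrac14\eta_{nl}(\eta_{ik}I_{jm}+\eta_{jk}I_{im}),\end{aligned}$$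 and $G$ is a conformally invariant two-point function on $U$ if and only if $G_{ij,k|mn,l}(x,y)=2C\,\hat\Pi_{ij,k|mn,l}(x-y)/|x-y|^{2\Delta}$ on $U$ for some constant $C\in\mathbb C$. -/

import Mathlib

open scoped BigOperators

noncomputable section

namespace HookCFT

/-! ### Minkowski space -/

/-- Points of `d`-dimensional Minkowski space, given by their contravariant components `x^m`. -/
abbrev Pt (d : ℕ) : Type := Fin d → ℝ

/-- Diagonal entries of the Minkowski metric `diag(-1, 1, …, 1)` (which is its own inverse). -/
def eta {d : ℕ} (m : Fin d) : ℝ := if (m : ℕ) = 0 then -1 else 1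

/-- The metric tensor `η_{mn}`. -/
def metric {d : ℕ} (m n : Fin d) : ℝ := if m = n then eta m else 0

/-- Covariant components `x_m`. -/
def low {d : ℕ} (x : Pt d) (m : Fin d) : ℝ := eta m * x m

/-- The interval `x² = η_{mn} x^m x^n`. -/
def sq {d : ℕ} (x : Pt d) : ℝ := ∑ m, low x m * x m

/-- `|x| = |x²|^{1/2}`. -/
def mabs {d : ℕ} (x : Pt d) : ℝ := Real.sqrt |sq x|

/-- The inversion matrix `I_{mn}(x) = η_{mn} - 2 x_m x_n / x²`. -/
def invMat {d : ℕ} (x : Pt d) (m n : Fin d) : ℝ :=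
  metric m n - 2 * (low x m * low x n) / sq x

/-- The inversion `x ↦ x / x²`. -/
def inversion {d : ℕ} (x : Pt d) : Pt d := fun m => x m / sq x

/-- Pairs of points at spacelike separation. -/
def spacelikePairs (d : ℕ) : Set (Pt d × Pt d) := {z | 0 < sq (z.1 - z.2)}

/-- Pairs of points at timelike separation. -/
def timelikePairs (d : ℕ) : Set (Pt d × Pt d) := {z | sq (z.1 - z.2) < 0}

/-- All pairs of points that are not lightlike separated. -/
def nonNullPairs (d : ℕ) : Set (Pt d × Pt d) := {z | sq (z.1 - z.2) ≠ 0}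

/-! ### Traceless tensors of hook symmetry type

A tensor of type `{s, p}` has `s` symmetric and `p - 1` antisymmetric indices. We write
`s = r + 1` and `p = q + 1`, so that `s, p ≥ 1` holds by construction. -/

/-- Index positions: `r + 1` in the symmetric group, `q` in the antisymmetric group. -/
abbrev Pos (r q : ℕ) : Type := Fin (r + 1) ⊕ Fin q

/-- Multi-indices `(i_1 … i_s, m_1 … m_{p-1})`. -/
abbrev Idx (d r q : ℕ) : Type := Pos r q → Fin d

/-- A (covariant) traceless tensor of hook symmetry type `{r + 1, q + 1}`. -/
structure IsTracelessHook {d r q : ℕ} {M : Type*} [AddCommGroup M] [Module ℝ M]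
    (T : Idx d r q → M) : Prop where
  /-- symmetry in the first group of indices -/
  symm : ∀ (σ : Equiv.Perm (Fin (r + 1))) (a : Idx d r q), T (a ∘ Sum.map σ id) = T a
  /-- antisymmetry in the second group of indices -/
  antisymm : ∀ (τ : Equiv.Perm (Fin q)) (a : Idx d r q),
    T (a ∘ Sum.map id τ) = (Equiv.Perm.sign τ : ℤ) • T a
  /-- symmetrization of all indices of the first group with one index of the second group gives
  zero; because of `symm` it suffices to sum over representatives of the cosets of `S_s` in
  `S_{s+1}` -/
  young : ∀ (k : Fin q) (a : Idx d r q),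
    T a + ∑ j : Fin (r + 1), T (a ∘ Equiv.swap (Sum.inl j) (Sum.inr k)) = 0
  /-- tracelessness in any two indices of the first group -/
  traceless : ∀ (j j' : Fin (r + 1)), j ≠ j' → ∀ a : Idx d r q,
    ∑ n : Fin d,
      eta n • T (Function.update (Function.update a (Sum.inl j) n) (Sum.inl j') n) = 0

/-! ### Conformal Killing vectors and invariant two-point functions -/

/-- Parameters of a conformal Killing vector: translations `P_m`, Lorentz transformations
`Λ_{mn} = -Λ_{nm}`, dilatation `D`, special conformal transformations `K_m`. -/
structure Killing (d : ℕ) where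
  /-- translation parameter -/
  P : Fin d → ℝ
  /-- Lorentz parameter -/
  L : Fin d → Fin d → ℝ
  /-- antisymmetry of the Lorentz parameter -/
  L_antisymm : ∀ m n, L m n = - L n m
  /-- dilatation parameter -/
  D : ℝ
  /-- special conformal parameter -/
  K : Fin d → ℝ

namespace Killing

variable {d : ℕ} (ξ : Killing d)

/-- The contraction `(K x) = K_m x^m`. -/
def Kdot (x : Pt d) : ℝ := ∑ m, ξ.K m * x m

/-- Covariant components
`ξ_m(x) = P_m + Λ_{mn} x^n + D x_m + K_m x² - 2 x_m (K x)`. -/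
def lowVec (x : Pt d) (m : Fin d) : ℝ :=
  ξ.P m + ∑ n, ξ.L m n * x n + ξ.D * low x m + ξ.K m * sq x - 2 * low x m * ξ.Kdot x

/-- Contravariant components `ξ^m(x)`. -/
def vec (x : Pt d) : Pt d := fun m => eta m * ξ.lowVec x m

/-- The local scale factor `σ_ξ(x) = D - 2 (K x)`. -/
def scale (x : Pt d) : ℝ := ξ.D - 2 * ξ.Kdot x

/-- The local Lorentz rotation `Λ_{mn} + 2 (K_m x_n - K_n x_m)`. -/
def rot (x : Pt d) (m n : Fin d) : ℝ :=
  ξ.L m n + 2 * (ξ.K m * low x n - ξ.K n * low x m)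

end Killing

/-- Action of a Lorentz matrix `ω_{mn}` on a covariant tensor:
the sum over all index positions of `ω_{m n} T_{… }{}^{n}{}_{…}`. -/
def rotAct {d r q : ℕ} (ω : Fin d → Fin d → ℝ) (T : Idx d r q → ℂ) (a : Idx d r q) : ℂ :=
  ∑ k : Pos r q, ∑ n : Fin d, ((ω (a k) n * eta n : ℝ) : ℂ) * T (Function.update a k n)

/-- `∏_k I_{a_k}{}^{b_k}(x)`, the matrix by which the inversion acts on tensors. -/
def invAct {d r q : ℕ} (x : Pt d) (a b : Idx d r q) : ℝ :=
  ∏ k : Pos r q, invMat x (a k) (b k) * eta (b k)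

/-- `G` is, on the set `U` of pairs of points, a conformally invariant two-point function
`⟨O_a(x) O'_b(y)⟩ = G (x, y) a b` of two primary fields of type `{r + 1, q + 1}` and dimension
`Δ`. -/
structure IsConformalTwoPoint {d r q : ℕ} (Δ : ℝ) (U : Set (Pt d × Pt d))
    (G : Pt d × Pt d → Idx d r q → Idx d r q → ℂ) : Prop where
  differentiable : DifferentiableOn ℝ G U
  /-- the first field is a traceless hook tensor -/
  hook_left : ∀ z ∈ U, ∀ b, IsTracelessHook (fun a => G z a b)
  /-- the second field is a traceless hook tensor -/
  hook_right : ∀ z ∈ U, ∀ a, IsTracelessHook (fun b => G z a b)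
  /-- invariance under `δ_ξ O = -(ξ^m ∂_m + Δ σ_ξ) O + ω_ξ · O` for every conformal Killing
  vector `ξ` -/
  ward : ∀ (ξ : Killing d) (x y : Pt d), (x, y) ∈ U → ∀ a b : Idx d r q,
    fderiv ℝ G (x, y) (ξ.vec x, ξ.vec y) a b
      + ((Δ * (ξ.scale x + ξ.scale y) : ℝ) : ℂ) * G (x, y) a b
      - rotAct (ξ.rot x) (fun a' => G (x, y) a' b) a
      - rotAct (ξ.rot y) (fun b' => G (x, y) a b') b = 0
  /-- invariance under the inversion -/
  inversion_invariant : ∀ x y : Pt d, (x, y) ∈ U → sq x ≠ 0 → sq y ≠ 0 →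
    (inversion x, inversion y) ∈ U → ∀ a b : Idx d r q,
    G (inversion x, inversion y) a b =
      ((mabs x ^ (2 * Δ) * mabs y ^ (2 * Δ) : ℝ) : ℂ) *
        ∑ a' : Idx d r q, ∑ b' : Idx d r q,
          ((invAct x a a' * invAct y b b' : ℝ) : ℂ) * G (x, y) a' b'

/-! ### The numerator `Π` -/

/-- `S_{i_1 … i_t | j_1 … j_t} = I_{(i_1 j_1} ⋯ I_{i_t) j_t}`, with unit weight. -/
def symBlock {d t : ℕ} (x : Pt d) (i j : Fin t → Fin d) : ℝ :=
  ((t.factorial : ℝ))⁻¹ * ∑ σ : Equiv.Perm (Fin t), ∏ k, invMat x (i (σ k)) (j k)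

/-- `A_{m_1 … m_t | n_1 … n_t} = I_{[m_1 n_1} ⋯ I_{m_t] n_t}`, with unit weight. -/
def altBlock {d t : ℕ} (x : Pt d) (m n : Fin t → Fin d) : ℝ :=
  ((t.factorial : ℝ))⁻¹ *
    ∑ σ : Equiv.Perm (Fin t), ((Equiv.Perm.sign σ : ℤ) : ℝ) * ∏ k, invMat x (m (σ k)) (n k)

/-- The term without traces,
`S_{(i_1 … i_{s-1} | (j_1 … j_{s-1}} A_{i_s) m_1 … m_{p-1} | j_s) n_1 … n_{p-1}}`. -/
def leading {d r q : ℕ} (x : Pt d) (a b : Idx d r q) : ℝ :=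
  (((r + 1).factorial : ℝ) ^ 2)⁻¹ *
    ∑ σ : Equiv.Perm (Fin (r + 1)), ∑ τ : Equiv.Perm (Fin (r + 1)),
      symBlock x (fun k : Fin r => a (Sum.inl (σ k.castSucc)))
          (fun k : Fin r => b (Sum.inl (τ k.castSucc))) *
        altBlock x
          (Fin.cons (a (Sum.inl (σ (Fin.last r)))) (fun k : Fin q => a (Sum.inr k)) :
            Fin (q + 1) → Fin d)
          (Fin.cons (b (Sum.inl (τ (Fin.last r)))) (fun k : Fin q => b (Sum.inr k)) :
            Fin (q + 1) → Fin d)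

/-- Product over a complete pairing of the indices of both fields: a pair of indices of the same
field contributes `η`, a pair with one index of each field contributes `I`. The pairing joins
`e (inl k)` with `e (inr k)`. -/
def pairingTerm {d r q : ℕ} (e : Equiv.Perm (Pos r q ⊕ Pos r q)) (x : Pt d)
    (a b : Idx d r q) : ℝ :=
  ∏ k : Pos r q,
    if (e (Sum.inl k)).isLeft = (e (Sum.inr k)).isLeft then
      metric (Sum.elim a b (e (Sum.inl k))) (Sum.elim a b (e (Sum.inr k)))
    else
      invMat x (Sum.elim a b (e (Sum.inl k))) (Sum.elim a b (e (Sum.inr k)))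

/-- The `η`-terms: linear combinations, with constant coefficients, of products of `η`'s and `I`'s
in which at least one `η` carries two indices of the same field. -/
def etaTerms (d r q : ℕ) : Submodule ℝ (Pt d → Idx d r q → Idx d r q → ℝ) :=
  Submodule.span ℝ {f | ∃ e : Equiv.Perm (Pos r q ⊕ Pos r q),
    (∃ k, (e (Sum.inl k)).isLeft = (e (Sum.inr k)).isLeft) ∧ f = pairingTerm e}

/-- `Pi = S A + η`-terms, with the `η`-terms such that `Pi` is a traceless hook tensor in either
group of indices. -/
structure IsNumerator {d r q : ℕ} (Pi : Pt d → Idx d r q → Idx d r q → ℝ) : Prop where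
  eta_terms : Pi - leading ∈ etaTerms d r q
  hook_left : ∀ x, sq x ≠ 0 → ∀ b, IsTracelessHook (fun a => Pi x a b)
  hook_right : ∀ x, sq x ≠ 0 → ∀ a, IsTracelessHook (fun b => Pi x a b)

/-! ### The simplest hook -/

/-- The multi-index `(i j, k)` of a tensor of type `{2, 2}`. -/
def hookIdx {d : ℕ} (i j k : Fin d) : Idx d 1 1 := Sum.elim ![i, j] ![k]

/-- The trace part `T_{ij,k|mn,l}`. -/
def hookTrace {d : ℕ} (x : Pt d) (i j k m n l : Fin d) : ℝ :=
  metric i j * metric m n * invMat x k l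
    - 1 / 2 * metric m n * (metric i k * invMat x j l + metric j k * invMat x i l)
    - 1 / 2 * metric i j * metric m l * invMat x k n
    + 1 / 4 * metric m l * (metric i k * invMat x j n + metric j k * invMat x i n)
    - 1 / 2 * metric i j * metric n l * invMat x k m
    + 1 / 4 * metric n l * (metric i k * invMat x j m + metric j k * invMat x i m)

/-- The numerator `Π_{ij,k|mn,l}` for type `{2, 2}`. -/
def hookNumerator {d : ℕ} (x : Pt d) (i j k m n l : Fin d) : ℝ :=
  (invMat x i m * invMat x j n + invMat x i n * invMat x j m) * invMat x k l
    - 1 / 2 * (invMat x i m * invMat x k n + invMat x i n * invMat x k m) * invMat x j l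
    - 1 / 2 * (invMat x j m * invMat x k n + invMat x j n * invMat x k m) * invMat x i l
    - 2 / ((d : ℝ) - 1) * hookTrace x i j k m n l

end HookCFT

end

open scoped BigOperators

noncomputable section

namespace HookCFT

/-! ### Minkowski geometry -/

/-! Tensors are evaluated on vectors (`ev`), so that the inversion matrix `I(x)` becomes the
reflection `refl x` along `x` and all index manipulations become multilinear algebra. A pairing at
the point `x` is the same pairing at the origin with the second group of vectors reflected along `x`
(`ev_ev_of_mem`). A numerator is therefore encoded by the constant tensor `Pi 0`, which is invariant
under infinitesimal Lorentz transformations and under all reflections.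

The numerator. Equip arrays of components with the positive definite Euclidean product. Contraction
of two positions is, up to a factor, adjoint to multiplication by the metric (`sum_mul_metric`).
Hence a combination of η-terms that is traceless in the first group is orthogonal to itself and
vanishes, which gives uniqueness (`eq_zero_of_mem_etaTerms`). For existence, subtract from the
leading term its orthogonal projection to the η-terms. The result is traceless by the same
adjointness, and it keeps every permutation symmetry because permutations within the groups preserve
the η-terms and their orthogonal complement (`exists_traceless`). It is nonzero because on the flags
`(n₊,…,n₊; e_J)` and `(n₋,…,n₋; e_J)` of a light-cone frame all η-terms vanish, while the leading
term does not (`IsNumerator.flag_ne_zero`).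

Rigidity. A highest-weight argument shows that an invariant tensor of hook type in both groups
vanishes once this one flag component does (`eq_zero_of_flag_eq_zero`). Boost weights, axis flips
and axis permutations first give vanishing on all transverse null flags. Null rotations combined
with the trace conditions then reach all other arguments (`MHook.eq_zero_of_null_flag`). So
invariant tensors are multiples of `Pi 0` (`IsNumerator.eq_mul`).

The two-point function. Multiply `G` by `|x-y|^{2Δ}` and reflect the second group along `x-y`. Since
`I(x-y)` intertwines the local rotations at the two points (`reflDeriv_eq`), the Ward identity says
that the derivative of this `normalized` function along a Killing vector is the rotation by `ω_ξ(x)`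
of both groups. Every displacement is realized by a Killing vector with `ω_ξ(x) = 0`
(`exists_killing`), so the function is locally constant; comparison with pure rotations then makes
it Lorentz invariant. The inversion adds invariance under reflections
(`IsConformalTwoPoint.reflInvariant`), so rigidity identifies the function with `C · Pi 0` at one
displacement. Segments and inversions carry the same constant to all of `U`, including its different
connected components (`Propagates`). The converse runs the same computation backwards from the
constant tensor `C · Pi 0`.

For type `{2,2}` the explicit formula is a leading term plus η-terms with the required symmetries,
so uniqueness identifies it. -/

theorem eta_mul_self {d : ℕ} (m : Fin d) : eta m * eta m = 1 := by
  unfold eta; split_ifs <;> norm_num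

/-- The Minkowski inner product. -/
def dot {d : ℕ} (x y : Pt d) : ℝ := ∑ m, low x m * y m

theorem dot_self {d : ℕ} (x : Pt d) : dot x x = sq x := rfl

theorem dot_comm {d : ℕ} (x y : Pt d) : dot x y = dot y x := by
  simp only [dot, low]; exact Finset.sum_congr rfl fun m _ => by ring

theorem dot_add_right {d : ℕ} (x y z : Pt d) : dot x (y + z) = dot x y + dot x z := by
  simp [dot, mul_add, Finset.sum_add_distrib]

theorem dot_smul_right {d : ℕ} (c : ℝ) (x y : Pt d) : dot x (c • y) = c * dot x y := by
  simp only [dot, Finset.mul_sum, Pi.smul_apply, smul_eq_mul]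
  exact Finset.sum_congr rfl fun m _ => by ring

theorem dot_add_left {d : ℕ} (x y z : Pt d) : dot (x + y) z = dot x z + dot y z := by
  rw [dot_comm, dot_add_right, dot_comm z x, dot_comm z y]

theorem dot_smul_left {d : ℕ} (c : ℝ) (x y : Pt d) : dot (c • x) y = c * dot x y := by
  rw [dot_comm, dot_smul_right, dot_comm]

theorem dot_neg_right {d : ℕ} (x y : Pt d) : dot x (-y) = -dot x y := by
  simpa using dot_smul_right (-1) x y

theorem dot_neg_left {d : ℕ} (x y : Pt d) : dot (-x) y = -dot x y := by
  simpa using dot_smul_left (-1) x y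

theorem dot_sub_right {d : ℕ} (x y z : Pt d) : dot x (y - z) = dot x y - dot x z := by
  rw [sub_eq_add_neg, dot_add_right, dot_neg_right, sub_eq_add_neg]

theorem dot_sub_left {d : ℕ} (x y z : Pt d) : dot (x - y) z = dot x z - dot y z := by
  rw [sub_eq_add_neg, dot_add_left, dot_neg_left, sub_eq_add_neg]

theorem dot_zero_right {d : ℕ} (x : Pt d) : dot x 0 = 0 := by simp [dot]

theorem sq_smul {d : ℕ} (c : ℝ) (x : Pt d) : sq (c • x) = c ^ 2 * sq x := by
  rw [← dot_self, dot_smul_left, dot_smul_right, dot_self]; ring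

/-- The standard basis vectors. -/
abbrev bas {d : ℕ} (n : Fin d) : Pt d := Pi.single n 1

theorem dot_bas {d : ℕ} (x : Pt d) (n : Fin d) : dot x (bas n) = low x n := by
  simp [dot, Pi.single_apply]

theorem dot_bas_bas {d : ℕ} (m n : Fin d) : dot (bas m) (bas n) = metric m n := by
  rw [dot_bas, low, metric]
  by_cases h : m = n
  · subst h; simp
  · simp [h, Ne.symm h]

theorem sum_eta_low_bas {d : ℕ} (x : Pt d) : ∑ n, (eta n * low x n) • bas n = x := by
  ext m
  simp only [Finset.sum_apply, Pi.smul_apply, smul_eq_mul, low, Pi.single_apply]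
  simp [← mul_assoc, eta_mul_self]

theorem eq_sum_bas {d : ℕ} (x : Pt d) : x = ∑ n, x n • bas n := by
  ext m; simp [Finset.sum_apply, Pi.single_apply]

/-- The reflection along `x`; it is the identity if `x² = 0`. -/
def refl {d : ℕ} (x : Pt d) : Pt d →ₗ[ℝ] Pt d where
  toFun u := u - (2 * dot x u / sq x) • x
  map_add' u v := by
    rw [dot_add_right]; ext m; simp; ring
  map_smul' c u := by
    rw [dot_smul_right]; ext m; simp; ring

theorem refl_apply {d : ℕ} (x u : Pt d) : refl x u = u - (2 * dot x u / sq x) • x := rfl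

theorem refl_of_sq_eq_zero {d : ℕ} {x : Pt d} (h : sq x = 0) (u : Pt d) : refl x u = u := by
  simp [refl_apply, h]

theorem refl_zero {d : ℕ} (u : Pt d) : refl 0 u = u := by
  simp [refl_apply]

theorem dot_refl_refl {d : ℕ} (x u v : Pt d) : dot (refl x u) (refl x v) = dot u v := by
  by_cases h : sq x = 0
  · rw [refl_of_sq_eq_zero h, refl_of_sq_eq_zero h]
  · simp only [refl_apply, dot_sub_left, dot_sub_right, dot_smul_left, dot_smul_right, dot_self,
      dot_comm u x]
    field_simp; ring

theorem refl_refl {d : ℕ} (x u : Pt d) : refl x (refl x u) = u := by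
  by_cases h : sq x = 0
  · rw [refl_of_sq_eq_zero h, refl_of_sq_eq_zero h]
  · simp only [refl_apply, dot_sub_right, dot_smul_right, dot_self]
    ext m; simp; field_simp; ring

theorem refl_smul {d : ℕ} {c : ℝ} (hc : c ≠ 0) (x u : Pt d) : refl (c • x) u = refl x u := by
  by_cases h : sq x = 0
  · rw [refl_of_sq_eq_zero h, refl_of_sq_eq_zero (by rw [sq_smul, h, mul_zero])]
  · simp only [refl_apply, dot_smul_left, sq_smul]
    ext m; simp only [Pi.sub_apply, Pi.smul_apply, smul_eq_mul]; field_simp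

theorem refl_of_dot_eq_zero {d : ℕ} {x u : Pt d} (h : dot x u = 0) : refl x u = u := by
  simp [refl_apply, h]

/-- `refl x` is given by the matrix `I_m{}^n(x)`, acting from the right on rows. -/
theorem refl_eq_sum {d : ℕ} (x u : Pt d) (n : Fin d) :
    refl x u n = ∑ m, u m * (invMat x m n * eta n) := by
  simp only [refl_apply, invMat, metric, low, dot, Pi.sub_apply, Pi.smul_apply, smul_eq_mul,
    sub_mul, mul_sub, Finset.sum_sub_distrib]
  congr 1
  · simp [ite_mul, eta_mul_self]
  · rw [Finset.mul_sum, Finset.sum_div, Finset.sum_mul]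
    refine Finset.sum_congr rfl fun m _ => ?_
    have := eta_mul_self n
    linear_combination (- (u m * 2 * eta m * x m * x n) / sq x) * this

theorem dot_refl_comm {d : ℕ} (x u v : Pt d) : dot u (refl x v) = dot (refl x u) v := by
  rw [← dot_refl_refl x, refl_refl]

theorem sq_inversion {d : ℕ} {x : Pt d} (h : sq x ≠ 0) : sq (inversion x) = (sq x)⁻¹ := by
  have : inversion x = (sq x)⁻¹ • x := by ext m; simp [inversion]; ring
  rw [this, sq_smul]; field_simp

theorem inversion_eq_smul {d : ℕ} (x : Pt d) : inversion x = (sq x)⁻¹ • x := by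
  ext m; simp [inversion]; ring

theorem sq_sub {d : ℕ} (x y : Pt d) : sq (x - y) = sq x - 2 * dot x y + sq y := by
  rw [← dot_self, dot_sub_left, dot_sub_right, dot_sub_right, dot_comm y x, dot_self, dot_self]
  ring

theorem sq_add {d : ℕ} (x y : Pt d) : sq (x + y) = sq x + 2 * dot x y + sq y := by
  rw [← dot_self, dot_add_left, dot_add_right, dot_add_right, dot_comm y x, dot_self, dot_self]
  ring

theorem sq_inversion_sub {d : ℕ} {x y : Pt d} (hx : sq x ≠ 0) (hy : sq y ≠ 0) :
    sq (inversion x - inversion y) = sq (x - y) / (sq x * sq y) := by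
  rw [sq_sub, sq_inversion hx, sq_inversion hy, inversion_eq_smul, inversion_eq_smul,
    dot_smul_left, dot_smul_right, sq_sub]
  field_simp; ring

/-- The inversion matrix of a difference of inverted points factorizes. -/
theorem refl_inversion_sub {d : ℕ} {x y : Pt d} (hx : sq x ≠ 0) (hy : sq y ≠ 0)
    (hz : sq (x - y) ≠ 0) (u : Pt d) :
    refl (inversion x - inversion y) u = refl y (refl (x - y) (refl x u)) := by
  have hw := sq_inversion_sub hx hy
  simp only [refl_apply, hw]
  simp only [inversion_eq_smul, dot_sub_left, dot_sub_right, dot_smul_left, dot_smul_right,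
    dot_self, dot_comm y x]
  have hz' := hz
  rw [sq_sub] at hz' ⊢
  generalize dot x u = p at *
  generalize dot y u = p' at *
  generalize dot x y = c at *
  generalize sq x = X at *
  generalize sq y = Y at *
  ext m
  simp only [Pi.sub_apply, Pi.smul_apply, smul_eq_mul]
  field_simp
  ring

/-- The infinitesimal transformation of contravariant vectors dual to `ω_{mn}`. -/
def gen {d : ℕ} (ω : Fin d → Fin d → ℝ) : Pt d →ₗ[ℝ] Pt d where
  toFun u := fun n => ∑ m, u m * (ω m n * eta n)
  map_add' u v := by ext n; simp [add_mul, Finset.sum_add_distrib]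
  map_smul' c u := by ext n; simp [Finset.mul_sum, mul_assoc]

theorem gen_apply {d : ℕ} (ω : Fin d → Fin d → ℝ) (u : Pt d) (n : Fin d) :
    gen ω u n = ∑ m, u m * (ω m n * eta n) := rfl

theorem dot_gen {d : ℕ} {ω : Fin d → Fin d → ℝ} (h : ∀ m n, ω m n = -ω n m) (u v : Pt d) :
    dot (gen ω u) v + dot u (gen ω v) = 0 := by
  simp only [dot, low, gen_apply, Finset.mul_sum, Finset.sum_mul]
  rw [Finset.sum_comm, ← Finset.sum_add_distrib]
  refine Finset.sum_eq_zero fun m _ => ?_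
  rw [← Finset.sum_add_distrib]
  refine Finset.sum_eq_zero fun n _ => ?_
  rw [h n m]
  linear_combination (u m * v n * ω m n) * eta_mul_self n - (u m * v n * ω m n) * eta_mul_self m

/-- The generator `p ∧ p'`. -/
def wedge {d : ℕ} (p p' : Pt d) (m n : Fin d) : ℝ := low p m * low p' n - low p' m * low p n

theorem wedge_antisymm {d : ℕ} (p p' : Pt d) (m n : Fin d) :
    wedge p p' m n = -wedge p p' n m := by simp only [wedge]; ring

theorem gen_wedge {d : ℕ} (p p' u : Pt d) :
    gen (wedge p p') u = dot p u • p' - dot p' u • p := by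
  ext n
  simp only [gen_apply, wedge, dot, Pi.sub_apply, Pi.smul_apply, smul_eq_mul, Finset.sum_mul,
    ← Finset.sum_sub_distrib]
  refine Finset.sum_congr rfl fun m _ => ?_
  simp only [low]
  linear_combination (u m * eta m * p m * p' n - u m * eta m * p' m * p n) * eta_mul_self n

/-! ### Evaluation of tensors on vectors -/

section Evaluation

variable {d : ℕ} {P : Type*} [Fintype P] [DecidableEq P] {E : Type*} [AddCommGroup E] [Module ℝ E]

/-- The multilinear map with components `T`. -/
def ev (T : (P → Fin d) → E) : MultilinearMap ℝ (fun _ : P => Pt d) E :=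
  ∑ a : P → Fin d, ((MultilinearMap.mkPiAlgebra ℝ P ℝ).compLinearMap
    (fun k => (LinearMap.proj (a k) : Pt d →ₗ[ℝ] ℝ))).smulRight (T a)

theorem ev_apply (T : (P → Fin d) → E) (u : P → Pt d) :
    ev T u = ∑ a : P → Fin d, (∏ k, u k (a k)) • T a := by
  simp [ev]

theorem ev_bas (T : (P → Fin d) → E) (a : P → Fin d) : ev T (fun k => bas (a k)) = T a := by
  rw [ev_apply, Finset.sum_eq_single a]
  · simp
  · intro b _ hb
    obtain ⟨k, hk⟩ := Function.ne_iff.1 hb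
    rw [Finset.prod_eq_zero (Finset.mem_univ k), zero_smul]
    simp [hk]
  · simp

theorem ev_injective {T T' : (P → Fin d) → E} (h : ∀ u, ev T u = ev T' u) : T = T' := by
  ext a; rw [← ev_bas T, h, ev_bas]

theorem ev_map {E' : Type*} [AddCommGroup E'] [Module ℝ E'] (f : E →ₗ[ℝ] E')
    (T : (P → Fin d) → E) (u : P → Pt d) : ev (fun a => f (T a)) u = f (ev T u) := by
  simp [ev_apply, map_sum]

theorem ev_add (T T' : (P → Fin d) → E) (u : P → Pt d) :
    ev (fun a => T a + T' a) u = ev T u + ev T' u := by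
  simp [ev_apply, smul_add, Finset.sum_add_distrib]

theorem ev_sum {ι : Type*} (s : Finset ι) (T : ι → (P → Fin d) → E) (u : P → Pt d) :
    ev (fun a => ∑ i ∈ s, T i a) u = ∑ i ∈ s, ev (T i) u := by
  simp only [ev_apply, Finset.smul_sum]
  exact Finset.sum_comm

theorem ev_zero (u : P → Pt d) : ev (fun _ => (0 : E)) u = 0 := by simp [ev_apply]

theorem ev_comp_perm (T : (P → Fin d) → E) (π : Equiv.Perm P) (u : P → Pt d) :
    ev (fun a => T (a ∘ π)) u = ev T (u ∘ π) := by
  rw [ev_apply, ev_apply]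
  refine Fintype.sum_equiv (Equiv.arrowCongr π.symm (Equiv.refl _)) _ _ fun a => ?_
  have h : (Equiv.arrowCongr π.symm (Equiv.refl (Fin d))) a = a ∘ π := by
    ext k; simp [Equiv.arrowCongr]
  rw [h]
  congr 1
  exact (Fintype.prod_equiv π _ _ fun k => by simp).symm

theorem ev_update_bas (T : (P → Fin d) → E) (u : P → Pt d) (j : P) (n m : Fin d) :
    ev T (Function.update u j (bas n)) =
      ev (fun a => T (Function.update a j n)) (Function.update u j (bas m)) := by
  rw [ev_apply, ev_apply]
  have hinv : Function.Involutive
      (fun a : P → Fin d => Function.update a j (Equiv.swap n m (a j))) := by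
    intro a; simp
  refine Fintype.sum_equiv hinv.toPerm _ _ fun a => ?_
  have h1 : ∀ (w : Pt d) (a : P → Fin d), ∏ k, Function.update u j w k (a k) =
      w (a j) * ∏ k ∈ Finset.univ.erase j, u k (a k) := by
    intro w a
    rw [← Finset.mul_prod_erase _ _ (Finset.mem_univ j)]
    congr 1
    · simp
    · exact Finset.prod_congr rfl fun k hk => by rw [Function.update_of_ne (Finset.ne_of_mem_erase hk)]
  rw [h1, h1]
  simp only [Function.Involutive.coe_toPerm, Function.update_self, Function.update_idem]
  by_cases han : a j = n
  · have : Function.update a j n = a := by rw [← han]; exact Function.update_eq_self j a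
    rw [this, han, Equiv.swap_apply_left]
    congr 1
    simp only [bas, Pi.single_eq_same]
    congr 1
    exact Finset.prod_congr rfl fun k hk => by rw [Function.update_of_ne (Finset.ne_of_mem_erase hk)]
  · have : Equiv.swap n m (a j) ≠ m := by
      intro h
      apply han
      exact (Equiv.swap n m).injective (h.trans (Equiv.swap_apply_left n m).symm)
    simp [han, this]

/-- A multilinear map that vanishes on tuples of generators vanishes on tuples from the spans. -/
theorem eq_zero_of_mem_span (F : MultilinearMap ℝ (fun _ : P => Pt d) E) (S : P → Set (Pt d))
    (h : ∀ u : P → Pt d, (∀ k, u k ∈ S k) → F u = 0) (u : P → Pt d)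
    (hu : ∀ k, u k ∈ Submodule.span ℝ (S k)) : F u = 0 := by
  have key : ∀ (A : Finset P) (u : P → Pt d), (∀ k ∈ A, u k ∈ Submodule.span ℝ (S k)) →
      (∀ k ∉ A, u k ∈ S k) → F u = 0 := by
    intro A
    induction A using Finset.induction_on with
    | empty => exact fun u _ h2 => h u fun k => h2 k (Finset.notMem_empty k)
    | insert i A hi ih =>
      intro u h1 h2
      have h3 : ∀ w ∈ Submodule.span ℝ (S i), F (Function.update u i w) = 0 := by
        intro w hw
        induction hw using Submodule.span_induction with
        | mem w hw =>
          refine ih _ (fun k hk => ?_) fun k hk => ?_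
          · rw [Function.update_of_ne (fun e : k = i => hi (e ▸ hk))]
            exact h1 k (Finset.mem_insert_of_mem hk)
          · by_cases hki : k = i
            · subst hki; simpa using hw
            · rw [Function.update_of_ne hki]
              exact h2 k (by simp [hki, hk])
        | zero => exact F.map_update_zero u i
        | add w w' _ _ e e' => rw [F.map_update_add, e, e', add_zero]
        | smul c w _ e => rw [F.map_update_smul, e, smul_zero]
      simpa using h3 (u i) (h1 i (Finset.mem_insert_self i A))
  exact key Finset.univ u (fun k _ => hu k) fun k hk => absurd (Finset.mem_univ k) hk

/-- Evaluation in two slots as a bilinear map. -/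
def twoSlot (F : MultilinearMap ℝ (fun _ : P => Pt d) E) (u : P → Pt d) {j j' : P} (h : j ≠ j') :
    Pt d →ₗ[ℝ] Pt d →ₗ[ℝ] E :=
  LinearMap.mk₂ ℝ (fun p p' => F (Function.update (Function.update u j p) j' p'))
    (fun p q p' => by
      simp only [Function.update_comm h]; rw [F.map_update_add])
    (fun c p p' => by
      simp only [Function.update_comm h]; rw [F.map_update_smul])
    (fun p p' q' => by rw [F.map_update_add])
    (fun c p p' => by rw [F.map_update_smul])

theorem twoSlot_apply {Q : Type*} [DecidableEq Q] (F : MultilinearMap ℝ (fun _ : Q => Pt d) E)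
    (u : Q → Pt d) {j k : Q}
    (h : j ≠ k) (p w : Pt d) :
    twoSlot F u h p w = F (Function.update (Function.update u j p) k w) := rfl

/-- The trace of a bilinear map is invariant under reflections. -/
theorem trace_refl (B : Pt d →ₗ[ℝ] Pt d →ₗ[ℝ] E) (x : Pt d) :
    ∑ n, eta n • B (refl x (bas n)) (refl x (bas n)) = ∑ n, eta n • B (bas n) (bas n) := by
  by_cases hx : sq x = 0
  · simp only [refl_of_sq_eq_zero hx]
  have h1 : ∑ n, (eta n * low x n) • B (bas n) x = B x x := by
    have := congrArg (fun y => B y x) (sum_eta_low_bas x)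
    simpa only [map_sum, map_smul, LinearMap.sum_apply, LinearMap.smul_apply] using this
  have h2 : ∑ n, (eta n * low x n) • B x (bas n) = B x x := by
    have := congrArg (fun y => B x y) (sum_eta_low_bas x)
    simpa only [map_sum, map_smul] using this
  have h3 : ∑ n, (eta n * low x n * low x n) = sq x := by
    rw [sq]; refine Finset.sum_congr rfl fun n _ => ?_
    simp only [low]; linear_combination (x n * x n * eta n) * eta_mul_self n
  -- After summation the two cross terms give `-(4/x²) B(x,x)` and the quadratic term gives `+(4/x²)
  -- B(x,x)`.
  have : ∀ n, eta n • B (refl x (bas n)) (refl x (bas n)) = eta n • B (bas n) (bas n)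
      - (2 / sq x) • ((eta n * low x n) • B (bas n) x) - (2 / sq x) • ((eta n * low x n) • B x (bas n))
      + ((4 / sq x ^ 2) * (eta n * low x n * low x n)) • B x x := by
    intro n
    simp only [refl_apply, dot_bas, map_sub, map_smul, LinearMap.sub_apply, LinearMap.smul_apply]
    module
  simp only [this, Finset.sum_add_distrib, Finset.sum_sub_distrib, ← Finset.smul_sum,
    ← Finset.sum_smul, ← Finset.mul_sum, h1, h2, h3]
  rw [sub_sub, ← add_smul, sub_add, ← sub_smul]
  have : 2 / sq x + 2 / sq x - 4 / sq x ^ 2 * sq x = 0 := by field_simp; ring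
  rw [this, zero_smul, sub_zero]

end Evaluation

/-! ### Multilinear maps of hook type -/

section Hook

variable {d r q : ℕ} {E : Type*} [AddCommGroup E] [Module ℝ E]

/-- The multilinear version of `IsTracelessHook`. -/
structure MHook (F : MultilinearMap ℝ (fun _ : Pos r q => Pt d) E) : Prop where
  symm : ∀ (σ : Equiv.Perm (Fin (r + 1))) (u : Pos r q → Pt d), F (u ∘ Sum.map σ id) = F u
  antisymm : ∀ (τ : Equiv.Perm (Fin q)) (u : Pos r q → Pt d),
    F (u ∘ Sum.map id τ) = (Equiv.Perm.sign τ : ℤ) • F u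
  young : ∀ (k : Fin q) (u : Pos r q → Pt d),
    F u + ∑ j : Fin (r + 1), F (u ∘ Equiv.swap (Sum.inl j) (Sum.inr k)) = 0
  traceless : ∀ (j j' : Fin (r + 1)), j ≠ j' → ∀ u : Pos r q → Pt d,
    ∑ n : Fin d, eta n •
      F (Function.update (Function.update u (Sum.inl j) (bas n)) (Sum.inl j') (bas n)) = 0

theorem IsTracelessHook.mhook {T : Idx d r q → E} (h : IsTracelessHook T) : MHook (ev T) where
  symm σ u := by
    have := ev_comp_perm T (Equiv.sumCongr σ (Equiv.refl (Fin q))) u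
    exact this.symm.trans (congrArg (fun S => ev S u) (funext (h.symm σ)))
  antisymm τ u := by
    have := ev_comp_perm T (Equiv.sumCongr (Equiv.refl (Fin (r + 1))) τ) u
    refine this.symm.trans ((congrArg (fun S => ev S u) (funext (h.antisymm τ))).trans ?_)
    exact ev_map (((Equiv.Perm.sign τ : ℤ)) • (LinearMap.id : E →ₗ[ℝ] E)) T u
  young k u := by
    rw [← ev_zero u, ← funext (h.young k), ev_add, ev_sum]
    simp only [ev_comp_perm]
  traceless j j' hj u := by
    have hj' : (Sum.inl j : Pos r q) ≠ Sum.inl j' := fun e => hj (Sum.inl_injective e)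
    rcases Nat.eq_zero_or_pos d with hd | hd
    · subst hd; simp
    let m : Fin d := ⟨0, hd⟩
    have h1 : ∀ n, ev T (Function.update (Function.update u (Sum.inl j) (bas n)) (Sum.inl j')
        (bas n)) = ev (fun a => T (Function.update (Function.update a (Sum.inl j) n) (Sum.inl j') n))
          (Function.update (Function.update u (Sum.inl j) (bas m)) (Sum.inl j') (bas m)) := by
      intro n
      rw [ev_update_bas T _ _ n m, Function.update_comm hj', ev_update_bas _ _ _ n m,
        Function.update_comm hj'.symm]
    simp only [h1]
    rw [← ev_zero (Function.update (Function.update u (Sum.inl j) (bas m)) (Sum.inl j') (bas m)),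
      ← funext (h.traceless j j' hj), ev_sum]
    refine Finset.sum_congr rfl fun n _ => ?_
    exact (ev_map (eta n • (LinearMap.id : E →ₗ[ℝ] E)) _ _).symm

theorem MHook.isTracelessHook {T : Idx d r q → E} (h : MHook (ev T)) : IsTracelessHook T where
  symm σ a := by
    have := h.symm σ (fun k => bas (a k))
    rw [ev_bas] at this
    rw [← this, ← ev_bas T]; rfl
  antisymm τ a := by
    have := h.antisymm τ (fun k => bas (a k))
    rw [ev_bas] at this
    rw [← this, ← ev_bas T]; rfl
  young k a := by
    have := h.young k (fun k => bas (a k))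
    rw [ev_bas] at this
    rw [← this]
    congr 1
    exact Finset.sum_congr rfl fun j _ => (ev_bas T _).symm
  traceless j j' hj a := by
    rw [← h.traceless j j' hj (fun k => bas (a k))]
    refine Finset.sum_congr rfl fun n _ => ?_
    rw [← ev_bas T]
    congr 2
    ext1 k
    rcases eq_or_ne k (Sum.inl j') with rfl | h1
    · simp
    · rcases eq_or_ne k (Sum.inl j) with rfl | h2
      · simp [h1]
      · simp [h1, h2]

theorem mhook_ev_iff {T : Idx d r q → E} : MHook (ev T) ↔ IsTracelessHook T :=
  ⟨MHook.isTracelessHook, IsTracelessHook.mhook⟩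

variable {F : MultilinearMap ℝ (fun _ : Pos r q => Pt d) E}

theorem eq_zero_of_two_smul {x : E} (h : x + x = 0) : x = 0 := by
  have : (2 : ℝ) • x = 0 := by rw [two_smul]; exact h
  exact (smul_eq_zero.1 this).resolve_left two_ne_zero

theorem MHook.swap_right (h : MHook F) {k k' : Fin q} (hk : k ≠ k') (u : Pos r q → Pt d) :
    F (u ∘ Equiv.swap (Sum.inr k) (Sum.inr k')) = -F u := by
  have := h.antisymm (Equiv.swap k k') u
  rw [Equiv.Perm.sign_swap hk] at this
  have e : (Sum.map id (Equiv.swap k k') : Pos r q → Pos r q) =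
      Equiv.swap (Sum.inr k) (Sum.inr k') := by
    ext1 x
    rcases x with i | i
    · rw [Equiv.swap_apply_of_ne_of_ne (by simp) (by simp)]; rfl
    · simp only [Sum.map_inr, Equiv.swap_apply_def, Sum.inr.injEq]
      split_ifs <;> rfl
  rw [e] at this
  simpa using this

theorem MHook.swap_left (h : MHook F) (i i' : Fin (r + 1)) (u : Pos r q → Pt d) :
    F (u ∘ Equiv.swap (Sum.inl i) (Sum.inl i')) = F u := by
  have := h.symm (Equiv.swap i i') u
  have e : (Sum.map (Equiv.swap i i') id : Pos r q → Pos r q) =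
      Equiv.swap (Sum.inl i) (Sum.inl i') := by
    ext1 x
    rcases x with i | i
    · simp only [Sum.map_inl, Equiv.swap_apply_def, Sum.inl.injEq]
      split_ifs <;> rfl
    · rw [Equiv.swap_apply_of_ne_of_ne (by simp) (by simp)]; rfl
  rwa [e] at this

theorem comp_swap_of_eq {P X : Type*} [DecidableEq P] {u : P → X} {i j : P} (h : u i = u j) :
    u ∘ Equiv.swap i j = u := by
  ext1 k
  simp only [Function.comp, Equiv.swap_apply_def]
  split_ifs with h1 h2
  · rw [h1, h]
  · rw [h2, h]
  · rfl

theorem MHook.eq_zero_of_right_eq (h : MHook F) {k k' : Fin q} (hk : k ≠ k') {u : Pos r q → Pt d}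
    (hu : u (Sum.inr k) = u (Sum.inr k')) : F u = 0 := by
  have := h.swap_right hk u
  rw [comp_swap_of_eq hu] at this
  exact eq_zero_of_two_smul (by nth_rewrite 1 [this]; exact neg_add_cancel _)

/-- All `r + 2` terms of the Young relation coincide. -/
theorem MHook.eq_zero_of_left_eq (h : MHook F) {k : Fin q} {u : Pos r q → Pt d}
    (hu : ∀ i, u (Sum.inl i) = u (Sum.inr k)) : F u = 0 := by
  have := h.young k u
  simp only [comp_swap_of_eq (hu _), Finset.sum_const, Finset.card_univ, Fintype.card_fin] at this
  have h2 : ((r : ℝ) + 2) • F u = 0 := by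
    rw [← this, ← Nat.cast_smul_eq_nsmul ℝ]; push_cast; module
  exact (smul_eq_zero.1 h2).resolve_left (by positivity)

/-- If all but one of the indices of the first group agree with `u (inr k)`, the exceptional one
can be moved to the second group. -/
theorem MHook.move (h : MHook F) {k : Fin q} {i₀ : Fin (r + 1)} {u : Pos r q → Pt d}
    (hu : ∀ i ≠ i₀, u (Sum.inl i) = u (Sum.inr k)) :
    ((r : ℝ) + 1) • F u = -F (u ∘ Equiv.swap (Sum.inl i₀) (Sum.inr k)) := by
  have := h.young k u
  rw [← Finset.add_sum_erase _ _ (Finset.mem_univ i₀),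
    Finset.sum_congr rfl fun i hi => by rw [comp_swap_of_eq (hu i (Finset.ne_of_mem_erase hi))],
    Finset.sum_const, Finset.card_erase_of_mem (Finset.mem_univ _), Finset.card_univ,
    Fintype.card_fin, Nat.add_sub_cancel, ← Nat.cast_smul_eq_nsmul ℝ] at this
  rw [eq_neg_iff_add_eq_zero, ← this]
  module

/-- Place the contracted pair in two symmetric slots `j`, `j'` and the vector of slot `j'` in slot
`k`, then contract the Young relation. Only the exchanges of `k` with `j` and with `j'` survive, and
these agree by symmetry, so twice the mixed trace vanishes. If `j` is the only symmetric slot, each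
term vanishes separately by the Young relation. -/
theorem MHook.traceless_mixed (h : MHook F) (j : Fin (r + 1)) (k : Fin q) (u : Pos r q → Pt d) :
    ∑ n : Fin d, eta n •
      F (Function.update (Function.update u (Sum.inl j) (bas n)) (Sum.inr k) (bas n)) = 0 := by
  by_cases hj : ∃ j', j' ≠ j
  · obtain ⟨j', hj'⟩ := hj
    let w : Fin d → Pos r q → Pt d := fun n => Function.update (Function.update
      (Function.update u (Sum.inr k) (u (Sum.inl j'))) (Sum.inl j) (bas n)) (Sum.inl j') (bas n)
    have h1 : ∑ n, eta n • (F (w n) + ∑ i, F (w n ∘ Equiv.swap (Sum.inl i) (Sum.inr k))) = 0 := by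
      simp only [h.young, smul_zero, Finset.sum_const_zero]
    simp only [smul_add, Finset.sum_add_distrib, Finset.smul_sum] at h1
    rw [Finset.sum_comm] at h1
    have hz : ∑ i ∈ (Finset.univ.erase j).erase j',
        ∑ n, eta n • F (w n ∘ Equiv.swap (Sum.inl i) (Sum.inr k)) = 0 := by
      refine Finset.sum_eq_zero fun i hi => ?_
      simp only [Finset.mem_erase, Finset.mem_univ, and_true] at hi
      have e4 : ∀ n, w n ∘ Equiv.swap (Sum.inl i) (Sum.inr k) = Function.update (Function.update
          ((Function.update u (Sum.inr k) (u (Sum.inl j'))) ∘ Equiv.swap (Sum.inl i) (Sum.inr k))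
            (Sum.inl j) (bas n)) (Sum.inl j') (bas n) := by
        intro n
        have hji : (Sum.inl j : Pos r q) ≠ Sum.inl i := fun e => hi.2 (Sum.inl_injective e).symm
        have hji' : (Sum.inl j' : Pos r q) ≠ Sum.inl i := fun e => hi.1 (Sum.inl_injective e).symm
        simp only [w]
        rw [Function.update_comp_equiv, Function.update_comp_equiv]
        simp [Equiv.swap_apply_of_ne_of_ne, hji, hji']
      simp only [e4]
      exact h.traceless j j' hj'.symm _
    rw [h.traceless j j' hj'.symm, zero_add, ← Finset.add_sum_erase _ _ (Finset.mem_univ j),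
      ← Finset.add_sum_erase _ _ (Finset.mem_erase.2 ⟨hj', Finset.mem_univ _⟩), hz,
      add_zero] at h1
    have e1 : ∀ n, w n ∘ Equiv.swap (Sum.inl j') (Sum.inr k) =
        Function.update (Function.update u (Sum.inl j) (bas n)) (Sum.inr k) (bas n) := by
      intro n; ext1 x
      rcases x with i | i
      · rw [Function.comp, Equiv.swap_apply_def]
        by_cases hi : i = j'
        · subst hi; simp [w, hj']
        · by_cases hi' : i = j
          · subst hi'; simp [w, hj'.symm]
          · simp [w, hi, hi']
      · rw [Function.comp, Equiv.swap_apply_def]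
        by_cases hi : i = k
        · subst hi; simp [w]
        · simp [w, hi]
    have e2 : ∀ n, (w n ∘ Equiv.swap (Sum.inl j) (Sum.inr k)) ∘ Equiv.swap (Sum.inl j)
        (Sum.inl j') = w n ∘ Equiv.swap (Sum.inl j') (Sum.inr k) := by
      intro n; ext1 x
      simp only [Function.comp]
      rcases x with i | i
      · by_cases hi : i = j'
        · subst hi; simp [w]
        · by_cases hi' : i = j
          · subst hi'; simp [w, Equiv.swap_apply_of_ne_of_ne, hj'.symm, hj']
          · simp [w, Equiv.swap_apply_of_ne_of_ne, hi, hi']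
      · by_cases hi : i = k
        · subst hi
          simp [w, Equiv.swap_apply_of_ne_of_ne, hj'.symm]
        · simp [w, Equiv.swap_apply_of_ne_of_ne, hi]
    have e3 : ∀ n, F (w n ∘ Equiv.swap (Sum.inl j) (Sum.inr k)) =
        F (w n ∘ Equiv.swap (Sum.inl j') (Sum.inr k)) := by
      intro n; rw [← h.swap_left j j', e2]
    simp only [e3, e1] at h1
    exact eq_zero_of_two_smul h1
  · push Not at hj
    refine Finset.sum_eq_zero fun n _ => ?_
    rw [h.eq_zero_of_left_eq (k := k), smul_zero]
    intro i
    simp [hj i]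

/-- Permutation symmetries are unaffected by applying one map in all slots; tracelessness survives
because a reflection preserves the metric trace. -/
theorem MHook.comp_refl (h : MHook F) (x : Pt d) :
    MHook (F.compLinearMap fun _ => refl x) where
  symm σ u := h.symm σ (fun k => refl x (u k))
  antisymm τ u := h.antisymm τ (fun k => refl x (u k))
  young k u := h.young k (fun k => refl x (u k))
  traceless j j' hj u := by
    have hj' : (Sum.inl j : Pos r q) ≠ Sum.inl j' := fun e => hj (Sum.inl_injective e)
    rw [← h.traceless j j' hj (fun k => refl x (u k))]
    refine Eq.trans ?_ (trace_refl (twoSlot F (fun k => refl x (u k)) hj') x)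
    refine Finset.sum_congr rfl fun n _ => ?_
    rw [twoSlot_apply, MultilinearMap.compLinearMap_apply]
    congr 2
    ext1 k
    rcases eq_or_ne k (Sum.inl j') with rfl | h1
    · simp
    · rcases eq_or_ne k (Sum.inl j) with rfl | h2
      · simp [h1]
      · simp [h1, h2]

end Hook

/-! ### A light-cone frame -/

section LightCone

variable {D : ℕ}

/-- A null vector. -/
def nplus : Pt (D + 2) := bas 0 + bas 1

/-- The opposite null vector. -/
def nminus : Pt (D + 2) := bas 0 - bas 1

/-- The transverse basis vectors. -/
def etr (j : Fin D) : Pt (D + 2) := bas j.succ.succ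

/-- The light-cone frame. -/
def lc : Fin (D + 2) → Pt (D + 2) := Fin.cons nplus (Fin.cons nminus etr)

theorem metric_of_ne {d : ℕ} {m n : Fin d} (h : m ≠ n) : metric m n = 0 := by simp [metric, h]

theorem eta_succ {n : ℕ} (j : Fin n) : eta j.succ = 1 := by simp [eta]

theorem eta_one : eta (1 : Fin (D + 2)) = 1 := eta_succ (0 : Fin (D + 1))

theorem eta_zero : eta (0 : Fin (D + 2)) = -1 := by simp [eta]

theorem metric_self {d : ℕ} (m : Fin d) : metric m m = eta m := by simp [metric]

theorem succ_succ_ne_one (j : Fin D) : (j.succ.succ : Fin (D + 2)) ≠ 1 := by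
  intro h
  exact Fin.succ_ne_zero j (Fin.succ_injective _ h)

theorem dot_nplus_nplus : dot (nplus : Pt (D + 2)) nplus = 0 := by
  simp [nplus, dot_add_left, dot_add_right, dot_bas_bas, metric_self, eta_zero, eta_one,
    metric_of_ne]

theorem dot_nminus_nminus : dot (nminus : Pt (D + 2)) nminus = 0 := by
  simp [nminus, dot_sub_left, dot_sub_right, dot_bas_bas, metric_self, eta_zero, eta_one,
    metric_of_ne]

theorem dot_nplus_nminus : dot (nplus : Pt (D + 2)) nminus = -2 := by
  simp [nplus, nminus, dot_add_left, dot_sub_right, dot_bas_bas, metric_self, eta_zero, eta_one,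
    metric_of_ne]
  norm_num

theorem dot_nminus_nplus : dot (nminus : Pt (D + 2)) nplus = -2 := by
  rw [dot_comm, dot_nplus_nminus]

theorem dot_nplus_etr (j : Fin D) : dot nplus (etr j) = 0 := by
  simp [nplus, etr, dot_add_left, dot_bas_bas, metric_of_ne, (Fin.succ_ne_zero _).symm,
    (succ_succ_ne_one j).symm]

theorem dot_nminus_etr (j : Fin D) : dot nminus (etr j) = 0 := by
  simp [nminus, etr, dot_sub_left, dot_bas_bas, metric_of_ne, (Fin.succ_ne_zero _).symm,
    (succ_succ_ne_one j).symm]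

theorem dot_etr_etr (i j : Fin D) : dot (etr i) (etr j) = if i = j then 1 else 0 := by
  simp [etr, dot_bas_bas, metric, eta_succ]

theorem span_lc : Submodule.span ℝ (Set.range (lc : Fin (D + 2) → Pt (D + 2))) = ⊤ := by
  rw [eq_top_iff]
  intro x _
  have hm : ∀ m : Fin (D + 2), lc m ∈ Submodule.span ℝ (Set.range (lc : Fin (D + 2) → Pt (D + 2))) :=
    fun m => Submodule.subset_span ⟨m, rfl⟩
  rw [eq_sum_bas x]
  refine Submodule.sum_mem _ fun m _ => Submodule.smul_mem _ _ ?_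
  have h0 : bas (0 : Fin (D + 2)) = (1 / 2 : ℝ) • (lc 0 + lc 1) := by
    change _ = (1 / 2 : ℝ) • (nplus + nminus)
    simp only [nplus, nminus]; module
  have h1 : bas (1 : Fin (D + 2)) = (1 / 2 : ℝ) • (lc 0 - lc 1) := by
    change _ = (1 / 2 : ℝ) • (nplus - nminus)
    simp only [nplus, nminus]; module
  refine Fin.cases ?_ (fun m => Fin.cases ?_ (fun j => ?_) m) m
  · rw [h0]; exact Submodule.smul_mem _ _ (Submodule.add_mem _ (hm _) (hm _))
  · change bas (1 : Fin (D + 2)) ∈ _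
    rw [h1]; exact Submodule.smul_mem _ _ (Submodule.sub_mem _ (hm _) (hm _))
  · exact hm j.succ.succ

/-- The null vectors satisfy `n₊ · n₋ = -2`, so the inverse metric has the off-diagonal entries
`-1/2` in the light-cone frame. -/
theorem trace_lc {E : Type*} [AddCommGroup E] [Module ℝ E]
    (B : Pt (D + 2) →ₗ[ℝ] Pt (D + 2) →ₗ[ℝ] E) :
    ∑ n, eta n • B (bas n) (bas n) =
      ∑ j, B (etr j) (etr j) - (1 / 2 : ℝ) • (B nplus nminus + B nminus nplus) := by
  rw [Fin.sum_univ_succ, Fin.sum_univ_succ]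
  simp only [eta_succ, one_smul, eta_zero, nplus, nminus, map_add, map_sub, LinearMap.add_apply,
    LinearMap.sub_apply, etr]
  rw [Fin.succ_zero_eq_one]
  module

/-- The null rotation that fixes `nminus`. -/
def nullRot (j : Fin D) : Fin (D + 2) → Fin (D + 2) → ℝ := wedge nminus (etr j)

/-- Null rotations act as lowering operators: `n₊` goes to a multiple of `e_j`, and `e_j` to a
multiple of `n₋`. -/
theorem gen_nullRot_nplus (j : Fin D) : gen (nullRot j) nplus = (-2 : ℝ) • etr j := by
  rw [nullRot, gen_wedge, dot_nminus_nplus, dot_comm, dot_nplus_etr]; simp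

theorem gen_nullRot_etr (j i : Fin D) :
    gen (nullRot j) (etr i) = if j = i then -nminus else 0 := by
  rw [nullRot, gen_wedge, dot_nminus_etr, dot_etr_etr]; split_ifs <;> simp

theorem refl_one_nplus : refl (bas 1) (nplus : Pt (D + 2)) = nminus := by
  have h1 : dot (bas 1) (nplus : Pt (D + 2)) = 1 := by
    simp [nplus, dot_add_right, dot_bas_bas, metric_self, eta_one, metric_of_ne]
  have h2 : sq (bas 1 : Pt (D + 2)) = 1 := by
    rw [← dot_self, dot_bas_bas, metric_self, eta_one]
  rw [refl_apply, h1, h2]; simp only [nplus, nminus]; module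

theorem refl_one_nminus : refl (bas 1) (nminus : Pt (D + 2)) = nplus := by
  rw [← refl_one_nplus, refl_refl]

end LightCone

/-! ### Hook tensors are determined by their values on null flags -/

section NullFlags

variable {D r q : ℕ} {E : Type*} [AddCommGroup E] [Module ℝ E]
  {F : MultilinearMap ℝ (fun _ : Pos r q => Pt (D + 2)) E}

/-- The arguments `(p, …, p; w)`. -/
def flag (p : Pt (D + 2)) (w : Fin q → Pt (D + 2)) : Pos r q → Pt (D + 2) :=
  Sum.elim (fun _ => p) w

theorem flag_update (p : Pt (D + 2)) (w : Fin q → Pt (D + 2)) (k : Fin q) (x : Pt (D + 2)) :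
    (Function.update (flag p w) (Sum.inr k) x : Pos r q → Pt (D + 2)) =
      flag p (Function.update w k x) := Sum.update_elim_inr

@[simp] theorem flag_inl (p : Pt (D + 2)) (w : Fin q → Pt (D + 2)) (i : Fin (r + 1)) :
    flag p w (Sum.inl i : Pos r q) = p := rfl

@[simp] theorem flag_inr (p : Pt (D + 2)) (w : Fin q → Pt (D + 2)) (k : Fin q) :
    flag p w (Sum.inr k : Pos r q) = w k := rfl

theorem MHook.update_left_eq (h : MHook F) {u : Pos r q → Pt (D + 2)} {i i' : Fin (r + 1)}
    (hu : u (Sum.inl i) = u (Sum.inl i')) (x : Pt (D + 2)) :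
    F (Function.update u (Sum.inl i) x) = F (Function.update u (Sum.inl i') x) := by
  rw [← h.swap_left i i']
  congr 1
  rw [Function.update_comp_equiv, comp_swap_of_eq hu]
  simp

/-- Let `X` be the value in question. A null rotation of a vanishing flag expresses the values with
one symmetric `n₊` replaced by `e_j` through values of the type of `X`. Inserting this into the
mixed trace over a symmetric slot and `k₀` leaves `(D - q + 1 + r) X = 0`, whose coefficient is
positive. The condition `hlie` only asks that the zeros of `F` be stable under infinitesimal
rotations; `F` will take values in functions of the second group. -/
theorem MHook.null_flag_nminus_eq_zero (h : MHook F)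
    (hlie : ∀ ω : Fin (D + 2) → Fin (D + 2) → ℝ, (∀ m n, ω m n = -ω n m) → ∀ u, F u = 0 →
      ∑ k, F (Function.update u k (gen ω (u k))) = 0)
    (hd : q ≤ D)
    (h0 : ∀ J : Fin q → Fin D, F (flag nplus fun k => etr (J k)) = 0)
    (J : Fin q → Fin D) (k₀ : Fin q) :
    F (flag nplus (Function.update (fun k => etr (J k)) k₀ nminus)) = 0 := by
  -- the null rotation applied to a flag
  have h1 : ∀ (J : Fin q → Fin D) (j : Fin D), (-2 * ((r : ℝ) + 1)) •
      F (Function.update (flag nplus fun k => etr (J k)) (Sum.inl 0) (etr j)) =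
      ∑ k, if j = J k then F (flag nplus (Function.update (fun k => etr (J k)) k nminus)) else 0 := by
    intro J j
    have := hlie (nullRot j) (wedge_antisymm _ _) _ (h0 J)
    rw [Fintype.sum_sum_type] at this
    have e1 : ∀ i : Fin (r + 1), F (Function.update (flag nplus fun k => etr (J k)) (Sum.inl i)
        (gen (nullRot j) (flag nplus (fun k => etr (J k)) (Sum.inl i : Pos r q)))) =
        (-2 : ℝ) • F (Function.update (flag nplus fun k => etr (J k)) (Sum.inl 0) (etr j)) := by
      intro i
      rw [show flag nplus (fun k => etr (J k)) (Sum.inl i : Pos r q) = nplus from rfl,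
        gen_nullRot_nplus, F.map_update_smul, h.update_left_eq (i' := 0)]
      rfl
    have e2 : ∀ k : Fin q, F (Function.update (flag nplus fun k => etr (J k)) (Sum.inr k)
        (gen (nullRot j) (flag nplus (fun k => etr (J k)) (Sum.inr k : Pos r q)))) =
        -(if j = J k then F (flag nplus (Function.update (fun k => etr (J k)) k nminus)) else 0) := by
      intro k
      rw [show flag nplus (fun k => etr (J k)) (Sum.inr k : Pos r q) = etr (J k) from rfl,
        gen_nullRot_etr]
      split_ifs
      · rw [← neg_one_smul ℝ nminus, F.map_update_smul, neg_one_smul, flag_update]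
      · rw [F.map_update_zero, neg_zero]
    simp only [e1, e2, Finset.sum_const, Finset.card_univ, Fintype.card_fin,
      Finset.sum_neg_distrib, ← Nat.cast_smul_eq_nsmul ℝ] at this
    rw [← sub_eq_add_neg, sub_eq_zero] at this
    rw [← this]; push_cast; module
  set X := F (flag nplus (Function.update (fun k => etr (J k)) k₀ nminus)) with hX
  -- contraction with the trace
  have h2 := h.traceless_mixed 0 k₀ (flag nplus fun k => etr (J k))
  have hne : (Sum.inl 0 : Pos r q) ≠ Sum.inr k₀ := by simp
  have h3 := trace_lc (twoSlot F (flag nplus fun k => etr (J k)) hne)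
  simp only [twoSlot_apply] at h3
  rw [h2] at h3
  have e3 : Function.update (Function.update (flag nplus fun k => etr (J k)) (Sum.inl 0) nplus)
      (Sum.inr k₀) nminus =
      (flag nplus (Function.update (fun k => etr (J k)) k₀ nminus) : Pos r q → Pt (D + 2)) := by
    rw [← flag_update]
    congr 1
    exact Function.update_eq_self (Sum.inl 0) (flag nplus fun k => etr (J k))
  -- With `n₊` in slot `k₀` and `n₋` in one symmetric slot, the Young relation exchanges the two at
  -- the price of the factor `-1/(r+1)`.
  have e4 : ((r : ℝ) + 1) • F (Function.update (Function.update (flag nplus fun k => etr (J k))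
      (Sum.inl 0) nminus) (Sum.inr k₀) nplus) = -X := by
    rw [h.move (k := k₀) (i₀ := 0), hX, ← e3]
    · congr 2
      ext1 x
      rcases eq_or_ne x (Sum.inl 0) with rfl | hx
      · simp
      · rcases eq_or_ne x (Sum.inr k₀) with rfl | hx'
        · simp
        · simp [Equiv.swap_apply_of_ne_of_ne hx hx', hx, hx']
    · intro i hi
      simp [hi]
  -- The null rotation of the flag with `e_j` at `k₀` also hits every other slot that carries `e_j`;
  -- antisymmetry turns such a term into `-X`. Summed over `j`, this counts `D - (q - 1)` copies of
  -- `X`.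
  have e5 : ∀ j, (-2 * ((r : ℝ) + 1)) • F (Function.update (Function.update
      (flag nplus fun k => etr (J k)) (Sum.inl 0) (etr j)) (Sum.inr k₀) (etr j)) =
      X - ∑ k ∈ Finset.univ.erase k₀, if j = J k then X else 0 := by
    intro j
    have := h1 (Function.update J k₀ j) j
    have e6 : (fun k => etr (Function.update J k₀ j k) : Fin q → Pt (D + 2)) =
        Function.update (fun k => etr (J k)) k₀ (etr j) := by
      ext1 k; rcases eq_or_ne k k₀ with rfl | hk
      · simp
      · simp [hk]
    simp only [e6] at this
    rw [← flag_update, Function.update_comm hne.symm] at this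
    rw [this, ← Finset.add_sum_erase _ _ (Finset.mem_univ k₀)]
    simp only [Function.update_self, if_true, Function.update_idem]
    rw [sub_eq_add_neg, ← Finset.sum_neg_distrib]
    congr 1
    refine Finset.sum_congr rfl fun k hk => ?_
    have hk' := Finset.ne_of_mem_erase hk
    rw [Function.update_of_ne hk']
    split_ifs with hj
    · rw [hX, ← h.swap_right hk', hj]
      congr 1
      ext1 x
      rcases x with i | i
      · rw [Function.comp, Equiv.swap_apply_of_ne_of_ne (by simp) (by simp)]; rfl
      · rcases eq_or_ne i k with rfl | hi
        · simp
        · rcases eq_or_ne i k₀ with rfl | hi'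
          · simp [hi, Ne.symm hi]
          · simp [Equiv.swap_apply_of_ne_of_ne, hi, hi']
    · simp
  have e6 : ∑ j, (-2 * ((r : ℝ) + 1)) • F (Function.update (Function.update
      (flag nplus fun k => etr (J k)) (Sum.inl 0) (etr j)) (Sum.inr k₀) (etr j)) =
      ((D : ℝ) - q + 1) • X := by
    simp only [e5, Finset.sum_sub_distrib]
    rw [Finset.sum_comm]
    have hq : 1 ≤ q := Nat.one_le_iff_ne_zero.2 (by rintro rfl; exact k₀.elim0)
    simp only [Finset.sum_ite_eq', Finset.mem_univ, if_true, Finset.sum_const, Finset.card_univ,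
      Fintype.card_fin, Finset.card_erase_of_mem (Finset.mem_univ k₀), ← Nat.cast_smul_eq_nsmul ℝ]
    rw [Nat.cast_sub hq]; push_cast; module
  rw [← Finset.smul_sum] at e6
  have h4 : ((D : ℝ) - q + 1 + r) • X = 0 := by
    have := congrArg ((-2 * ((r : ℝ) + 1)) • ·) h3
    simp only [e3, smul_zero, smul_sub, e6] at this
    rw [this]
    have e4' : (-2 * ((r : ℝ) + 1)) • ((1 / 2 : ℝ) • (X + F (Function.update (Function.update
      (flag nplus fun k => etr (J k)) (Sum.inl 0) nminus) (Sum.inr k₀) nplus))) =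
      -(((r : ℝ) + 1) • X + ((r : ℝ) + 1) • F (Function.update (Function.update
      (flag nplus fun k => etr (J k)) (Sum.inl 0) nminus) (Sum.inr k₀) nplus)) := by module
    rw [e4', e4]; module
  have : (0 : ℝ) < (D : ℝ) - q + 1 + r := by
    have : (q : ℝ) ≤ D := by exact_mod_cast hd
    have : (0 : ℝ) ≤ r := r.cast_nonneg
    linarith
  exact (smul_eq_zero.1 h4).resolve_left this.ne'

theorem mem_span_lc (x : Pt (D + 2)) :
    x ∈ Submodule.span ℝ (Set.range (lc : Fin (D + 2) → Pt (D + 2))) := by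
  rw [span_lc]; trivial

/-- By multilinearity the antisymmetric slots may carry frame vectors. An `n₊` there vanishes by the
Young relation, two `n₋` by antisymmetry, a single `n₋` by `MHook.null_flag_nminus_eq_zero`;
transverse vectors are the hypothesis. -/
theorem MHook.null_flag_eq_zero (h : MHook F)
    (hlie : ∀ ω : Fin (D + 2) → Fin (D + 2) → ℝ, (∀ m n, ω m n = -ω n m) → ∀ u, F u = 0 →
      ∑ k, F (Function.update u k (gen ω (u k))) = 0)
    (hd : q ≤ D)
    (h0 : ∀ J : Fin q → Fin D, F (flag nplus fun k => etr (J k)) = 0)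
    (w : Fin q → Pt (D + 2)) : F (flag nplus w) = 0 := by
  refine eq_zero_of_mem_span F (Sum.elim (fun _ => {nplus}) fun _ => Set.range lc) ?_ _ ?_
  · intro u hu
    have hl : ∀ i, u (Sum.inl i) = nplus := fun i => hu (Sum.inl i)
    have hr : ∀ k, ∃ m, lc m = u (Sum.inr k) := fun k => hu (Sum.inr k)
    choose m hm using hr
    by_cases h1 : ∃ k, m k = 0
    · obtain ⟨k, hk⟩ := h1
      refine h.eq_zero_of_left_eq (k := k) fun i => ?_
      rw [hl, ← hm, hk]; rfl
    push Not at h1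
    have h2 : ∀ k, ∃ m', m k = Fin.succ m' := fun k => ⟨_, (Fin.succ_pred _ (h1 k)).symm⟩
    choose m' hm' using h2
    have hu' : u = flag nplus fun k => lc (m k) := by
      ext1 x; rcases x with i | i
      · exact hl i
      · exact (hm i).symm
    by_cases h3 : ∃ k, m' k = 0
    · obtain ⟨k, hk⟩ := h3
      by_cases h4 : ∃ k', k' ≠ k ∧ m' k' = 0
      · obtain ⟨k', hne, hk'⟩ := h4
        refine h.eq_zero_of_right_eq hne ?_
        rw [← hm, ← hm, hm', hm', hk, hk']
      · push Not at h4
        -- A default transverse index is needed at the slot occupied by `n₋`; it exists unless `D =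
        -- 0`, and then `q ≤ D` leaves no such slot.
        by_cases hD : D = 0
        · subst hD
          obtain rfl : q = 0 := by omega
          exact k.elim0
        have : NeZero D := ⟨hD⟩
        have h5 : ∀ k', ∃ J : Fin D, k' ≠ k → m' k' = Fin.succ J := by
          intro k'
          by_cases hkk : k' = k
          · exact ⟨0, fun h => absurd hkk h⟩
          · exact ⟨_, fun _ => (Fin.succ_pred _ (h4 k' hkk)).symm⟩
        choose J hJ using h5
        have : u = flag nplus (Function.update (fun k => etr (J k)) k nminus) := by
          rw [hu']
          congr 1
          ext1 k'
          rcases eq_or_ne k' k with rfl | hkk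
          · rw [hm', hk]; simp; rfl
          · rw [hm', hJ k' hkk, Function.update_of_ne hkk]; rfl
        rw [this]
        exact h.null_flag_nminus_eq_zero hlie hd h0 J k
    · push Not at h3
      have h5 : ∀ k, ∃ J : Fin D, m' k = Fin.succ J := fun k => ⟨_, (Fin.succ_pred _ (h3 k)).symm⟩
      choose J hJ using h5
      have : u = flag nplus (fun k => etr (J k)) := by
        rw [hu']; congr 1; ext1 k; rw [hm', hJ]; rfl
      rw [this]; exact h0 J
  · rintro (i | i)
    · exact Submodule.subset_span rfl
    · exact mem_span_lc _

/-- Induction on the set `A` of symmetric slots that may differ from `n₊`. In a new slot, `n₊` is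
the induction hypothesis, and `e_j` is produced from `n₊` by a null rotation. For `n₋` the trace
over the new slot and a remaining `n₊` slot is used; when no such slot remains, the reflection along
`e_1` exchanges `n₋` with `n₊`. -/
theorem MHook.eq_zero_of_null_flag (h : MHook F)
    (hlie : ∀ ω : Fin (D + 2) → Fin (D + 2) → ℝ, (∀ m n, ω m n = -ω n m) → ∀ u, F u = 0 →
      ∑ k, F (Function.update u k (gen ω (u k))) = 0)
    (hrefl : ∀ u, F u = 0 → F (fun k => refl (bas 1) (u k)) = 0)
    (hd : q ≤ D)
    (h0 : ∀ J : Fin q → Fin D, F (flag nplus fun k => etr (J k)) = 0)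
    (u : Pos r q → Pt (D + 2)) : F u = 0 := by
  have key : ∀ A : Finset (Fin (r + 1)), ∀ u : Pos r q → Pt (D + 2),
      (∀ i ∉ A, u (Sum.inl i) = nplus) → F u = 0 := by
    intro A
    induction A using Finset.induction_on with
    | empty =>
      intro u hu
      have : u = flag nplus fun k => u (Sum.inr k) := by
        ext1 x; rcases x with i | i
        · exact hu i (Finset.notMem_empty i)
        · rfl
      rw [this]
      exact h.null_flag_eq_zero hlie hd h0 _
    | insert i₀ A hi₀ ih =>
      -- transverse vectors in the new slot
      have htr : ∀ (u : Pos r q → Pt (D + 2)), (∀ i ∉ insert i₀ A, u (Sum.inl i) = nplus) →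
          ∀ j, F (Function.update u (Sum.inl i₀) (etr j)) = 0 := by
        intro u hu j
        set u' := Function.update u (Sum.inl i₀) nplus with hu'
        have hn : ∀ i ∉ A, u' (Sum.inl i) = nplus := by
          intro i hi
          rcases eq_or_ne i i₀ with rfl | hne
          · simp [hu']
          · simp only [hu', ne_eq, Sum.inl.injEq, hne, not_false_eq_true, Function.update_of_ne]
            exact hu i (by simp [hne, hi])
        have h1 := hlie (nullRot j) (wedge_antisymm _ _) u' (ih u' hn)
        -- All slots outside `A` carry `n₊` and contribute equally by symmetry; rotations of the
        -- other slots vanish by induction. What remains is a nonzero multiple of the desired value.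
        have e1 : ∀ i ∉ A, F (Function.update u' (Sum.inl i) (gen (nullRot j) (u' (Sum.inl i)))) =
            (-2 : ℝ) • F (Function.update u (Sum.inl i₀) (etr j)) := by
          intro i hi
          rw [hn i hi, gen_nullRot_nplus, F.map_update_smul,
            h.update_left_eq ((hn i hi).trans (hn i₀ hi₀).symm), hu', Function.update_idem]
        have e2 : ∀ i ∈ A, F (Function.update u' (Sum.inl i) (gen (nullRot j) (u' (Sum.inl i)))) =
            0 := by
          intro i hi
          refine ih _ fun i' hi' => ?_
          rw [Function.update_of_ne, hn i' hi']
          intro e; exact hi' (Sum.inl_injective e ▸ hi)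
        have e3 : ∀ k, F (Function.update u' (Sum.inr k) (gen (nullRot j) (u' (Sum.inr k)))) =
            0 := by
          intro k
          refine ih _ fun i' hi' => ?_
          rw [Function.update_of_ne (by simp), hn i' hi']
        rw [Fintype.sum_sum_type, Finset.sum_eq_zero (fun k _ => e3 k), add_zero,
          ← Finset.sum_add_sum_compl A, Finset.sum_eq_zero e2, zero_add,
          Finset.sum_congr rfl fun i hi => e1 i (Finset.mem_compl.1 hi), Finset.sum_const,
          ← Nat.cast_smul_eq_nsmul ℝ, smul_smul] at h1
        refine (smul_eq_zero.1 h1).resolve_left (mul_ne_zero ?_ (by norm_num))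
        exact Nat.cast_ne_zero.2 (Finset.card_ne_zero.2 ⟨i₀, Finset.mem_compl.2 hi₀⟩)
      -- the opposite null vector in the new slot
      have hv : ∀ (u : Pos r q → Pt (D + 2)), (∀ i ∉ insert i₀ A, u (Sum.inl i) = nplus) →
          F (Function.update u (Sum.inl i₀) nminus) = 0 := by
        intro u hu
        by_cases hA : ∃ i₁, i₁ ∉ insert i₀ A
        · obtain ⟨i₁, hi₁⟩ := hA
          have hne : (Sum.inl i₀ : Pos r q) ≠ Sum.inl i₁ := by
            intro e; exact hi₁ (Sum.inl_injective e ▸ Finset.mem_insert_self _ _)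
          set X := F (Function.update u (Sum.inl i₀) nminus) with hX
          -- Rotate the vanishing configuration with `e_j` in slot `i₀`: that slot gives `-X`, each
          -- of the `N` remaining `n₊` slots gives `-2` times the value with `e_j` in both `i₀` and
          -- `i₁`, and all else vanishes.
          have h1 : ∀ j, (2 * (((insert i₀ A)ᶜ.card : ℕ) : ℝ)) •
              F (Function.update (Function.update u (Sum.inl i₀) (etr j)) (Sum.inl i₁) (etr j)) =
              -X := by
            intro j
            set u' := Function.update u (Sum.inl i₀) (etr j) with hu'
            have hn : ∀ i ∉ insert i₀ A, u' (Sum.inl i) = nplus := by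
              intro i hi
              rw [hu', Function.update_of_ne, hu i hi]
              intro e; exact hi (Sum.inl_injective e ▸ Finset.mem_insert_self _ _)
            have h1 := hlie (nullRot j) (wedge_antisymm _ _) u' (htr u hu j)
            have e1 : ∀ i ∉ insert i₀ A, F (Function.update u' (Sum.inl i)
                (gen (nullRot j) (u' (Sum.inl i)))) =
                (-2 : ℝ) • F (Function.update u' (Sum.inl i₁) (etr j)) := by
              intro i hi
              rw [hn i hi, gen_nullRot_nplus, F.map_update_smul,
                h.update_left_eq ((hn i hi).trans (hn i₁ hi₁).symm)]
            have e0 : F (Function.update u' (Sum.inl i₀) (gen (nullRot j) (u' (Sum.inl i₀)))) =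
                -X := by
              have : u' (Sum.inl i₀) = etr j := by simp [hu']
              rw [this, gen_nullRot_etr, if_pos rfl, ← neg_one_smul ℝ nminus, F.map_update_smul,
                neg_one_smul, hu', Function.update_idem]
            have e2 : ∀ i ∈ A, F (Function.update u' (Sum.inl i)
                (gen (nullRot j) (u' (Sum.inl i)))) = 0 := by
              intro i hi
              have hii : (Sum.inl i : Pos r q) ≠ Sum.inl i₀ := by
                intro e; exact hi₀ (Sum.inl_injective e ▸ hi)
              rw [hu', Function.update_comm hii.symm]
              refine htr _ (fun i' hi' => ?_) j
              rw [Function.update_of_ne, hu i' hi']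
              intro e; exact hi' (Sum.inl_injective e ▸ Finset.mem_insert_of_mem hi)
            have e3 : ∀ k, F (Function.update u' (Sum.inr k)
                (gen (nullRot j) (u' (Sum.inr k)))) = 0 := by
              intro k
              rw [hu', Function.update_comm (by simp)]
              refine htr _ (fun i' hi' => ?_) j
              rw [Function.update_of_ne (by simp), hu i' hi']
            rw [Fintype.sum_sum_type, Finset.sum_eq_zero (fun k _ => e3 k), add_zero,
              ← Finset.sum_add_sum_compl (insert i₀ A), Finset.sum_insert hi₀,
              Finset.sum_eq_zero e2, e0, add_zero,
              Finset.sum_congr rfl fun i hi => e1 i (Finset.mem_compl.1 hi), Finset.sum_const,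
              ← Nat.cast_smul_eq_nsmul ℝ] at h1
            rw [eq_neg_iff_add_eq_zero, ← neg_eq_zero, ← h1]
            module
          have h2 := h.traceless i₀ i₁ (fun e => hne (congrArg _ e)) u
          have h3 := trace_lc (twoSlot F u hne)
          simp only [twoSlot_apply] at h3
          rw [h2] at h3
          have e4 : F (Function.update (Function.update u (Sum.inl i₀) nminus) (Sum.inl i₁) nplus)
              = X := by
            rw [hX, Function.update_eq_self_iff.2]
            rw [Function.update_of_ne hne.symm, hu i₁ hi₁]
          have e5 : F (Function.update (Function.update u (Sum.inl i₀) nplus) (Sum.inl i₁) nminus)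
              = X := by
            rw [← e4, ← h.swap_left i₀ i₁]
            congr 1
            ext1 x
            rcases eq_or_ne x (Sum.inl i₀) with rfl | hx
            · simp [hne]
            · rcases eq_or_ne x (Sum.inl i₁) with rfl | hx'
              · simp [hne]
              · simp [Equiv.swap_apply_of_ne_of_ne hx hx', hx, hx']
          rw [e4, e5] at h3
          set N : ℝ := (((insert i₀ A)ᶜ.card : ℕ) : ℝ) with hN
          -- Multiplied by `2N`, the transverse part of the trace gives `-D X` and the light-cone
          -- part gives `-2N X`.
          have h4 : ((D : ℝ) + 2 * N) • X = 0 := by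
            have h5 := congrArg ((2 * N) • ·) h3
            simp only [smul_zero, smul_sub, Finset.smul_sum, h1, Finset.sum_const,
              Finset.card_univ, Fintype.card_fin,
              ← Nat.cast_smul_eq_nsmul ℝ] at h5
            rw [← neg_eq_zero, h5]; module
          have hNpos : 0 < N := Nat.cast_pos.2 (Finset.card_pos.2 ⟨i₁, Finset.mem_compl.2 hi₁⟩)
          exact (smul_eq_zero.1 h4).resolve_left (by positivity)
        -- Now `i₀` is the last slot, all others being unrestricted, so after the reflection the
        -- induction hypothesis applies.
        · push Not at hA
          have := hrefl (fun k => refl (bas 1) (Function.update u (Sum.inl i₀) nminus k)) ?_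
          · simpa only [refl_refl] using this
          · refine ih _ fun i hi => ?_
            have : i = i₀ := (Finset.mem_insert.1 (hA i)).resolve_right hi
            subst this
            simp [refl_one_nminus]
      intro u hu
      have h1 : ∀ w ∈ Submodule.span ℝ (Set.range (lc : Fin (D + 2) → Pt (D + 2))),
          F (Function.update u (Sum.inl i₀) w) = 0 := by
        intro w hw
        induction hw using Submodule.span_induction with
        | mem w hw =>
          obtain ⟨m, rfl⟩ := hw
          refine Fin.cases ?_ (fun m => Fin.cases ?_ (fun j => ?_) m) m
          · refine ih _ fun i hi => ?_
            rcases eq_or_ne i i₀ with rfl | hne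
            · simp [lc]
            · rw [Function.update_of_ne (fun e => hne (Sum.inl_injective e))]
              exact hu i (by simp [hne, hi])
          · exact hv u hu
          · exact htr u hu j
        | zero => exact F.map_update_zero u _
        | add w w' _ _ e e' => rw [F.map_update_add, e, e', add_zero]
        | smul c w _ e => rw [F.map_update_smul, e, smul_zero]
      simpa using h1 _ (mem_span_lc (u (Sum.inl i₀)))
  exact key Finset.univ u fun i hi => absurd (Finset.mem_univ i) hi

end NullFlags

/-! ### Tensors with two groups of indices and their invariance -/

section TwoSided

variable {d r q : ℕ} {E : Type*} [AddCommGroup E] [Module ℝ E]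

theorem IsTracelessHook.map {E' : Type*} [AddCommGroup E'] [Module ℝ E'] {T : Idx d r q → E}
    (h : IsTracelessHook T) (f : E →ₗ[ℝ] E') : IsTracelessHook (fun a => f (T a)) where
  symm σ a := by rw [h.symm]
  antisymm τ a := by rw [h.antisymm]; exact map_zsmul f _ _
  young k a := by rw [← map_sum, ← map_add, h.young, map_zero]
  traceless j j' hj a := by
    simp only [← map_smul, ← map_sum]
    rw [h.traceless j j' hj, map_zero]

theorem isTracelessHook_pi {ι : Type*} {T : Idx d r q → ι → E}
    (h : ∀ i, IsTracelessHook (fun a => T a i)) : IsTracelessHook T where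
  symm σ a := funext fun i => (h i).symm σ a
  antisymm τ a := funext fun i => (h i).antisymm τ a
  young k a := funext fun i => by simpa using (h i).young k a
  traceless j j' hj a := funext fun i => by simpa using (h i).traceless _ _ hj a

/-- Evaluation on fixed vectors as a linear map. -/
def evLin (u : Pos r q → Pt d) : (Idx d r q → E) →ₗ[ℝ] E where
  toFun T := ev T u
  map_add' T T' := ev_add T T' u
  map_smul' c T := ev_map (c • (LinearMap.id : E →ₗ[ℝ] E)) T u

theorem ev_ev_apply (M : Idx d r q → Idx d r q → E) (u : Pos r q → Pt d) (b : Idx d r q) :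
    ev M u b = ev (fun a => M a b) u :=
  (ev_map (LinearMap.proj b : (Idx d r q → E) →ₗ[ℝ] E) M u).symm

theorem isTracelessHook_ev {M : Idx d r q → Idx d r q → E} (h : ∀ a, IsTracelessHook (M a))
    (u : Pos r q → Pt d) : IsTracelessHook (ev M u) := by
  have h1 : IsTracelessHook (fun b a => M a b) := isTracelessHook_pi h
  have h2 := h1.map (evLin u)
  have : ev M u = fun b => evLin u fun a => M a b := funext fun b => ev_ev_apply M u b
  rw [this]; exact h2

/-- Infinitesimal Lorentz invariance of a tensor with two groups of indices. -/
def LieInvariant (M : Idx d r q → Idx d r q → E) : Prop :=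
  ∀ ω : Fin d → Fin d → ℝ, (∀ m n, ω m n = -ω n m) → ∀ u v : Pos r q → Pt d,
    ∑ k, ev (ev M (Function.update u k (gen ω (u k)))) v +
      ∑ k, ev (ev M u) (Function.update v k (gen ω (v k))) = 0

/-- Invariance under the reflection along `x`. -/
def ReflInvariant (M : Idx d r q → Idx d r q → E) (x : Pt d) : Prop :=
  ∀ u v : Pos r q → Pt d,
    ev (ev M fun k => refl x (u k)) (fun k => refl x (v k)) = ev (ev M u) v

end TwoSided

/-! ### Invariant tensors of hook type -/

section Schur

variable {D r q : ℕ} {E : Type*} [AddCommGroup E] [Module ℝ E]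

/-- The boost weight of the vectors of the light-cone frame. -/
def boostWeight (m : Fin (D + 2)) : ℤ := if m = 0 then 1 else if m = 1 then -1 else 0

theorem gen_boost_lc (m : Fin (D + 2)) :
    gen (wedge nplus nminus) (lc m) = (2 * (boostWeight m : ℝ)) • lc m := by
  rw [gen_wedge]
  refine Fin.cases ?_ (fun m => Fin.cases ?_ (fun j => ?_) m) m
  · change dot nplus nplus • _ - dot nminus nplus • _ = _ • nplus
    rw [dot_nplus_nplus, dot_nminus_nplus]; simp [boostWeight]
  · change dot nplus nminus • _ - dot nminus nminus • _ = _ • nminus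
    rw [dot_nplus_nminus, dot_nminus_nminus]
    have : boostWeight (Fin.succ 0 : Fin (D + 2)) = -1 := by simp [boostWeight]
    rw [this]; simp
  · change dot nplus (etr j) • _ - dot nminus (etr j) • _ = _ • etr j
    rw [dot_nplus_etr, dot_nminus_etr]
    have : boostWeight (j.succ.succ : Fin (D + 2)) = 0 := by
      simp [boostWeight, succ_succ_ne_one]
    rw [this]; simp

theorem boostWeight_le (m : Fin (D + 2)) : -boostWeight m ≤ 1 := by
  unfold boostWeight; split_ifs <;> norm_num

theorem boostWeight_le_of_ne {m : Fin (D + 2)} (h : m ≠ 1) : -boostWeight m ≤ 0 := by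
  unfold boostWeight; split_ifs <;> simp_all

theorem exists_eq_succ_succ {m : Fin (D + 2)} (h : m ≠ 1) (h' : boostWeight m = 0) :
    ∃ j : Fin D, lc m = etr j := by
  have h0 : m ≠ 0 := by rintro rfl; simp [boostWeight] at h'
  obtain ⟨m, rfl⟩ := Fin.exists_succ_eq_of_ne_zero h0
  have h1 : m ≠ 0 := by rintro rfl; exact h rfl
  obtain ⟨j, rfl⟩ := Fin.exists_succ_eq_of_ne_zero h1
  exact ⟨j, rfl⟩

/-- A hook tensor of extremal boost weight is determined by its values on transverse flags. -/
theorem MHook.eq_zero_of_boostWeight {T : MultilinearMap ℝ (fun _ : Pos r q => Pt (D + 2)) E}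
    (h : MHook T)
    (hw : ∀ κ : Pos r q → Fin (D + 2), T (fun k => lc (κ k)) ≠ 0 →
      ∑ k, -boostWeight (κ k) = r + 1)
    (h0 : ∀ K : Fin q → Fin D, T (flag nminus fun k => etr (K k)) = 0)
    (v : Pos r q → Pt (D + 2)) : T v = 0 := by
  -- Without `n₋` in the antisymmetric slots, the total weight `r + 1` is reached only with `n₋` in
  -- every symmetric slot and transverse vectors elsewhere.
  have hA : ∀ κ : Pos r q → Fin (D + 2), (∀ k, κ (Sum.inr k) ≠ 1) →
      T (fun k => lc (κ k)) = 0 := by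
    intro κ hκ
    by_contra hne
    have hs := hw κ hne
    rw [Fintype.sum_sum_type] at hs
    have hy : ∀ k ∈ Finset.univ, -boostWeight (κ (Sum.inr k)) ≤ 0 :=
      fun k _ => boostWeight_le_of_ne (hκ k)
    have hx : ∀ i, κ (Sum.inl i) = 1 := by
      intro i
      by_contra hi
      have : ∑ i : Fin (r + 1), -boostWeight (κ (Sum.inl i)) < ∑ i : Fin (r + 1), (1 : ℤ) :=
        Finset.sum_lt_sum (fun i _ => boostWeight_le _)
          ⟨i, Finset.mem_univ i, lt_of_le_of_lt (boostWeight_le_of_ne hi) one_pos⟩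
      have h2 := Finset.sum_nonpos hy
      simp at this h2 hs
      linarith
    have hx' : ∑ i : Fin (r + 1), -boostWeight (κ (Sum.inl i)) = r + 1 := by
      simp [hx, boostWeight]
    have hy' : ∑ k, -boostWeight (κ (Sum.inr k)) = 0 := by linarith
    rw [Finset.sum_eq_zero_iff_of_nonpos hy] at hy'
    have : ∀ k, ∃ j : Fin D, lc (κ (Sum.inr k)) = etr j := fun k =>
      exists_eq_succ_succ (hκ k) (neg_eq_zero.1 (hy' k (Finset.mem_univ k)))
    choose K hK using this
    refine hne ((congrArg T ?_).trans (h0 K))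
    ext1 x
    rcases x with i | k
    · simp only [hx]; rfl
    · exact hK k
  refine eq_zero_of_mem_span T (fun _ => Set.range lc) ?_ v fun k => mem_span_lc _
  intro u hu
  choose κ hκ using hu
  obtain rfl : (fun k => lc (κ k)) = u := funext hκ
  clear hκ
  by_cases h1 : ∃ k, κ (Sum.inr k) = 1
  swap
  · push Not at h1; exact hA κ h1
  -- A nonzero value has at most one `n₋` among the antisymmetric slots, and not all symmetric slots
  -- are `n₋`. The weight then forces exactly one exceptional symmetric slot `i₀`, and `MHook.move`
  -- brings the `n₋` there, back to the case `hA`.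
  obtain ⟨k₀, hk₀⟩ := h1
  by_contra hne
  have huniq : ∀ k ≠ k₀, κ (Sum.inr k) ≠ 1 := by
    intro k hk hk1
    exact hne (h.eq_zero_of_right_eq hk (by simp only [hk1, hk₀]))
  have hi : ∃ i, κ (Sum.inl i) ≠ 1 := by
    by_contra hall
    push Not at hall
    exact hne (h.eq_zero_of_left_eq (k := k₀) fun i => by simp only [hall, hk₀])
  obtain ⟨i₀, hi₀⟩ := hi
  have hs := hw κ hne
  rw [Fintype.sum_sum_type, ← Finset.add_sum_erase _ _ (Finset.mem_univ i₀),
    ← Finset.add_sum_erase _ _ (Finset.mem_univ k₀)] at hs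
  have hy : ∑ k ∈ Finset.univ.erase k₀, -boostWeight (κ (Sum.inr k)) ≤ 0 :=
    Finset.sum_nonpos fun k hk => boostWeight_le_of_ne (huniq k (Finset.ne_of_mem_erase hk))
  have hall : ∀ i ≠ i₀, κ (Sum.inl i) = 1 := by
    intro i hne'
    by_contra hi
    have : ∑ i ∈ Finset.univ.erase i₀, -boostWeight (κ (Sum.inl i)) <
        ∑ i ∈ Finset.univ.erase i₀, (1 : ℤ) :=
      Finset.sum_lt_sum (fun i _ => boostWeight_le _)
        ⟨i, by simp [hne'], lt_of_le_of_lt (boostWeight_le_of_ne hi) one_pos⟩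
    rw [Finset.sum_const, Finset.card_erase_of_mem (Finset.mem_univ _), Finset.card_univ,
      Fintype.card_fin] at this
    have h2 := boostWeight_le_of_ne hi₀
    have h3 := boostWeight_le (κ (Sum.inr k₀))
    simp only [Nat.add_sub_cancel, nsmul_eq_mul, mul_one] at this
    linarith
  have hm := h.move (k := k₀) (i₀ := i₀) (u := fun k => lc (κ k))
    (fun i hi => by simp only [hall i hi, hk₀])
  have h3 := hA (κ ∘ Equiv.swap (Sum.inl i₀) (Sum.inr k₀)) ?_
  · have h4 : T ((fun k => lc (κ k)) ∘ Equiv.swap (Sum.inl i₀) (Sum.inr k₀)) = 0 := h3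
    rw [h4, neg_zero] at hm
    exact hne ((smul_eq_zero.1 hm).resolve_left (by positivity))
  · intro k
    rcases eq_or_ne k k₀ with rfl | hk
    · simpa using hi₀
    · simpa [Equiv.swap_apply_of_ne_of_ne, hk] using huniq k hk

theorem sq_etr (j : Fin D) : sq (etr j) = 1 := by rw [← dot_self, dot_etr_etr, if_pos rfl]

theorem refl_etr_etr (j i : Fin D) : refl (etr j) (etr i) = if j = i then -etr i else etr i := by
  rw [refl_apply, dot_etr_etr, sq_etr]
  split_ifs with h
  · subst h; module
  · simp

theorem refl_etr_sub_etr {i j : Fin D} (hij : i ≠ j) (k : Fin D) :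
    refl (etr i - etr j) (etr k) = etr (Equiv.swap i j k) := by
  have h2 : sq (etr i - etr j) = 2 := by
    rw [sq_sub, sq_etr, sq_etr, dot_etr_etr, if_neg hij]; norm_num
  rw [refl_apply, h2, dot_sub_left, dot_etr_etr, dot_etr_etr]
  rcases eq_or_ne i k with rfl | hi
  · rw [Equiv.swap_apply_left, if_pos rfl, if_neg hij.symm]; module
  · rcases eq_or_ne j k with rfl | hj
    · rw [Equiv.swap_apply_right, if_pos rfl, if_neg hij]; module
    · rw [Equiv.swap_apply_of_ne_of_ne hi.symm hj.symm, if_neg hi, if_neg hj]; simp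

/-- Reflections along `e_i - e_j` transpose two axes and fix `n₊` and `n₋`; transpositions generate
all permutations. -/
theorem ev_flag_perm {M : Idx (D + 2) r q → Idx (D + 2) r q → E}
    (hswap : ∀ i j : Fin D, i ≠ j → ReflInvariant M (etr i - etr j)) (π : Equiv.Perm (Fin D))
    (J : Fin q → Fin D) :
    ev (ev M (flag nplus fun k => etr (π (J k)))) (flag nminus fun k => etr (π (J k))) =
      ev (ev M (flag nplus fun k => etr (J k))) (flag nminus fun k => etr (J k)) := by
  induction π using Equiv.Perm.swap_induction_on with
  | one => rfl
  | swap_mul f x y hxy ih =>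
    rw [← ih, ← hswap x y hxy]
    congr 2
    · congr 1
      ext1 k; rcases k with i | k
      · simp only [flag_inl]
        rw [refl_of_dot_eq_zero]
        rw [dot_comm, dot_sub_right, dot_nplus_etr, dot_nplus_etr, sub_zero]
      · simp only [flag_inr, refl_etr_sub_etr hxy]; simp
    · ext1 k; rcases k with i | k
      · simp only [flag_inl]
        rw [refl_of_dot_eq_zero]
        rw [dot_comm, dot_sub_right, dot_nminus_etr, dot_nminus_etr, sub_zero]
      · simp only [flag_inr, refl_etr_sub_etr hxy]; simp

theorem refl_etr_flag (p : Pt (D + 2)) (hp : ∀ j, dot p (etr j) = 0) (j : Fin D)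
    (J : Fin q → Fin D) :
    (fun k => refl (etr j) ((flag p fun k => etr (J k)) k) : Pos r q → Pt (D + 2)) =
      flag p fun k => refl (etr j) (etr (J k)) := by
  ext1 k; rcases k with i | k
  · simp only [flag_inl]; rw [refl_of_dot_eq_zero]; rw [dot_comm, hp]
  · rfl

theorem MHook.flag_refl_etr {T : MultilinearMap ℝ (fun _ : Pos r q => Pt (D + 2)) E}
    (p : Pt (D + 2)) (j : Fin D) {J : Fin q → Fin D} (hJ : Function.Injective J) :
    T (flag p fun k => refl (etr j) (etr (J k))) =
      (if j ∈ Set.range J then (-1 : ℝ) else 1) • T (flag p fun k => etr (J k)) := by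
  split_ifs with hj
  · obtain ⟨k₀, rfl⟩ := hj
    have : (flag p fun k => refl (etr (J k₀)) (etr (J k)) : Pos r q → Pt (D + 2)) =
        Function.update (flag p fun k => etr (J k)) (Sum.inr k₀) ((-1 : ℝ) • etr (J k₀)) := by
      ext1 k; rcases k with i | k
      · simp
      · rcases eq_or_ne k k₀ with rfl | hk
        · simp [refl_etr_etr]
        · simp [refl_etr_etr, hk, hJ.ne hk.symm]
    rw [this, T.map_update_smul]
    congr 2
    exact Function.update_eq_self (Sum.inr k₀) (flag p fun k => etr (J k))
  · rw [one_smul]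
    congr 2
    ext1 k
    rw [refl_etr_etr, if_neg]
    rintro rfl; exact hj ⟨k, rfl⟩

/-- An invariant tensor that is of traceless hook type in both groups of indices vanishes if one
particular component vanishes. -/
theorem eq_zero_of_flag_eq_zero {M : Idx (D + 2) r q → Idx (D + 2) r q → E} (hd : q ≤ D)
    (hL : ∀ b, IsTracelessHook (fun a => M a b)) (hR : ∀ a, IsTracelessHook (M a))
    (hlie : LieInvariant M) (h1 : ReflInvariant M (bas 1))
    (hflip : ∀ j : Fin D, ReflInvariant M (etr j))
    (hswap : ∀ i j : Fin D, i ≠ j → ReflInvariant M (etr i - etr j))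
    {J₀ : Fin q → Fin D} (hJ₀ : Function.Injective J₀)
    (h0 : ev (ev M (flag nplus fun k => etr (J₀ k))) (flag nminus fun k => etr (J₀ k)) = 0) :
    M = 0 := by
  have hLM : MHook (ev M) := (isTracelessHook_pi hL).mhook
  have hRM : ∀ u, MHook (ev (ev M u)) := fun u => (isTracelessHook_ev hR u).mhook
  -- Any two injective families of axes are related by a permutation of the axes, which extends the
  -- bijection between their ranges.
  have hdiag : ∀ J : Fin q → Fin D, Function.Injective J →
      ev (ev M (flag nplus fun k => etr (J k))) (flag nminus fun k => etr (J k)) = 0 := by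
    intro J hJ
    let e : {x // x ∈ Set.range J₀} ≃ {x // x ∈ Set.range J} :=
      (Equiv.ofInjective J₀ hJ₀).symm.trans (Equiv.ofInjective J hJ)
    classical
    have he : ∀ k, e.extendSubtype (J₀ k) = J k := by
      intro k
      rw [Equiv.extendSubtype_apply_of_mem e _ ⟨k, rfl⟩]
      simp [e]
    have := ev_flag_perm hswap e.extendSubtype J₀
    simp only [he] at this
    rw [this, h0]
  have hflags : ∀ J K : Fin q → Fin D,
      ev (ev M (flag nplus fun k => etr (J k))) (flag nminus fun k => etr (K k)) = 0 := by
    intro J K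
    by_cases hJ : Function.Injective J
    swap
    · simp only [Function.Injective] at hJ
      push Not at hJ
      obtain ⟨k, k', hkk, hne⟩ := hJ
      rw [hLM.eq_zero_of_right_eq hne (by simp only [flag_inr, hkk])]
      exact ev_zero _
    by_cases hK : Function.Injective K
    swap
    · simp only [Function.Injective] at hK
      push Not at hK
      obtain ⟨k, k', hkk, hne⟩ := hK
      exact (hRM _).eq_zero_of_right_eq hne (by simp only [flag_inr, hkk])
    -- With the same set of axes, antisymmetry reduces to `K = J`. Otherwise some axis occurs in
    -- only one of the two flags, and flipping it changes the sign of an invariant value.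
    by_cases hr : Set.range K = Set.range J
    · let τ : Equiv.Perm (Fin q) := (Equiv.ofInjective K hK).trans
        ((Equiv.setCongr hr).trans (Equiv.ofInjective J hJ).symm)
      have hτ : ∀ k, J (τ k) = K k := by
        intro k
        have := Equiv.apply_ofInjective_symm hJ ((Equiv.setCongr hr) (Equiv.ofInjective K hK k))
        simpa [τ] using this
      have := (hRM (flag nplus fun k => etr (J k))).antisymm τ (flag nminus fun k => etr (J k))
      rw [hdiag J hJ, smul_zero] at this
      rw [← this]
      congr 1
      ext1 k; rcases k with i | k
      · rfl
      · simp [hτ]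
    · have : ∃ j, ¬ (j ∈ Set.range K ↔ j ∈ Set.range J) := by
        by_contra hcon; push Not at hcon; exact hr (Set.ext hcon)
      obtain ⟨j, hj⟩ := this
      have hinv := hflip j (flag nplus fun k => etr (J k)) (flag nminus fun k => etr (K k))
      rw [refl_etr_flag _ dot_nplus_etr, refl_etr_flag _ dot_nminus_etr,
        MHook.flag_refl_etr nminus j hK, MHook.flag_refl_etr nplus j hJ] at hinv
      have hlin : ∀ (c : ℝ) (S : Idx (D + 2) r q → E) (v : Pos r q → Pt (D + 2)),
          ev (c • S) v = c • ev S v := fun c S v => (evLin v).map_smul c S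
      rw [hlin, smul_smul] at hinv
      have hneg : -ev (ev M (flag nplus fun k => etr (J k))) (flag nminus fun k => etr (K k)) =
          ev (ev M (flag nplus fun k => etr (J k))) (flag nminus fun k => etr (K k)) := by
        by_cases hjK : j ∈ Set.range K <;> by_cases hjJ : j ∈ Set.range J <;> simp_all
      apply eq_zero_of_two_smul
      nth_rewrite 1 [← hneg]
      exact neg_add_cancel _
  -- The flag over `n₊` has boost weight `r + 1`, so boost invariance leaves only second arguments
  -- of weight `-(r + 1)`. Such a tensor is determined by its values on transverse flags over `n₋`,
  -- which vanish by `hflags`.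
  have hcol : ∀ J : Fin q → Fin D, ev M (flag nplus fun k => etr (J k)) = 0 := by
    intro J
    refine ev_injective fun v => ?_
    rw [(hRM (flag nplus fun k => etr (J k))).eq_zero_of_boostWeight ?_ (hflags J) v]
    · exact (ev_zero v).symm
    · intro κ hne
      have := hlie (wedge nplus nminus) (wedge_antisymm _ _) (flag nplus fun k => etr (J k))
        (fun k => lc (κ k))
      have e1 : ∀ k, ev (ev M (flag nplus fun k => etr (J k)))
          (Function.update (fun k => lc (κ k)) k (gen (wedge nplus nminus) (lc (κ k)))) =
          (2 * (boostWeight (κ k) : ℝ)) • ev (ev M (flag nplus fun k => etr (J k)))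
            (fun k => lc (κ k)) := by
        intro k
        rw [gen_boost_lc, MultilinearMap.map_update_smul]
        congr 2
        exact Function.update_eq_self k (fun k => lc (κ k))
      have e2 : ∀ i : Fin (r + 1), ev M (Function.update (flag nplus fun k => etr (J k)) (Sum.inl i)
          (gen (wedge nplus nminus) nplus)) = (2 : ℝ) • ev M (flag nplus fun k => etr (J k)) := by
        intro i
        have : gen (wedge nplus nminus) (nplus : Pt (D + 2)) = (2 : ℝ) • nplus := by
          rw [gen_wedge, dot_nplus_nplus, dot_nminus_nplus]; module
        rw [this, MultilinearMap.map_update_smul]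
        congr 2
        exact Function.update_eq_self (Sum.inl i) (flag nplus fun k => etr (J k))
      have e3 : ∀ k : Fin q, ev M (Function.update (flag nplus fun k => etr (J k)) (Sum.inr k)
          (gen (wedge nplus nminus) (etr (J k)))) = 0 := by
        intro k
        rw [gen_wedge, dot_nplus_etr, dot_nminus_etr]
        simp
      have hlin : ∀ (c : ℝ) (S : Idx (D + 2) r q → E) (v : Pos r q → Pt (D + 2)),
          ev (c • S) v = c • ev S v := fun c S v => (evLin v).map_smul c S
      rw [Fintype.sum_sum_type] at this
      simp only [flag_inl, flag_inr, e1, e2, e3, hlin, ← Finset.sum_smul, Finset.sum_const,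
        Finset.card_univ, Fintype.card_fin, ← Nat.cast_smul_eq_nsmul ℝ] at this
      rw [show ev (0 : Idx (D + 2) r q → E) (fun k => lc (κ k)) = 0 from ev_zero _, smul_zero,
        add_zero, ← add_smul] at this
      have := (smul_eq_zero.1 this).resolve_right hne
      rw [← Finset.mul_sum] at this
      rw [Finset.sum_neg_distrib]
      have h4 : ((r : ℝ) + 1) + ∑ k, (boostWeight (κ k) : ℝ) = 0 := by
        simp only [smul_eq_mul] at this; push_cast at this; linarith
      have h5 : ((r : ℤ) + 1) + ∑ k, boostWeight (κ k) = 0 := by exact_mod_cast h4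
      linarith
  -- View `M` as a map of the first group with values in tensors of the second. By invariance a
  -- rotation or reflection of the first arguments can be traded for one of the second, so the zeros
  -- of this map are stable.
  have hzero : ∀ u, ev M u = 0 := by
    refine hLM.eq_zero_of_null_flag ?_ ?_ hd hcol
    · intro ω hω u hu
      refine ev_injective fun v => ?_
      have := hlie ω hω u v
      rw [hu, show ev (0 : Idx (D + 2) r q → E) = 0 from MultilinearMap.ext fun v => ev_zero v] at this
      simp only [zero_apply, Finset.sum_const_zero, add_zero] at this
      rw [show ev (0 : Idx (D + 2) r q → E) v = 0 from ev_zero v, ← this]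
      exact map_sum (evLin v) _ _
    · intro u hu
      refine ev_injective fun v => ?_
      have := h1 u (fun k => refl (bas 1) (v k))
      simp only [refl_refl] at this
      rw [this, hu]; exact (ev_zero _).trans (ev_zero _).symm
  refine ev_injective fun u => ?_
  rw [hzero]; exact (ev_zero _).symm

end Schur

/-! ### Pairings -/

section Pairings

variable {d r q : ℕ}

theorem metric_comm (m n : Fin d) : metric m n = metric n m := by
  rw [← dot_bas_bas, dot_comm, dot_bas_bas]

theorem invMat_comm (x : Pt d) (m n : Fin d) : invMat x m n = invMat x n m := by
  rw [invMat, invMat, metric_comm, mul_comm (low x m)]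

/-- The origin serves as the base point of all combinations of pairings: by the convention for
division by zero, `I` is there the metric, and `refl 0` the identity. -/
theorem invMat_zero (m n : Fin d) : invMat (0 : Pt d) m n = metric m n := by
  simp [invMat, low]

theorem sum_mul_metric_eq_dot (w w' : Pt d) :
    ∑ n, ∑ m, w n * w' m * metric n m = dot w w' := by
  simp only [metric, mul_ite, mul_zero, Finset.sum_ite_eq, Finset.mem_univ, if_true, dot, low]
  exact Finset.sum_congr rfl fun n _ => by ring

theorem sum_mul_invMat_eq_dot (x w w' : Pt d) :
    ∑ n, ∑ m, w n * w' m * invMat x n m = dot w (refl x w') := by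
  simp only [dot, refl_eq_sum, Finset.mul_sum, low]
  refine Finset.sum_congr rfl fun n _ => Finset.sum_congr rfl fun m _ => ?_
  rw [invMat_comm x n m]
  linear_combination (-(w n * w' m * invMat x m n)) * eta_mul_self n

/-- After relabelling positions by `e` the pairs are independent, and distributivity factorizes the
sum over all indices. -/
theorem ev_pairs {P : Type*} [Fintype P] [DecidableEq P] (m : P → Fin d → Fin d → ℝ)
    (e : Equiv.Perm (P ⊕ P)) (w : P ⊕ P → Pt d) :
    ev (fun c : P ⊕ P → Fin d => ∏ k, m k (c (e (Sum.inl k))) (c (e (Sum.inr k)))) w =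
      ∏ k, ∑ n, ∑ n', w (e (Sum.inl k)) n * w (e (Sum.inr k)) n' * m k n n' := by
  have h := ev_comp_perm (fun c : P ⊕ P → Fin d => ∏ k, m k (c (Sum.inl k)) (c (Sum.inr k))) e w
  refine h.trans ?_
  generalize hw : w ∘ e = w'
  have hw' : ∀ p, w (e p) = w' p := fun p => by rw [← hw]; rfl
  simp only [hw']
  rw [Finset.prod_univ_sum, Fintype.piFinset_univ, ev_apply]
  simp only [Finset.prod_univ_sum, Fintype.piFinset_univ]
  rw [← Fintype.sum_prod_type']
  refine Fintype.sum_equiv (Equiv.sumArrowEquivProdArrow P P (Fin d)) _ _ fun c => ?_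
  simp only [Fintype.prod_sum_type, Finset.prod_mul_distrib, smul_eq_mul]
  rfl

theorem ev_ev {E : Type*} [AddCommGroup E] [Module ℝ E] (M : Idx d r q → Idx d r q → E)
    (u v : Pos r q → Pt d) :
    ev (ev M u) v = ev (fun c : Pos r q ⊕ Pos r q → Fin d => M (c ∘ Sum.inl) (c ∘ Sum.inr))
      (Sum.elim u v) := by
  rw [ev_apply, ev_apply]
  simp only [ev_apply, Finset.sum_apply, Pi.smul_apply, Finset.smul_sum]
  rw [Finset.sum_comm, ← Fintype.sum_prod_type']
  refine (Fintype.sum_equiv (Equiv.sumArrowEquivProdArrow _ _ (Fin d)) _ _ fun c => ?_).symm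
  simp only [Fintype.prod_sum_type, smul_smul, Sum.elim_inl, Sum.elim_inr]
  rw [mul_comm]; rfl

theorem ev_ev_pairingTerm (e : Equiv.Perm (Pos r q ⊕ Pos r q)) (x : Pt d) (u v : Pos r q → Pt d) :
    ev (ev (pairingTerm e x) u) v = ∏ k,
      if (e (Sum.inl k)).isLeft = (e (Sum.inr k)).isLeft then
        dot (Sum.elim u v (e (Sum.inl k))) (Sum.elim u v (e (Sum.inr k)))
      else dot (Sum.elim u v (e (Sum.inl k))) (refl x (Sum.elim u v (e (Sum.inr k)))) := by
  rw [ev_ev]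
  have := ev_pairs (fun k n n' => if (e (Sum.inl k)).isLeft = (e (Sum.inr k)).isLeft then
    metric n n' else invMat x n n') e (Sum.elim u v)
  have hc : ∀ c : Pos r q ⊕ Pos r q → Fin d, Sum.elim (c ∘ Sum.inl) (c ∘ Sum.inr) = c :=
    fun c => by ext1 p; rcases p with p | p <;> rfl
  simp only [pairingTerm, hc]
  refine this.trans (Finset.prod_congr rfl fun k _ => ?_)
  split_ifs
  · exact sum_mul_metric_eq_dot _ _
  · exact sum_mul_invMat_eq_dot _ _ _

/-- The dependence of a pairing on the point is given by a reflection of the second group. -/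
theorem ev_ev_pairingTerm_eq (e : Equiv.Perm (Pos r q ⊕ Pos r q)) (x : Pt d)
    (u v : Pos r q → Pt d) :
    ev (ev (pairingTerm e x) u) v = ev (ev (pairingTerm e 0) u) (fun k => refl x (v k)) := by
  rw [ev_ev_pairingTerm, ev_ev_pairingTerm]
  refine Finset.prod_congr rfl fun k _ => ?_
  rcases h1 : e (Sum.inl k) with p | p <;> rcases h2 : e (Sum.inr k) with p' | p' <;>
    simp [refl_zero, refl_refl, dot_refl_comm]

theorem reflInvariant_pairingTerm (e : Equiv.Perm (Pos r q ⊕ Pos r q)) (x : Pt d) :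
    ReflInvariant (pairingTerm e 0 : Idx d r q → Idx d r q → ℝ) x := by
  intro u v
  rw [ev_ev_pairingTerm, ev_ev_pairingTerm]
  refine Finset.prod_congr rfl fun k _ => ?_
  rcases h1 : e (Sum.inl k) with p | p <;> rcases h2 : e (Sum.inr k) with p' | p' <;>
    simp [refl_zero, dot_refl_refl]

/-- Grouping the terms of the product rule by pairs, the two rotations of the members of a pair
cancel because the generator is skew for `dot`. -/
theorem lieInvariant_pairingTerm (e : Equiv.Perm (Pos r q ⊕ Pos r q)) :
    LieInvariant (pairingTerm e 0 : Idx d r q → Idx d r q → ℝ) := by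
  intro ω hω u v
  have hev : ∀ u v : Pos r q → Pt d, ev (ev (pairingTerm e 0) u) v =
      ∏ k, dot (Sum.elim u v (e (Sum.inl k))) (Sum.elim u v (e (Sum.inr k))) := by
    intro u v
    rw [ev_ev_pairingTerm]
    simp only [refl_zero, ite_self]
  simp only [hev, ← Sum.update_elim_inl, ← Sum.update_elim_inr]
  generalize hw : Sum.elim u v = w
  have hwl : ∀ k, u k = w (Sum.inl k) := fun k => by rw [← hw]; rfl
  have hwr : ∀ k, v k = w (Sum.inr k) := fun k => by rw [← hw]; rfl
  simp only [hwl, hwr]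
  rw [← Fintype.sum_sum_type (fun p => ∏ k, dot (Function.update w p (gen ω (w p)) (e (Sum.inl k)))
    (Function.update w p (gen ω (w p)) (e (Sum.inr k))))]
  rw [← Equiv.sum_comp e, Fintype.sum_sum_type, ← Finset.sum_add_distrib]
  refine Finset.sum_eq_zero fun k _ => ?_
  rw [← Finset.mul_prod_erase _ _ (Finset.mem_univ k),
    ← Finset.mul_prod_erase _ _ (Finset.mem_univ k)]
  have hl : ∀ p, p = Sum.inl k ∨ p = Sum.inr k → ∏ k' ∈ Finset.univ.erase k,
      dot (Function.update w (e p) (gen ω (w (e p))) (e (Sum.inl k')))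
      (Function.update w (e p) (gen ω (w (e p))) (e (Sum.inr k'))) =
      ∏ k' ∈ Finset.univ.erase k, dot (w (e (Sum.inl k'))) (w (e (Sum.inr k'))) := by
    intro p hp
    refine Finset.prod_congr rfl fun k' hk' => ?_
    have := Finset.ne_of_mem_erase hk'
    rw [Function.update_of_ne, Function.update_of_ne] <;>
    · rcases hp with rfl | rfl <;> simp [this]
  rw [hl _ (Or.inl rfl), hl _ (Or.inr rfl), ← add_mul]
  have h1 : e (Sum.inr k) ≠ e (Sum.inl k) := by simp
  rw [Function.update_self, Function.update_of_ne h1, Function.update_self,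
    Function.update_of_ne h1.symm, dot_gen hω, zero_mul]

/-! ### The leading term -/

/-- Regrouping of the index positions as `r` symmetrized ones and `q + 1` antisymmetrized ones. -/
def regroup (r q : ℕ) : Fin r ⊕ Fin (q + 1) ≃ Pos r q where
  toFun := Sum.elim (fun k => Sum.inl k.castSucc)
    (Fin.cons (Sum.inl (Fin.last r)) fun k => Sum.inr k)
  invFun := Sum.elim (fun i => Fin.lastCases (Sum.inr 0) (fun k => Sum.inl k) i)
    (fun k => Sum.inr k.succ)
  left_inv p := by
    rcases p with k | k
    · simp
    · refine Fin.cases ?_ (fun k => ?_) k <;> simp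
  right_inv p := by
    rcases p with k | k
    · refine Fin.lastCases ?_ (fun k => ?_) k <;> simp
    · simp

/-- The permutation of the index positions in a term of `leading`. -/
def leadPerm (σ : Equiv.Perm (Fin (r + 1))) (α : Equiv.Perm (Fin r)) (β : Equiv.Perm (Fin (q + 1))) :
    Equiv.Perm (Pos r q) :=
  (regroup r q).symm.trans ((Equiv.sumCongr α β).trans
    ((regroup r q).trans (Equiv.sumCongr σ (Equiv.refl (Fin q)))))

theorem pairingTerm_cross (π ρ : Equiv.Perm (Pos r q)) (x : Pt d) (a b : Idx d r q) :
    pairingTerm (Equiv.sumCongr π ρ) x a b = ∏ k, invMat x (a (π k)) (b (ρ k)) := by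
  simp [pairingTerm]

theorem cons_regroup (a : Idx d r q) (σ : Equiv.Perm (Fin (r + 1))) (k : Fin (q + 1)) :
    (Fin.cons (a (Sum.inl (σ (Fin.last r)))) (fun k : Fin q => a (Sum.inr k)) :
      Fin (q + 1) → Fin d) k = a (Sum.map σ id (regroup r q (Sum.inr k))) := by
  refine Fin.cases ?_ (fun k => ?_) k <;> simp [regroup]

/-- Multiplying out the two blocks exhibits the leading term as a combination of pairings that only
join positions of different groups. -/
theorem leading_eq (x : Pt d) (a b : Idx d r q) :
    leading x a b = ((((r + 1).factorial : ℝ) ^ 2)⁻¹ * ((r.factorial : ℝ)⁻¹ *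
      ((q + 1).factorial : ℝ)⁻¹)) * ∑ σ : Equiv.Perm (Fin (r + 1)), ∑ τ : Equiv.Perm (Fin (r + 1)),
        ∑ α : Equiv.Perm (Fin r), ∑ β : Equiv.Perm (Fin (q + 1)),
          ((Equiv.Perm.sign β : ℤ) : ℝ) *
            pairingTerm (Equiv.sumCongr (leadPerm σ α β)
              (Equiv.sumCongr τ (Equiv.refl (Fin q)))) x a b := by
  rw [leading, mul_assoc]
  congr 1
  rw [Finset.mul_sum]
  refine Finset.sum_congr rfl fun σ _ => ?_
  rw [Finset.mul_sum]
  refine Finset.sum_congr rfl fun τ _ => ?_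
  rw [symBlock, altBlock, mul_mul_mul_comm]
  congr 1
  rw [Finset.sum_mul]
  refine Finset.sum_congr rfl fun α _ => ?_
  rw [Finset.mul_sum]
  refine Finset.sum_congr rfl fun β _ => ?_
  rw [pairingTerm_cross, mul_left_comm]
  congr 1
  rw [← Equiv.prod_comp (regroup r q), Fintype.prod_sum_type]
  congr 1
  · refine Finset.prod_congr rfl fun k _ => ?_
    simp only [leadPerm, Equiv.trans_apply, Equiv.symm_apply_apply]
    simp [regroup]
  · refine Finset.prod_congr rfl fun k _ => ?_
    simp only [cons_regroup, leadPerm, Equiv.trans_apply, Equiv.symm_apply_apply]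
    rfl

/-- The span of all pairings. -/
def pairings (d r q : ℕ) : Submodule ℝ (Pt d → Idx d r q → Idx d r q → ℝ) :=
  Submodule.span ℝ (Set.range pairingTerm)

theorem leading_eq_sum : (leading : Pt d → Idx d r q → Idx d r q → ℝ) =
    ((((r + 1).factorial : ℝ) ^ 2)⁻¹ * ((r.factorial : ℝ)⁻¹ * ((q + 1).factorial : ℝ)⁻¹)) •
      ∑ σ : Equiv.Perm (Fin (r + 1)), ∑ τ : Equiv.Perm (Fin (r + 1)), ∑ α : Equiv.Perm (Fin r),
        ∑ β : Equiv.Perm (Fin (q + 1)), ((Equiv.Perm.sign β : ℤ) : ℝ) •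
          pairingTerm (Equiv.sumCongr (leadPerm σ α β)
            (Equiv.sumCongr τ (Equiv.refl (Fin q)))) := by
  ext x a b
  rw [leading_eq]
  simp only [Pi.smul_apply, Finset.sum_apply, smul_eq_mul]

theorem leading_mem : (leading : Pt d → Idx d r q → Idx d r q → ℝ) ∈ pairings d r q := by
  rw [leading_eq_sum]
  refine Submodule.smul_mem _ _ (Submodule.sum_mem _ fun σ _ => Submodule.sum_mem _ fun τ _ =>
    Submodule.sum_mem _ fun α _ => Submodule.sum_mem _ fun β _ => Submodule.smul_mem _ _
      (Submodule.subset_span ⟨_, rfl⟩))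

theorem etaTerms_le : etaTerms d r q ≤ pairings d r q :=
  Submodule.span_mono (by rintro f ⟨e, _, rfl⟩; exact ⟨e, rfl⟩)

/-- Extension of linear properties from pairings to their span. -/
theorem pairings_induction {p : (Pt d → Idx d r q → Idx d r q → ℝ) → Prop}
    (h : ∀ e, p (pairingTerm e)) (h0 : p 0) (hadd : ∀ f g, p f → p g → p (f + g))
    (hsmul : ∀ (c : ℝ) f, p f → p (c • f)) {f : Pt d → Idx d r q → Idx d r q → ℝ}
    (hf : f ∈ pairings d r q) : p f := by
  induction hf using Submodule.span_induction with
  | mem f hf => obtain ⟨e, rfl⟩ := hf; exact h e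
  | zero => exact h0
  | add f g _ _ hf hg => exact hadd f g hf hg
  | smul c f _ hf => exact hsmul c f hf

/-- Double evaluation as a linear map. -/
def evTwo {E : Type*} [AddCommGroup E] [Module ℝ E] (u v : Pos r q → Pt d) :
    (Idx d r q → Idx d r q → E) →ₗ[ℝ] E := evLin v ∘ₗ evLin u

theorem evTwo_apply {E : Type*} [AddCommGroup E] [Module ℝ E] (u v : Pos r q → Pt d)
    (M : Idx d r q → Idx d r q → E) : evTwo u v M = ev (ev M u) v := rfl

theorem LieInvariant.of_mem {f : Pt d → Idx d r q → Idx d r q → ℝ} (hf : f ∈ pairings d r q) :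
    LieInvariant (f 0) := by
  refine pairings_induction (p := fun f => LieInvariant (f 0)) lieInvariant_pairingTerm ?_ ?_ ?_ hf
  · intro ω hω u v
    simp only [← evTwo_apply]; simp
  · intro f g hf hg ω hω u v
    have h1 := hf ω hω u v
    have h2 := hg ω hω u v
    simp only [← evTwo_apply, Pi.add_apply, map_add, Finset.sum_add_distrib] at *
    linarith
  · intro c f hf ω hω u v
    have h1 := hf ω hω u v
    simp only [← evTwo_apply, Pi.smul_apply, map_smul, ← Finset.smul_sum, ← smul_add] at *
    rw [h1, smul_zero]

theorem ReflInvariant.of_mem {f : Pt d → Idx d r q → Idx d r q → ℝ} (hf : f ∈ pairings d r q)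
    (x : Pt d) : ReflInvariant (f 0) x := by
  refine pairings_induction (p := fun f => ReflInvariant (f 0) x)
    (fun e => reflInvariant_pairingTerm e x) ?_ ?_ ?_ hf
  · intro u v
    simp only [← evTwo_apply]; simp
  · intro f g hf hg u v
    have h1 := hf u v
    have h2 := hg u v
    simp only [← evTwo_apply, Pi.add_apply, map_add] at *
    rw [h1, h2]
  · intro c f hf u v
    have h1 := hf u v
    simp only [← evTwo_apply, Pi.smul_apply, map_smul] at *
    rw [h1]

/-- This reduces questions about `f` at all points to the single constant tensor `f 0`. -/
theorem ev_ev_of_mem {f : Pt d → Idx d r q → Idx d r q → ℝ} (hf : f ∈ pairings d r q)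
    (x : Pt d) (u v : Pos r q → Pt d) :
    ev (ev (f x) u) v = ev (ev (f 0) u) (fun k => refl x (v k)) := by
  refine pairings_induction (p := fun f => ev (ev (f x) u) v =
    ev (ev (f 0) u) (fun k => refl x (v k))) (fun e => ev_ev_pairingTerm_eq e x u v) ?_ ?_ ?_ hf
  · simp only [← evTwo_apply]; simp
  · intro f g h1 h2
    simp only [← evTwo_apply, Pi.add_apply, map_add] at *
    rw [h1, h2]
  · intro c f h1
    simp only [← evTwo_apply, Pi.smul_apply, map_smul] at *
    rw [h1]

end Pairings

/-! ### Traces of arrays -/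

section Arrays

variable {d : ℕ} {P : Type*} [Fintype P] [DecidableEq P]

/-- Overwriting the `i`-th index by a free one counts every tuple `d` times. -/
theorem card_mul_sum (g : (P → Fin d) → ℝ) (i : P) :
    (d : ℝ) * ∑ a, g a = ∑ a, ∑ n, g (Function.update a i n) := by
  rw [← Fintype.sum_prod_type']
  have hinv : Function.Involutive
      (fun p : (P → Fin d) × Fin d => (Function.update p.1 i p.2, p.1 i)) := by
    rintro ⟨a, n⟩; simp
  rw [Fintype.sum_equiv hinv.toPerm (fun p : (P → Fin d) × Fin d => g (Function.update p.1 i p.2))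
    (fun p => g p.1) (fun p => rfl), Fintype.sum_prod_type]
  simp [Finset.mul_sum]

/-- Contraction of `i` and `j` is adjoint to multiplication by the metric. The factors `d` appear
because the sum on the right still runs over the two contracted indices, on which nothing depends.
-/
theorem sum_mul_metric (g h : (P → Fin d) → ℝ) {i j : P} (hij : i ≠ j)
    (hi : ∀ a n, h (Function.update a i n) = h a) (hj : ∀ a n, h (Function.update a j n) = h a) :
    (d : ℝ) * (d * ∑ a, g a * (metric (a i) (a j) * h a)) =
      ∑ a, (∑ n, eta n * g (Function.update (Function.update a i n) j n)) * h a := by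
  rw [card_mul_sum _ j, card_mul_sum _ i]
  refine Finset.sum_congr rfl fun a _ => ?_
  rw [Finset.sum_mul]
  refine Finset.sum_congr rfl fun n _ => ?_
  rw [Finset.sum_eq_single n]
  · rw [hj, hi, Function.update_of_ne hij, Function.update_self, Function.update_self, metric_self]
    ring
  · intro m _ hm
    rw [Function.update_of_ne hij, Function.update_self, Function.update_self,
      metric_of_ne hm.symm]
    ring
  · simp

theorem sum_eta_metric_metric (a b : Fin d) :
    ∑ n, eta n * (metric n a * metric n b) = metric a b := by
  rw [Finset.sum_eq_single a]
  · rw [metric_self, ← mul_assoc, eta_mul_self, one_mul]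
  · intro n _ hn; rw [metric_of_ne hn]; ring
  · simp

/-- The product of metrics over a pairing of the positions `P ⊕ P`. -/
def pairProd (e : Equiv.Perm (P ⊕ P)) (c : P ⊕ P → Fin d) : ℝ :=
  ∏ k, metric (c (e (Sum.inl k))) (c (e (Sum.inr k)))

/-- The pair to which a position belongs. -/
def pairKey {Q : Type*} (p : Q ⊕ Q) : Q := Sum.elim id id p

theorem pairKey_eq_iff {Q : Type*} {p s : Q ⊕ Q} : pairKey p = pairKey s ↔ p = s ∨ p = s.swap := by
  rcases p with p | p <;> rcases s with s | s <;> simp [pairKey]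

theorem metric_pair {Q : Type*} (e : Equiv.Perm (Q ⊕ Q)) (c : Q ⊕ Q → Fin d) (p : Q ⊕ Q) :
    metric (c (e (Sum.inl (pairKey p)))) (c (e (Sum.inr (pairKey p)))) =
      metric (c (e p)) (c (e p.swap)) := by
  rcases p with p | p
  · rfl
  · exact metric_comm _ _

theorem pairProd_eq (e : Equiv.Perm (P ⊕ P)) (c : P ⊕ P → Fin d) (p : P ⊕ P) :
    pairProd e c = metric (c (e p)) (c (e p.swap)) *
      ∏ k ∈ Finset.univ.erase (pairKey p), metric (c (e (Sum.inl k))) (c (e (Sum.inr k))) := by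
  rw [pairProd, ← Finset.mul_prod_erase _ _ (Finset.mem_univ (pairKey p)), metric_pair]

theorem pairProd_eq₂ (e : Equiv.Perm (P ⊕ P)) (c : P ⊕ P → Fin d) {p s : P ⊕ P}
    (h : pairKey s ≠ pairKey p) :
    pairProd e c = metric (c (e p)) (c (e p.swap)) * (metric (c (e s)) (c (e s.swap)) *
      ∏ k ∈ (Finset.univ.erase (pairKey p)).erase (pairKey s),
        metric (c (e (Sum.inl k))) (c (e (Sum.inr k)))) := by
  rw [pairProd_eq e c p, ← Finset.mul_prod_erase _ _ (Finset.mem_erase.2 ⟨h, Finset.mem_univ _⟩),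
    metric_pair]

theorem ne_of_pairKey_ne {Q : Type*} {k : Q} {p : Q ⊕ Q} (h : k ≠ pairKey p) :
    Sum.inl k ≠ p ∧ Sum.inr k ≠ p := by
  constructor <;> rintro rfl <;> exact h rfl

/-- Contracting two positions of a pairing and multiplying by the metric gives a multiple of a
pairing that joins these positions. -/
theorem metric_mul_trace_pairProd (e : Equiv.Perm (P ⊕ P)) {i j : P ⊕ P} (hij : i ≠ j) :
    ∃ (e' : Equiv.Perm (P ⊕ P)) (κ : ℝ),
      (∃ k, (e' (Sum.inl k) = i ∧ e' (Sum.inr k) = j) ∨ (e' (Sum.inl k) = j ∧ e' (Sum.inr k) = i)) ∧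
      ∀ c : P ⊕ P → Fin d, metric (c i) (c j) * ∑ n, eta n *
        pairProd e (Function.update (Function.update c i n) j n) = κ * pairProd e' c := by
  obtain ⟨p, rfl⟩ := e.surjective i
  obtain ⟨s, rfl⟩ := e.surjective j
  have hps : p ≠ s := fun h => hij (congrArg e h)
  -- If the contracted positions form a pair, the contraction gives the factor `d`.
  by_cases hk : pairKey s = pairKey p
  · have hs : s = p.swap := (pairKey_eq_iff.1 hk).resolve_left hps.symm
    subst hs
    refine ⟨e, d, ⟨pairKey p, ?_⟩, fun c => ?_⟩
    · rcases p with p | p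
      · exact Or.inl ⟨rfl, rfl⟩
      · exact Or.inr ⟨rfl, rfl⟩
    · have h1 : ∀ n, pairProd e (Function.update (Function.update c (e p) n) (e p.swap) n) =
          metric n n * ∏ k ∈ Finset.univ.erase (pairKey p),
            metric (c (e (Sum.inl k))) (c (e (Sum.inr k))) := by
        intro n
        rw [pairProd_eq e _ p, Function.update_of_ne hij, Function.update_self,
          Function.update_self]
        congr 1
        refine Finset.prod_congr rfl fun k hk' => ?_
        have h1 := ne_of_pairKey_ne (Finset.ne_of_mem_erase hk')
        have h2 := ne_of_pairKey_ne (hk ▸ Finset.ne_of_mem_erase hk' : k ≠ pairKey p.swap)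
        simp [h1, h2]
      simp only [h1, metric_self, ← mul_assoc, eta_mul_self, one_mul, Finset.sum_const,
        Finset.card_univ, Fintype.card_fin, nsmul_eq_mul]
      rw [pairProd_eq e c p]; ring
  -- Otherwise the contraction joins the two partners, and the extra metric joins the contracted
  -- positions: this is the pairing in which the partner of the first position has been exchanged
  -- with the second position.
  · have hps' : p.swap ≠ s := by
      rintro rfl; exact hk (pairKey_eq_iff.2 (Or.inr rfl))
    have hsp' : s.swap ≠ p := by
      rintro rfl; exact hk (pairKey_eq_iff.2 (Or.inr (by simp)))
    have hpp : p.swap ≠ p := by rcases p with p | p <;> simp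
    have hss : s.swap ≠ s := by rcases s with s | s <;> simp
    have hsp : s.swap ≠ p.swap := fun h => hps (Sum.swap_leftInverse.injective h).symm
    refine ⟨e.trans (Equiv.swap (e p.swap) (e s)), 1, ⟨pairKey p, ?_⟩, fun c => ?_⟩
    · rcases p with p | p
      · refine Or.inl ⟨?_, ?_⟩
        · exact Equiv.swap_apply_of_ne_of_ne (by simp) hij
        · exact Equiv.swap_apply_left _ _
      · refine Or.inr ⟨?_, ?_⟩
        · exact Equiv.swap_apply_left _ _
        · exact Equiv.swap_apply_of_ne_of_ne (by simp) hij
    · have h1 : ∀ n, pairProd e (Function.update (Function.update c (e p) n) (e s) n) =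
          metric n (c (e p.swap)) * (metric n (c (e s.swap)) *
          ∏ k ∈ (Finset.univ.erase (pairKey p)).erase (pairKey s),
            metric (c (e (Sum.inl k))) (c (e (Sum.inr k)))) := by
        intro n
        rw [pairProd_eq₂ e _ hk]
        congr 1
        · simp [hps, hps', hpp]
        congr 1
        · simp [hss, hsp']
        refine Finset.prod_congr rfl fun k hk' => ?_
        have h1 := ne_of_pairKey_ne (Finset.ne_of_mem_erase (Finset.mem_of_mem_erase hk'))
        have h2 := ne_of_pairKey_ne (Finset.ne_of_mem_erase hk')
        simp [h1, h2]
      have h2 : ∀ n, eta n * pairProd e (Function.update (Function.update c (e p) n) (e s) n) =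
          (eta n * (metric n (c (e p.swap)) * metric n (c (e s.swap)))) *
          ∏ k ∈ (Finset.univ.erase (pairKey p)).erase (pairKey s),
            metric (c (e (Sum.inl k))) (c (e (Sum.inr k))) := by
        intro n; rw [h1]; ring
      simp only [h2]
      rw [← Finset.sum_mul, sum_eta_metric_metric, pairProd_eq₂ _ c hk, one_mul]
      simp only [Equiv.trans_apply, Equiv.swap_apply_left, Equiv.swap_apply_right]
      rw [Equiv.swap_apply_of_ne_of_ne (e.injective.ne hpp.symm) hij,
        Equiv.swap_apply_of_ne_of_ne (e.injective.ne hsp) (e.injective.ne hss)]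
      congr 2
      refine Finset.prod_congr rfl fun k hk' => ?_
      have h1 := ne_of_pairKey_ne (Finset.ne_of_mem_erase (Finset.mem_of_mem_erase hk'))
      have h2 := ne_of_pairKey_ne (Finset.ne_of_mem_erase hk')
      have h3 : k ≠ pairKey p.swap := by
        rw [pairKey_eq_iff.2 (Or.inr rfl : p.swap = p ∨ p.swap = p.swap)]
        exact Finset.ne_of_mem_erase (Finset.mem_of_mem_erase hk')
      have h3 := ne_of_pairKey_ne h3
      rw [Equiv.swap_apply_of_ne_of_ne (e.injective.ne h3.1) (e.injective.ne h2.1),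
        Equiv.swap_apply_of_ne_of_ne (e.injective.ne h3.2) (e.injective.ne h2.2)]

end Arrays

/-! ### Uniqueness of the numerator -/

section Uniqueness

variable {d r q : ℕ}

/-- Symmetric pairs are traceless by definition, mixed pairs by the Young relation, antisymmetric
pairs because equal indices give zero. -/
theorem IsTracelessHook.trace_eq_zero {E : Type*} [AddCommGroup E] [Module ℝ E]
    {T : Idx d r q → E} (h : IsTracelessHook T) {i j : Pos r q} (hij : i ≠ j) (a : Idx d r q) :
    ∑ n, eta n • T (Function.update (Function.update a i n) j n) = 0 := by
  have hm := h.mhook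
  have hmixed : ∀ (i : Fin (r + 1)) (k : Fin q), ∑ n, eta n • T (Function.update
      (Function.update a (Sum.inl i) n) (Sum.inr k) n) = 0 := by
    intro i k
    rw [← hm.traceless_mixed i k (fun k => bas (a k))]
    refine Finset.sum_congr rfl fun n _ => ?_
    rw [← ev_bas T]
    congr 2
    ext1 p
    rcases eq_or_ne p (Sum.inr k) with rfl | h1
    · simp
    · rcases eq_or_ne p (Sum.inl i) with rfl | h2
      · simp
      · simp [h1, h2]
  rcases i with i | i <;> rcases j with j | j
  · exact h.traceless i j (fun e => hij (congrArg _ e)) a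
  · exact hmixed i j
  · simp only [Function.update_comm hij]; exact hmixed j i
  · refine Finset.sum_eq_zero fun n _ => ?_
    rw [← ev_bas T, hm.eq_zero_of_right_eq (fun e => hij (congrArg _ e) : i ≠ j), smul_zero]
    simp [hij]

/-- If a pairing joins two positions of one group, it also joins two positions of the first. -/
theorem exists_left_pair {P : Type*} [Finite P] (e : Equiv.Perm (P ⊕ P))
    (h : ∃ k, (e (Sum.inl k)).isLeft = (e (Sum.inr k)).isLeft) :
    ∃ k, (e (Sum.inl k)).isLeft = true ∧ (e (Sum.inr k)).isLeft = true := by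
  by_contra hno
  push Not at hno
  -- If no pair lay inside the first group, distinct positions of that group would lie in distinct
  -- pairs. There are as many pairs as such positions, so every pair would meet the first group,
  -- including the pair joining two positions of one group.
  have hinj : Function.Injective fun p : P => pairKey (e.symm (Sum.inl p)) := by
    intro p p' hpp
    rcases h1 : e.symm (Sum.inl p) with k | k <;> rcases h2 : e.symm (Sum.inl p') with k' | k' <;>
      simp only [h1, h2, pairKey, Sum.elim_inl, Sum.elim_inr, id] at hpp <;> subst hpp
    · exact Sum.inl_injective (e.symm.injective (h1.trans h2.symm))
    · exact absurd (by rw [← h2]; simp) (hno k (by rw [← h1]; simp))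
    · exact absurd (by rw [← h1]; simp) (hno k (by rw [← h2]; simp))
    · exact Sum.inl_injective (e.symm.injective (h1.trans h2.symm))
  obtain ⟨k, hk⟩ := h
  obtain ⟨p, hp⟩ := Finite.surjective_of_injective hinj k
  simp only at hp
  rcases h1 : e.symm (Sum.inl p) with k' | k' <;>
    rw [h1] at hp <;> simp only [pairKey, Sum.elim_inl, Sum.elim_inr, id] at hp <;> subst hp
  · have h2 : (e (Sum.inl k')).isLeft = true := by rw [← h1]; simp
    exact hno k' h2 (hk ▸ h2)
  · have h2 : (e (Sum.inr k')).isLeft = true := by rw [← h1]; simp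
    exact hno k' (hk.trans h2) h2

/-- The pairing contains a metric with both positions in the first group; moved to the other factor
by `sum_mul_metric`, it becomes a trace of `T`. -/
theorem sum_mul_pairingTerm_eq_zero {T : Idx d r q → ℝ} (hT : IsTracelessHook T)
    {e : Equiv.Perm (Pos r q ⊕ Pos r q)}
    (he : ∃ k, (e (Sum.inl k)).isLeft = (e (Sum.inr k)).isLeft) (x : Pt d) (b : Idx d r q) :
    ∑ a, T a * pairingTerm e x a b = 0 := by
  rcases Nat.eq_zero_or_pos d with rfl | hd
  · have : IsEmpty (Idx 0 r q) := ⟨fun a => (a (Sum.inl 0)).elim0⟩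
    simp
  obtain ⟨k, h1, h2⟩ := exists_left_pair e he
  obtain ⟨i, hi⟩ := Sum.isLeft_iff.1 h1
  obtain ⟨j, hj⟩ := Sum.isLeft_iff.1 h2
  have hij : i ≠ j := by
    rintro rfl
    have := e.injective (hi.trans hj.symm)
    simp at this
  let h : Idx d r q → ℝ := fun a => ∏ k' ∈ Finset.univ.erase k,
    if (e (Sum.inl k')).isLeft = (e (Sum.inr k')).isLeft then
      metric (Sum.elim a b (e (Sum.inl k'))) (Sum.elim a b (e (Sum.inr k')))
    else
      invMat x (Sum.elim a b (e (Sum.inl k'))) (Sum.elim a b (e (Sum.inr k')))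
  have hh : ∀ a, pairingTerm e x a b = metric (a i) (a j) * h a := by
    intro a
    rw [pairingTerm, ← Finset.mul_prod_erase _ _ (Finset.mem_univ k), if_pos (h1.trans h2.symm),
      hi, hj]
    rfl
  have hindep : ∀ (p : Pos r q), (Sum.inl p = e (Sum.inl k) ∨ Sum.inl p = e (Sum.inr k)) →
      ∀ a n, h (Function.update a p n) = h a := by
    intro p hp a n
    refine Finset.prod_congr rfl fun k' hk' => ?_
    have hne := Finset.ne_of_mem_erase hk'
    have hl : e (Sum.inl k') ≠ Sum.inl p := by
      rcases hp with hp | hp <;> rw [hp] <;> simp [hne]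
    have hr : e (Sum.inr k') ≠ Sum.inl p := by
      rcases hp with hp | hp <;> rw [hp] <;> simp [hne]
    simp only [← Sum.update_elim_inl, Function.update_of_ne hl, Function.update_of_ne hr]
  have := sum_mul_metric T h hij (hindep i (Or.inl hi.symm)) (hindep j (Or.inr hj.symm))
  have h0 : ∀ a, ∑ n, eta n * T (Function.update (Function.update a i n) j n) = 0 :=
    fun a => hT.trace_eq_zero hij a
  simp only [h0, zero_mul, Finset.sum_const_zero, mul_eq_zero, Nat.cast_eq_zero, hd.ne',
    false_or] at this
  simpa only [hh] using this

/-- A combination of `η`-terms that is of traceless hook type in the first group vanishes. -/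
theorem eq_zero_of_mem_etaTerms {f : Pt d → Idx d r q → Idx d r q → ℝ} (hf : f ∈ etaTerms d r q)
    {x : Pt d} (h : ∀ b, IsTracelessHook (fun a => f x a b)) : f x = 0 := by
  -- Tracelessness makes `f x` orthogonal to all η-terms for the Euclidean product of components. As
  -- `f` is itself a combination of η-terms, its sum of squares vanishes.
  have key : ∀ g ∈ etaTerms d r q, ∀ b, ∑ a, f x a b * g x a b = 0 := by
    intro g hg b
    induction hg using Submodule.span_induction with
    | mem g hg =>
      obtain ⟨e, he, rfl⟩ := hg
      exact sum_mul_pairingTerm_eq_zero (h b) he x b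
    | zero => simp
    | add g g' _ _ h1 h2 =>
      simp only [Pi.add_apply, mul_add, Finset.sum_add_distrib, h1, h2, add_zero]
    | smul c g _ h1 =>
      simp only [Pi.smul_apply, smul_eq_mul, mul_left_comm _ c, ← Finset.mul_sum, h1, mul_zero]
  ext a b
  have := (Finset.sum_eq_zero_iff_of_nonneg fun a _ => mul_self_nonneg (f x a b)).1 (key f hf b) a
    (Finset.mem_univ a)
  simpa using this

end Uniqueness

/-! ### Symmetries of the leading term -/

section Leading

variable {d r q : ℕ}

theorem symBlock_comm {t : ℕ} (x : Pt d) (i j : Fin t → Fin d) :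
    symBlock x i j = symBlock x j i := by
  rw [symBlock, symBlock, ← Equiv.sum_comp (Equiv.inv (Equiv.Perm (Fin t)))]
  congr 1
  refine Finset.sum_congr rfl fun σ _ => ?_
  rw [← Equiv.prod_comp σ]
  refine Finset.prod_congr rfl fun k _ => ?_
  rw [invMat_comm]; simp

theorem altBlock_comm {t : ℕ} (x : Pt d) (i j : Fin t → Fin d) :
    altBlock x i j = altBlock x j i := by
  rw [altBlock, altBlock, ← Equiv.sum_comp (Equiv.inv (Equiv.Perm (Fin t)))]
  congr 1
  refine Finset.sum_congr rfl fun σ _ => ?_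
  rw [← Equiv.prod_comp σ]
  congr 1
  · simp
  · refine Finset.prod_congr rfl fun k _ => ?_
    rw [invMat_comm]; simp

theorem altBlock_comp {t : ℕ} (x : Pt d) (i j : Fin t → Fin d) (π : Equiv.Perm (Fin t)) :
    altBlock x (i ∘ π) j = ((Equiv.Perm.sign π : ℤ) : ℝ) * altBlock x i j := by
  rw [altBlock, altBlock, mul_left_comm]
  congr 1
  rw [← Equiv.sum_comp (Equiv.mulLeft π) (fun σ => ((Equiv.Perm.sign σ : ℤ) : ℝ) *
    ∏ k, invMat x (i (σ k)) (j k)), Finset.mul_sum]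
  refine Finset.sum_congr rfl fun σ _ => ?_
  have h : ((Equiv.Perm.sign π : ℤ) : ℝ) * ((Equiv.Perm.sign π : ℤ) : ℝ) = 1 := by
    rw [← Int.cast_mul, ← Units.val_mul, Int.units_mul_self]; simp
  simp only [Equiv.coe_mulLeft, Equiv.Perm.sign_mul, Units.val_mul, Int.cast_mul, Function.comp,
    Equiv.Perm.mul_apply]
  rw [← mul_assoc, ← mul_assoc, h, one_mul]

theorem leading_comm (x : Pt d) (a b : Idx d r q) : leading x a b = leading x b a := by
  rw [leading, leading, Finset.sum_comm]
  simp only [symBlock_comm x (fun k : Fin r => a _), altBlock_comm x (Fin.cons (a _) _)]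

/-- A summand of `leading` before the symmetrization of the first group. -/
def leadCore (x : Pt d) (j : Fin r → Fin d) (n : Fin (q + 1) → Fin d) (c : Idx d r q) : ℝ :=
  symBlock x (fun k => c (Sum.inl k.castSucc)) j *
    altBlock x (Fin.cons (c (Sum.inl (Fin.last r))) (fun k => c (Sum.inr k))) n

/-- The last symmetric position belongs to the antisymmetrized block, so this is a transposition
inside that block. -/
theorem leadCore_swap (x : Pt d) (j : Fin r → Fin d) (n : Fin (q + 1) → Fin d) (k : Fin q)
    (c : Idx d r q) :
    leadCore x j n (c ∘ Equiv.swap (Sum.inl (Fin.last r)) (Sum.inr k)) = -leadCore x j n c := by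
  have h1 : ∀ i : Fin r, (c ∘ Equiv.swap (Sum.inl (Fin.last r)) (Sum.inr k))
      (Sum.inl i.castSucc) = c (Sum.inl i.castSucc) := by
    intro i
    rw [Function.comp, Equiv.swap_apply_of_ne_of_ne _ (by simp)]
    intro h
    exact (Fin.castSucc_lt_last i).ne (Sum.inl_injective h)
  have h2 : (Fin.cons ((c ∘ Equiv.swap (Sum.inl (Fin.last r)) (Sum.inr k)) (Sum.inl (Fin.last r)))
      (fun k' => (c ∘ Equiv.swap (Sum.inl (Fin.last r)) (Sum.inr k)) (Sum.inr k')) :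
        Fin (q + 1) → Fin d) =
      (Fin.cons (c (Sum.inl (Fin.last r))) (fun k => c (Sum.inr k)) : Fin (q + 1) → Fin d) ∘
        Equiv.swap 0 k.succ := by
    ext1 i
    refine Fin.cases ?_ (fun i => ?_) i
    · simp
    · rcases eq_or_ne i k with rfl | hi
      · simp
      · have h3 : Equiv.swap 0 k.succ i.succ = i.succ := Equiv.swap_apply_of_ne_of_ne
          (Fin.succ_ne_zero i) (fun h => hi (Fin.succ_injective _ h))
        simp [Equiv.swap_apply_of_ne_of_ne, hi, h3]
  simp only [leadCore, h1, h2, altBlock_comp]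
  rw [Equiv.Perm.sign_swap (Fin.succ_ne_zero k).symm]
  simp

theorem leadCore_antisymm (x : Pt d) (j : Fin r → Fin d) (n : Fin (q + 1) → Fin d)
    (τ : Equiv.Perm (Fin q)) (c : Idx d r q) :
    leadCore x j n (c ∘ Sum.map id τ) = ((Equiv.Perm.sign τ : ℤ) : ℝ) * leadCore x j n c := by
  have h2 : (Fin.cons ((c ∘ Sum.map id τ) (Sum.inl (Fin.last r)))
      (fun k' => (c ∘ Sum.map id τ) (Sum.inr k')) : Fin (q + 1) → Fin d) =
      (Fin.cons (c (Sum.inl (Fin.last r))) (fun k => c (Sum.inr k)) : Fin (q + 1) → Fin d) ∘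
        Equiv.Perm.decomposeFin.symm (0, τ) := by
    ext1 i
    refine Fin.cases ?_ (fun i => ?_) i
    · simp
    · simp
  simp only [leadCore, h2, altBlock_comp]
  simp only [Function.comp, Sum.map_inl, id, Equiv.Perm.decomposeFin.symm_sign, if_true, one_mul]
  ring

/-- Symmetrization over the first group. -/
def symLeft (f : Idx d r q → ℝ) (a : Idx d r q) : ℝ :=
  ∑ σ : Equiv.Perm (Fin (r + 1)), f (a ∘ Sum.map σ id)

theorem symLeft_symm (f : Idx d r q → ℝ) (ρ : Equiv.Perm (Fin (r + 1))) (a : Idx d r q) :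
    symLeft f (a ∘ Sum.map ρ id) = symLeft f a := by
  rw [symLeft, symLeft, ← Equiv.sum_comp (Equiv.mulLeft ρ) (fun σ => f (a ∘ Sum.map σ id))]
  refine Finset.sum_congr rfl fun σ _ => ?_
  congr 1
  ext1 p; rcases p with p | p <;> rfl

/-- The exchange of `k` with the last symmetric position cancels the first term. For any other `j`,
absorb the transposition of `j` and the last position into the symmetrization. Since `(j last)(j k)
= (j k)(last k)`, the antisymmetry of `f` shows that the term is its own negative. -/
theorem symLeft_young {f : Idx d r q → ℝ} {k : Fin q}
    (hf : ∀ c, f (c ∘ Equiv.swap (Sum.inl (Fin.last r)) (Sum.inr k)) = -f c) (a : Idx d r q) :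
    symLeft f a + ∑ j, symLeft f (a ∘ Equiv.swap (Sum.inl j) (Sum.inr k)) = 0 := by
  have hconj : ∀ (σ : Equiv.Perm (Fin (r + 1))) (j : Fin (r + 1)),
      (a ∘ Equiv.swap (Sum.inl (σ j)) (Sum.inr k)) ∘ Sum.map σ id =
        (a ∘ Sum.map σ id) ∘ Equiv.swap (Sum.inl j) (Sum.inr k) := by
    intro σ j
    ext1 p
    rcases p with p | p
    · rcases eq_or_ne p j with rfl | hp
      · simp
      · simp [Equiv.swap_apply_of_ne_of_ne, hp]
    · rcases eq_or_ne p k with rfl | hp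
      · simp
      · simp [Equiv.swap_apply_of_ne_of_ne, hp]
  have h1 : ∑ j, symLeft f (a ∘ Equiv.swap (Sum.inl j) (Sum.inr k)) =
      ∑ j, ∑ σ : Equiv.Perm (Fin (r + 1)),
        f ((a ∘ Sum.map σ id) ∘ Equiv.swap (Sum.inl j) (Sum.inr k)) := by
    simp only [symLeft]
    rw [Finset.sum_comm, Finset.sum_comm (γ := Fin (r + 1))]
    refine Finset.sum_congr rfl fun σ _ => ?_
    rw [← Equiv.sum_comp σ]
    simp only [hconj]
  rw [h1, ← Finset.add_sum_erase _ _ (Finset.mem_univ (Fin.last r)), ← add_assoc]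
  have h2 : symLeft f a + ∑ σ : Equiv.Perm (Fin (r + 1)),
      f ((a ∘ Sum.map σ id) ∘ Equiv.swap (Sum.inl (Fin.last r)) (Sum.inr k)) = 0 := by
    simp only [hf, symLeft, Finset.sum_neg_distrib, add_neg_cancel]
  rw [h2, zero_add]
  refine Finset.sum_eq_zero fun j hj => ?_
  have hj' := Finset.ne_of_mem_erase hj
  have h3 : ∑ σ : Equiv.Perm (Fin (r + 1)),
      f ((a ∘ Sum.map σ id) ∘ Equiv.swap (Sum.inl j) (Sum.inr k)) =
      -∑ σ : Equiv.Perm (Fin (r + 1)),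
        f ((a ∘ Sum.map σ id) ∘ Equiv.swap (Sum.inl j) (Sum.inr k)) := by
    nth_rewrite 1 [← Equiv.sum_comp (Equiv.mulRight (Equiv.swap j (Fin.last r)))]
    rw [← Finset.sum_neg_distrib]
    refine Finset.sum_congr rfl fun σ _ => ?_
    rw [← hf]
    congr 1
    ext1 p
    simp only [Function.comp, Equiv.coe_mulRight]
    congr 1
    rcases p with p | p
    · rcases eq_or_ne p j with rfl | hp
      · rw [Equiv.swap_apply_left, Equiv.swap_apply_of_ne_of_ne (fun h => hj' (Sum.inl_injective h))
          (by simp), Equiv.swap_apply_left]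
        simp
      · rcases eq_or_ne p (Fin.last r) with rfl | hp'
        · rw [Equiv.swap_apply_of_ne_of_ne (fun h => hp (Sum.inl_injective h)) (by simp),
            Equiv.swap_apply_left, Equiv.swap_apply_right]
          simp
        · rw [Equiv.swap_apply_of_ne_of_ne (fun h => hp (Sum.inl_injective h)) (by simp),
            Equiv.swap_apply_of_ne_of_ne (fun h => hp' (Sum.inl_injective h)) (by simp),
            Equiv.swap_apply_of_ne_of_ne (fun h => hp (Sum.inl_injective h)) (by simp)]
          simp [Equiv.swap_apply_of_ne_of_ne hp hp']
    · rcases eq_or_ne p k with rfl | hp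
      · rw [Equiv.swap_apply_right, Equiv.swap_apply_right,
          Equiv.swap_apply_of_ne_of_ne (fun h => hj' (Sum.inl_injective h).symm) (by simp)]
        simp
      · rw [Equiv.swap_apply_of_ne_of_ne (by simp) (fun h => hp (Sum.inr_injective h)),
          Equiv.swap_apply_of_ne_of_ne (by simp) (fun h => hp (Sum.inr_injective h)),
          Equiv.swap_apply_of_ne_of_ne (by simp) (fun h => hp (Sum.inr_injective h))]
        simp
  linarith

theorem leading_eq_symLeft (x : Pt d) (b a : Idx d r q) :
    leading x a b = (((r + 1).factorial : ℝ) ^ 2)⁻¹ * ∑ τ : Equiv.Perm (Fin (r + 1)),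
      symLeft (leadCore x (fun k : Fin r => b (Sum.inl (τ k.castSucc)))
        (Fin.cons (b (Sum.inl (τ (Fin.last r)))) (fun k : Fin q => b (Sum.inr k)))) a := by
  rw [leading, Finset.sum_comm]; rfl

theorem leading_symm (x : Pt d) (b : Idx d r q) (σ : Equiv.Perm (Fin (r + 1))) (a : Idx d r q) :
    leading x (a ∘ Sum.map σ id) b = leading x a b := by
  simp only [leading_eq_symLeft, symLeft_symm]

theorem leading_antisymm (x : Pt d) (b : Idx d r q) (τ : Equiv.Perm (Fin q)) (a : Idx d r q) :
    leading x (a ∘ Sum.map id τ) b = ((Equiv.Perm.sign τ : ℤ) : ℝ) * leading x a b := by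
  have h : ∀ σ : Equiv.Perm (Fin (r + 1)), (a ∘ Sum.map id τ) ∘ Sum.map σ id =
      (a ∘ Sum.map σ id) ∘ Sum.map id τ := by
    intro σ; ext1 p; rcases p with p | p <;> rfl
  simp only [leading_eq_symLeft, symLeft, h, leadCore_antisymm, ← Finset.mul_sum]
  ring

theorem leading_young (x : Pt d) (b : Idx d r q) (k : Fin q) (a : Idx d r q) :
    leading x a b + ∑ j, leading x (a ∘ Equiv.swap (Sum.inl j) (Sum.inr k)) b = 0 := by
  simp only [leading_eq_symLeft]
  rw [← Finset.mul_sum, Finset.sum_comm, ← mul_add, ← Finset.sum_add_distrib]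
  simp only [symLeft_young (leadCore_swap _ _ _ k), Finset.sum_const_zero, mul_zero]

end Leading

/-! ### Existence of the numerator -/

section Existence

/-- Every array has a Euclidean orthogonal projection to a given subspace. -/
theorem exists_projection {X : Type*} [Fintype X] (S : Submodule ℝ (X → ℝ)) (t : X → ℝ) :
    ∃ s ∈ S, ∀ s' ∈ S, ∑ c, (t c - s c) * s' c = 0 := by
  let S' : Submodule ℝ (EuclideanSpace ℝ X) := S.map (WithLp.linearEquiv 2 ℝ (X → ℝ)).symm.toLinearMap
  obtain ⟨y, hy, z, hz, hyz⟩ := S'.exists_add_mem_mem_orthogonal (WithLp.toLp 2 t)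
  obtain ⟨s, hs, rfl⟩ := hy
  refine ⟨s, hs, fun s' hs' => ?_⟩
  have h1 := (Submodule.mem_orthogonal _ _).1 hz (WithLp.toLp 2 s') ⟨s', hs', rfl⟩
  have h2 : z = WithLp.toLp 2 (t - s) := by
    rw [WithLp.toLp_sub, hyz]; simp
  rw [h2, PiLp.inner_apply] at h1
  simpa [mul_comm] using h1

variable {d r q : ℕ}

/-- The array of all components at the origin. -/
def flat : (Pt d → Idx d r q → Idx d r q → ℝ) →ₗ[ℝ] (Pos r q ⊕ Pos r q → Fin d) → ℝ where
  toFun f c := f 0 (c ∘ Sum.inl) (c ∘ Sum.inr)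
  map_add' _ _ := rfl
  map_smul' _ _ := rfl

theorem flat_apply (f : Pt d → Idx d r q → Idx d r q → ℝ) (c : Pos r q ⊕ Pos r q → Fin d) :
    flat f c = f 0 (c ∘ Sum.inl) (c ∘ Sum.inr) := rfl

theorem flat_elim (f : Pt d → Idx d r q → Idx d r q → ℝ) (a b : Idx d r q) :
    flat f (Sum.elim a b) = f 0 a b := rfl

theorem flat_pairingTerm (e : Equiv.Perm (Pos r q ⊕ Pos r q)) :
    flat (pairingTerm e : Pt d → Idx d r q → Idx d r q → ℝ) = pairProd e := by
  ext c
  have hc : Sum.elim (c ∘ Sum.inl) (c ∘ Sum.inr) = c := by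
    ext1 p; rcases p with p | p <;> rfl
  simp only [flat_apply, pairingTerm, hc, invMat_zero, ite_self, pairProd]

/-- The operators on arrays that preserve a subspace and its orthogonal complement. -/
def reducing {X : Type*} [Fintype X] (S : Submodule ℝ (X → ℝ)) :
    Submodule ℝ (Module.End ℝ (X → ℝ)) where
  carrier := {A | (∀ s ∈ S, A s ∈ S) ∧
    ∀ t, (∀ s ∈ S, ∑ c, t c * s c = 0) → ∀ s ∈ S, ∑ c, A t c * s c = 0}
  add_mem' {A B} hA hB := ⟨fun s hs => S.add_mem (hA.1 s hs) (hB.1 s hs), fun t ht s hs => by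
    simp only [LinearMap.add_apply, Pi.add_apply, add_mul, Finset.sum_add_distrib,
      hA.2 t ht s hs, hB.2 t ht s hs, add_zero]⟩
  zero_mem' := ⟨fun s _ => S.zero_mem, fun t _ s _ => by simp⟩
  smul_mem' k A hA := ⟨fun s hs => S.smul_mem k (hA.1 s hs), fun t ht s hs => by
    simp only [LinearMap.smul_apply, Pi.smul_apply, smul_eq_mul, mul_assoc, ← Finset.mul_sum,
      hA.2 t ht s hs, mul_zero]⟩

/-- The image of `t - s` lies in `S`, since `A t = 0`, and is orthogonal to `S`. Linear relations of
`t` therefore pass to the component orthogonal to `S`. -/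
theorem apply_eq_zero_of_reducing {X : Type*} [Fintype X] {S : Submodule ℝ (X → ℝ)}
    {A : Module.End ℝ (X → ℝ)} (hA : A ∈ reducing S) {t s : X → ℝ} (hs : s ∈ S)
    (hts : ∀ s' ∈ S, ∑ c, (t c - s c) * s' c = 0) (h : A t = 0) : A (t - s) = 0 := by
  have h1 : A (t - s) ∈ S := by
    rw [map_sub, h, zero_sub]; exact S.neg_mem (hA.1 s hs)
  have h2 := hA.2 (t - s) hts _ h1
  ext c
  have := (Finset.sum_eq_zero_iff_of_nonneg fun c _ => mul_self_nonneg (A (t - s) c)).1 h2 c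
    (Finset.mem_univ c)
  simpa using this

/-- Permutation of the positions of an array. -/
def permOp {Q : Type*} (g : Equiv.Perm Q) : Module.End ℝ ((Q → Fin d) → ℝ) where
  toFun t c := t (c ∘ g)
  map_add' _ _ := rfl
  map_smul' _ _ := rfl

/-- Permuting each group separately keeps pairs within a group within that group; the adjoint is the
inverse permutation, which has the same form. -/
theorem permOp_mem (π ρ : Equiv.Perm (Pos r q)) :
    permOp (Equiv.sumCongr π ρ) ∈ reducing ((etaTerms d r q).map flat) := by
  have hmap : ∀ π ρ : Equiv.Perm (Pos r q), ∀ s ∈ (etaTerms d r q).map flat,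
      permOp (Equiv.sumCongr π ρ) s ∈ (etaTerms d r q).map flat := by
    rintro π ρ s ⟨f, hf, rfl⟩
    change f ∈ etaTerms d r q at hf
    induction hf using Submodule.span_induction with
    | mem f hf =>
      obtain ⟨e, ⟨k, hk⟩, rfl⟩ := hf
      refine ⟨pairingTerm (e.trans (Equiv.sumCongr π ρ)), Submodule.subset_span ⟨_, ⟨k, ?_⟩, rfl⟩, ?_⟩
      · simpa using hk
      · rw [flat_pairingTerm, flat_pairingTerm]; rfl
    | zero => rw [map_zero, map_zero]; exact Submodule.zero_mem _
    | add f g _ _ hf hg => rw [map_add, map_add]; exact Submodule.add_mem _ hf hg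
    | smul c f _ hf => rw [map_smul, map_smul]; exact Submodule.smul_mem _ _ hf
  refine ⟨hmap π ρ, fun t ht s hs => ?_⟩
  rw [← ht _ (hmap π.symm ρ.symm s hs)]
  refine Fintype.sum_equiv (Equiv.arrowCongr (Equiv.sumCongr π ρ).symm (Equiv.refl _)) _ _
    fun c => ?_
  have h : ∀ p, (Equiv.arrowCongr (Equiv.sumCongr π ρ).symm (Equiv.refl (Fin d))) c p =
      c (Equiv.sumCongr π ρ p) := by intro p; simp [Equiv.arrowCongr]
  have h1 : (Equiv.arrowCongr (Equiv.sumCongr π ρ).symm (Equiv.refl (Fin d))) c =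
      c ∘ Equiv.sumCongr π ρ := funext h
  rw [h1]
  congr 1
  change s c = s ((c ∘ Equiv.sumCongr π ρ) ∘ Equiv.sumCongr π.symm ρ.symm)
  congr 1
  ext1 p
  rcases p with p | p <;> simp

/-- Contraction of two positions of an array. -/
def traceArr {Q : Type*} [DecidableEq Q] (i j : Q) (t : (Q → Fin d) → ℝ) (c : Q → Fin d) : ℝ :=
  ∑ n, eta n * t (Function.update (Function.update c i n) j n)

/-- By `metric_mul_trace_pairProd` the result is a combination of pairings that join `i` with `j`,
which are η-terms because both positions lie in one group. -/
theorem metric_mul_traceArr_mem {f : Pt d → Idx d r q → Idx d r q → ℝ} (hf : f ∈ pairings d r q)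
    {i j : Pos r q ⊕ Pos r q} (hij : i ≠ j) (hs : i.isLeft = j.isLeft) :
    (fun c => metric (c i) (c j) * traceArr i j (flat f) c) ∈ (etaTerms d r q).map flat := by
  refine pairings_induction (p := fun f => (fun c => metric (c i) (c j) *
    traceArr i j (flat f) c) ∈ (etaTerms d r q).map flat) ?_ ?_ ?_ ?_ hf
  · intro e
    obtain ⟨e', κ, ⟨k, hk⟩, he'⟩ := metric_mul_trace_pairProd (d := d) e hij
    refine ⟨κ • pairingTerm e', Submodule.smul_mem _ _ (Submodule.subset_span ⟨e', ⟨k, ?_⟩, rfl⟩), ?_⟩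
    · rcases hk with ⟨h1, h2⟩ | ⟨h1, h2⟩
      · rw [h1, h2, hs]
      · rw [h1, h2, hs]
    · rw [map_smul, flat_pairingTerm]
      ext c
      rw [flat_pairingTerm]
      exact (he' c).symm
  · rw [map_zero]
    convert Submodule.zero_mem _
    simp [traceArr]
  · intro f g hf hg
    convert Submodule.add_mem _ hf hg using 1
    ext c
    simp [traceArr, mul_add, Finset.sum_add_distrib]
  · intro κ f hf
    convert Submodule.smul_mem _ κ hf using 1
    ext c
    simp only [traceArr, map_smul, Pi.smul_apply, smul_eq_mul, Finset.mul_sum]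
    exact Finset.sum_congr rfl fun n _ => by ring

theorem sum_permOp_apply {ι : Type*} [Fintype ι] (κ : ι → ℝ) (π ρ : ι → Equiv.Perm (Pos r q))
    (f : Pt d → Idx d r q → Idx d r q → ℝ) (c : Pos r q ⊕ Pos r q → Fin d) :
    (∑ i, κ i • permOp (Equiv.sumCongr (π i) (ρ i))) (flat f) c =
      ∑ i, κ i * f 0 ((c ∘ Sum.inl) ∘ π i) ((c ∘ Sum.inr) ∘ ρ i) := by
  simp only [LinearMap.sum_apply, LinearMap.smul_apply, Finset.sum_apply, Pi.smul_apply,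
    smul_eq_mul]
  rfl

/-- Subtracting suitable `η`-terms from the leading term makes it traceless, without spoiling any
of its symmetries. -/
theorem exists_traceless (d r q : ℕ) :
    ∃ Pi : Pt d → Idx d r q → Idx d r q → ℝ, Pi - leading ∈ etaTerms d r q ∧
      (∀ (ι : Type) [Fintype ι] (κ : ι → ℝ) (π ρ : ι → Equiv.Perm (Pos r q)),
        (∀ a b : Idx d r q, ∑ i, κ i * leading 0 (a ∘ π i) (b ∘ ρ i) = 0) →
          ∀ a b : Idx d r q, ∑ i, κ i * Pi 0 (a ∘ π i) (b ∘ ρ i) = 0) ∧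
      ∀ {i j : Pos r q ⊕ Pos r q}, i ≠ j → i.isLeft = j.isLeft →
        ∀ c, traceArr i j (flat Pi) c = 0 := by
  -- Take the component of the leading term orthogonal to the η-terms, at the origin.
  obtain ⟨s, ⟨f, hf, rfl⟩, hs⟩ := exists_projection ((etaTerms d r q).map flat) (flat leading)
  have hmem : leading - f ∈ pairings d r q := Submodule.sub_mem _ leading_mem (etaTerms_le hf)
  have hflat : flat (leading - f) = flat leading - flat f := map_sub _ _ _
  refine ⟨leading - f, ?_, fun ι _ κ π ρ h a b => ?_, ?_⟩
  · rw [sub_sub_cancel_left]; exact Submodule.neg_mem _ hf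
  · have hA : ∑ i, κ i • permOp (Equiv.sumCongr (π i) (ρ i)) ∈
        reducing ((etaTerms d r q).map flat) :=
      Submodule.sum_mem _ fun i _ => Submodule.smul_mem _ _ (permOp_mem _ _)
    have h1 := apply_eq_zero_of_reducing hA ⟨f, hf, rfl⟩ hs
      (by ext c; rw [sum_permOp_apply]; exact h _ _)
    rw [← hflat] at h1
    have h2 := congrFun h1 (Sum.elim a b)
    rw [sum_permOp_apply] at h2
    exact h2
  · intro i j hij hside
    -- The trace multiplied by the metric is an η-term, hence orthogonal to the array itself. By
    -- adjointness the trace has vanishing sum of squares.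
    have h1 := hs _ (metric_mul_traceArr_mem hmem hij hside)
    have hupd : ∀ c n, traceArr i j (flat (leading - f)) (Function.update c i n) =
        traceArr i j (flat (leading - f)) c := by
      intro c n; simp only [traceArr, Function.update_idem]
    have hupd' : ∀ c n, traceArr i j (flat (leading - f)) (Function.update c j n) =
        traceArr i j (flat (leading - f)) c := by
      intro c n; simp only [traceArr, Function.update_comm hij, Function.update_idem]
    have h2 := sum_mul_metric (flat (leading - f)) (traceArr i j (flat (leading - f))) hij
      hupd hupd'
    have h3 : ∑ c, flat (leading - f) c *
        (metric (c i) (c j) * traceArr i j (flat (leading - f)) c) = 0 := by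
      rw [← h1]; rfl
    rw [h3, mul_zero, mul_zero] at h2
    have h4 : ∑ c, traceArr i j (flat (leading - f)) c * traceArr i j (flat (leading - f)) c = 0 :=
      h2.symm
    intro c
    have := (Finset.sum_eq_zero_iff_of_nonneg fun c _ =>
      mul_self_nonneg (traceArr i j (flat (leading - f)) c)).1 h4 c (Finset.mem_univ c)
    simpa using this

/-- Relations between the components that express hook symmetry. -/
theorem isTracelessHook_of_relations {T : Idx d r q → ℝ}
    (hrel : ∀ (ι : Type) [Fintype ι] (κ : ι → ℝ) (π : ι → Equiv.Perm (Pos r q)),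
      (∀ a b : Idx d r q, ∑ i, κ i * leading 0 (a ∘ π i) b = 0) →
        ∀ a : Idx d r q, ∑ i, κ i * T (a ∘ π i) = 0)
    (htr : ∀ (j j' : Fin (r + 1)), j ≠ j' → ∀ a : Idx d r q, ∑ n : Fin d,
      eta n * T (Function.update (Function.update a (Sum.inl j) n) (Sum.inl j') n) = 0) :
    IsTracelessHook T where
  symm σ a := by
    -- Each symmetry is encoded as a linear relation among permuted components; here two terms, the
    -- permuted one and minus the original.
    have := hrel Bool (fun i => bif i then 1 else -1)
      (fun i => bif i then Equiv.sumCongr σ (Equiv.refl _) else Equiv.refl _) ?_ a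
    · simp only [Fintype.sum_bool, cond_true, cond_false, one_mul, neg_one_mul] at this
      exact sub_eq_zero.1 ((sub_eq_add_neg _ _).trans this)
    · intro a b
      simp only [Fintype.sum_bool, cond_true, cond_false, one_mul, neg_one_mul]
      exact (sub_eq_add_neg _ _).symm.trans (sub_eq_zero.2 (leading_symm 0 b σ a))
  antisymm τ a := by
    have := hrel Bool (fun i => bif i then 1 else -((Equiv.Perm.sign τ : ℤ) : ℝ))
      (fun i => bif i then Equiv.sumCongr (Equiv.refl _) τ else Equiv.refl _) ?_ a
    · simp only [Fintype.sum_bool, cond_true, cond_false, one_mul, neg_mul] at this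
      rw [← Int.cast_smul_eq_zsmul ℝ]
      exact sub_eq_zero.1 ((sub_eq_add_neg _ _).trans this)
    · intro a b
      simp only [Fintype.sum_bool, cond_true, cond_false, one_mul, neg_mul]
      exact (sub_eq_add_neg _ _).symm.trans (sub_eq_zero.2 (leading_antisymm 0 b τ a))
  young k a := by
    have := hrel (Option (Fin (r + 1))) (fun _ => 1)
      (fun i => i.elim (Equiv.refl _) fun j => Equiv.swap (Sum.inl j) (Sum.inr k)) ?_ a
    · simpa only [Fintype.sum_option, Option.elim, one_mul, Equiv.coe_refl,
        Function.comp_id] using this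
    · intro a b
      simpa only [Fintype.sum_option, Option.elim, one_mul, Equiv.coe_refl,
        Function.comp_id] using leading_young 0 b k a
  traceless j j' hj a := htr j j' hj a

theorem apply_eq_ev_refl {f : Pt d → Idx d r q → Idx d r q → ℝ} (hf : f ∈ pairings d r q)
    (x : Pt d) (a b : Idx d r q) : f x a b = ev (f 0 a) (fun k => refl x (bas (b k))) := by
  have := ev_ev_of_mem hf x (fun k => bas (a k)) (fun k => bas (b k))
  rwa [ev_bas, ev_bas, ev_bas] at this

/-- For combinations of pairings, hook symmetry at the origin implies hook symmetry everywhere. -/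
theorem hook_left_of_mem {f : Pt d → Idx d r q → Idx d r q → ℝ} (hf : f ∈ pairings d r q)
    (h : ∀ b, IsTracelessHook (fun a => f 0 a b)) (x : Pt d) (b : Idx d r q) :
    IsTracelessHook (fun a => f x a b) := by
  have h1 := (isTracelessHook_pi h).map (evLin fun k => refl x (bas (b k)))
  have h2 : (fun a => f x a b) = fun a => evLin (fun k => refl x (bas (b k))) (f 0 a) :=
    funext fun a => apply_eq_ev_refl hf x a b
  rw [h2]; exact h1

theorem hook_right_of_mem {f : Pt d → Idx d r q → Idx d r q → ℝ} (hf : f ∈ pairings d r q)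
    (h : ∀ a, IsTracelessHook (f 0 a)) (x : Pt d) (a : Idx d r q) :
    IsTracelessHook (f x a) := by
  have h1 : ev (f x a) = (ev (f 0 a)).compLinearMap fun _ => refl x := by
    refine MultilinearMap.ext fun v => ?_
    have := ev_ev_of_mem hf x (fun k => bas (a k)) v
    rw [ev_bas, ev_bas] at this
    exact this
  rw [← mhook_ev_iff, h1]
  exact (h a).mhook.comp_refl x

/-- The symmetries are verified at the origin, where they come from those of the leading term, and
reach other points by reflecting the second group. -/
theorem exists_numerator (d r q : ℕ) :
    ∃ Pi : Pt d → Idx d r q → Idx d r q → ℝ, IsNumerator Pi := by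
  obtain ⟨Pi, hPi, hrel, htr⟩ := exists_traceless d r q
  have hmem : Pi ∈ pairings d r q := by
    rw [← sub_add_cancel Pi leading]
    exact Submodule.add_mem _ (etaTerms_le hPi) leading_mem
  refine ⟨Pi, hPi, fun x _ b => hook_left_of_mem hmem (fun b => ?_) x b,
    fun x _ a => hook_right_of_mem hmem (fun a => ?_) x a⟩
  · refine isTracelessHook_of_relations (fun ι _ κ π h a => ?_) fun j j' hj a => ?_
    · exact hrel ι κ π (fun _ => Equiv.refl _) (fun a b => h a b) a b
    · rw [← htr (i := Sum.inl (Sum.inl j)) (j := Sum.inl (Sum.inl j'))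
        (fun e => hj (Sum.inl_injective (Sum.inl_injective e))) rfl (Sum.elim a b)]
      refine Finset.sum_congr rfl fun n _ => ?_
      rw [Sum.update_elim_inl, Sum.update_elim_inl, flat_elim]
  · refine isTracelessHook_of_relations (fun ι _ κ π h b => ?_) fun j j' hj b => ?_
    · refine hrel ι κ (fun _ => Equiv.refl _) π (fun a b => ?_) a b
      rw [← h b a]
      exact Finset.sum_congr rfl fun i _ => congrArg _ (leading_comm 0 _ _)
    · rw [← htr (i := Sum.inr (Sum.inl j)) (j := Sum.inr (Sum.inl j'))
        (fun e => hj (Sum.inl_injective (Sum.inr_injective e))) rfl (Sum.elim a b)]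
      refine Finset.sum_congr rfl fun n _ => ?_
      rw [Sum.update_elim_inr, Sum.update_elim_inr, flat_elim]

theorem IsNumerator.mem_pairings {Pi : Pt d → Idx d r q → Idx d r q → ℝ} (h : IsNumerator Pi) :
    Pi ∈ pairings d r q := by
  rw [← sub_add_cancel Pi leading]
  exact Submodule.add_mem _ (etaTerms_le h.eta_terms) leading_mem

theorem IsTracelessHook.sub {E : Type*} [AddCommGroup E] [Module ℝ E] {T T' : Idx d r q → E}
    (h : IsTracelessHook T) (h' : IsTracelessHook T') : IsTracelessHook (fun a => T a - T' a) where
  symm σ a := by rw [h.symm, h'.symm]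
  antisymm τ a := by rw [h.antisymm, h'.antisymm, smul_sub]
  young k a := by
    rw [Finset.sum_sub_distrib, sub_add_sub_comm, h.young, h'.young, sub_zero]
  traceless j j' hj a := by
    simp only [smul_sub, Finset.sum_sub_distrib, h.traceless j j' hj, h'.traceless j j' hj,
      sub_zero]

/-- The leading terms cancel in the difference, which is then a combination of η-terms of traceless
hook type in the first group. -/
theorem eq_of_sub_leading_mem {Pi Pi' : Pt d → Idx d r q → Idx d r q → ℝ}
    (h : Pi - leading ∈ etaTerms d r q) (h' : Pi' - leading ∈ etaTerms d r q) {x : Pt d}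
    (hL : ∀ b, IsTracelessHook (fun a => Pi x a b))
    (hL' : ∀ b, IsTracelessHook (fun a => Pi' x a b)) : Pi x = Pi' x := by
  have h1 : Pi - Pi' ∈ etaTerms d r q := by
    rw [← sub_sub_sub_cancel_right Pi Pi' leading]; exact Submodule.sub_mem _ h h'
  exact sub_eq_zero.1 (eq_zero_of_mem_etaTerms h1 (x := x) fun b => (hL b).sub (hL' b))

/-- A point with `x² ≠ 0` gives the symmetries of the numerator at the origin. -/
theorem IsNumerator.hook_zero (hd : 0 < d) {Pi : Pt d → Idx d r q → Idx d r q → ℝ}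
    (h : IsNumerator Pi) :
    (∀ b, IsTracelessHook (fun a => Pi 0 a b)) ∧ ∀ a, IsTracelessHook (Pi 0 a) := by
  -- The conditions on a numerator say nothing at the origin; they are transported there from the
  -- unit time vector by a reflection.
  have hx : sq (bas ⟨0, hd⟩ : Pt d) ≠ 0 := by
    rw [← dot_self, dot_bas_bas, metric_self]; simp [eta]
  set x : Pt d := bas ⟨0, hd⟩
  have hmem := h.mem_pairings
  have hinv : ∀ a b, Pi 0 a b = ev (Pi x a) (fun k => refl x (bas (b k))) := by
    intro a b
    have := ev_ev_of_mem hmem x (fun k => bas (a k)) (fun k => refl x (bas (b k)))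
    simp only [refl_refl] at this
    rw [ev_bas, ev_bas, ev_bas] at this
    exact this.symm
  constructor
  · intro b
    have h1 := (isTracelessHook_pi (h.hook_left x hx)).map (evLin fun k => refl x (bas (b k)))
    have h2 : (fun a => Pi 0 a b) = fun a => evLin (fun k => refl x (bas (b k))) (Pi x a) :=
      funext fun a => hinv a b
    rw [h2]; exact h1
  · intro a
    have h1 : ev (Pi 0 a) = (ev (Pi x a)).compLinearMap fun _ => refl x := by
      refine MultilinearMap.ext fun v => ?_
      have := ev_ev_of_mem hmem x (fun k => bas (a k)) (fun k => refl x (v k))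
      simp only [refl_refl] at this
      rw [ev_bas, ev_bas] at this
      exact this.symm
    rw [← mhook_ev_iff, h1]
    exact (h.hook_right x hx a).mhook.comp_refl x

end Existence

/-! ### The numerator does not vanish -/

section Nonvanishing

variable {D r q : ℕ}

theorem flag_leadPerm (p : Pt (D + 2)) (w : Fin q → Pt (D + 2)) (σ : Equiv.Perm (Fin (r + 1)))
    (k : Fin (q + 1)) :
    flag p w (Equiv.sumCongr σ (Equiv.refl (Fin q)) (regroup r q (Sum.inr k))) =
      (Fin.cons p w : Fin (q + 1) → Pt (D + 2)) k := by
  refine Fin.cases ?_ (fun k => ?_) k <;> simp [regroup]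

theorem dot_cons_cons {J : Fin q → Fin D} (hJ : Function.Injective J) {i j : Fin (q + 1)}
    (hij : i ≠ j) :
    dot ((Fin.cons nplus (fun k => etr (J k)) : Fin (q + 1) → Pt (D + 2)) i)
      ((Fin.cons nminus (fun k => etr (J k)) : Fin (q + 1) → Pt (D + 2)) j) = 0 := by
  refine Fin.cases (motive := fun i => i ≠ j → dot ((Fin.cons nplus (fun k => etr (J k)) :
    Fin (q + 1) → Pt (D + 2)) i) ((Fin.cons nminus (fun k => etr (J k)) :
      Fin (q + 1) → Pt (D + 2)) j) = 0) (fun hj => ?_) (fun i hj => ?_) i hij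
  · obtain ⟨j, rfl⟩ := Fin.exists_succ_eq_of_ne_zero hj.symm
    simp [dot_nplus_etr]
  · revert hj
    refine Fin.cases (fun _ => ?_) (fun j hj => ?_) j
    · simp [dot_comm _ nminus, dot_nminus_etr]
    · have : J i ≠ J j := hJ.ne (fun e => hj (congrArg _ e))
      simp [dot_etr_etr, this]

/-- The matrix of scalar products of `(n₊, e_J)` with `(n₋, e_J)` is diagonal, so only the identity
permutation of the antisymmetrized block contributes. Every surviving term equals `(-2)^{r+1}`, so
nothing cancels. -/
theorem ev_ev_leading_flag {J : Fin q → Fin D} (hJ : Function.Injective J) :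
    ev (ev (leading 0 : Idx (D + 2) r q → Idx (D + 2) r q → ℝ) (flag nplus fun k => etr (J k)))
      (flag nminus fun k => etr (J k)) ≠ 0 := by
  set u : Pos r q → Pt (D + 2) := flag nplus fun k => etr (J k) with hu
  set v : Pos r q → Pt (D + 2) := flag nminus fun k => etr (J k) with hv
  have hterm : ∀ (σ τ : Equiv.Perm (Fin (r + 1))) (α : Equiv.Perm (Fin r))
      (β : Equiv.Perm (Fin (q + 1))), ev (ev (pairingTerm (Equiv.sumCongr (leadPerm σ α β)
        (Equiv.sumCongr τ (Equiv.refl (Fin q)))) 0 :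
          Idx (D + 2) r q → Idx (D + 2) r q → ℝ) u) v = if β = 1 then (-2) ^ (r + 1) else 0 := by
    intro σ τ α β
    rw [ev_ev_pairingTerm]
    have h1 : ∀ k, (if ((Equiv.sumCongr (leadPerm σ α β) (Equiv.sumCongr τ (Equiv.refl (Fin q))))
        (Sum.inl k)).isLeft = ((Equiv.sumCongr (leadPerm σ α β) (Equiv.sumCongr τ
          (Equiv.refl (Fin q)))) (Sum.inr k)).isLeft then
        dot (Sum.elim u v ((Equiv.sumCongr (leadPerm σ α β) (Equiv.sumCongr τ (Equiv.refl (Fin q))))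
          (Sum.inl k))) (Sum.elim u v ((Equiv.sumCongr (leadPerm σ α β) (Equiv.sumCongr τ
            (Equiv.refl (Fin q)))) (Sum.inr k)))
        else dot (Sum.elim u v ((Equiv.sumCongr (leadPerm σ α β) (Equiv.sumCongr τ
          (Equiv.refl (Fin q)))) (Sum.inl k))) (refl 0 (Sum.elim u v
            ((Equiv.sumCongr (leadPerm σ α β) (Equiv.sumCongr τ (Equiv.refl (Fin q))))
              (Sum.inr k))))) =
        dot (u (leadPerm σ α β k)) (v (Equiv.sumCongr τ (Equiv.refl (Fin q)) k)) := by
      intro k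
      rw [refl_zero, ite_self]; rfl
    rw [Finset.prod_congr rfl fun k _ => h1 k, ← Equiv.prod_comp (regroup r q),
      Fintype.prod_sum_type]
    have h2 : ∀ k : Fin r, dot (u (leadPerm σ α β (regroup r q (Sum.inl k))))
        (v (Equiv.sumCongr τ (Equiv.refl (Fin q)) (regroup r q (Sum.inl k)))) = -2 := by
      intro k
      simp only [leadPerm, Equiv.trans_apply, Equiv.symm_apply_apply]
      simp only [regroup, Equiv.sumCongr_apply, Sum.map_inl, Equiv.coe_fn_mk, Sum.elim_inl, hu, hv,
        flag_inl]
      exact dot_nplus_nminus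
    have h3 : ∀ k : Fin (q + 1), dot (u (leadPerm σ α β (regroup r q (Sum.inr k))))
        (v (Equiv.sumCongr τ (Equiv.refl (Fin q)) (regroup r q (Sum.inr k)))) =
        dot ((Fin.cons nplus (fun k => etr (J k)) : Fin (q + 1) → Pt (D + 2)) (β k))
          ((Fin.cons nminus (fun k => etr (J k)) : Fin (q + 1) → Pt (D + 2)) k) := by
      intro k
      simp only [leadPerm, Equiv.trans_apply, Equiv.symm_apply_apply]
      rw [hu, hv, flag_leadPerm]
      congr 1
      exact flag_leadPerm _ _ σ (β k)
    simp only [h2, h3, Finset.prod_const, Finset.card_univ, Fintype.card_fin]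
    split_ifs with hβ
    · subst hβ
      rw [Fin.prod_univ_succ]
      simp [dot_nplus_nminus, dot_etr_etr, pow_succ]
    · obtain ⟨k, hk⟩ : ∃ k, β k ≠ k := by
        by_contra hcon; push Not at hcon; exact hβ (Equiv.ext hcon)
      rw [Finset.prod_eq_zero (Finset.mem_univ k) (dot_cons_cons hJ hk), mul_zero]
  rw [← evTwo_apply, leading_eq_sum]
  simp only [Pi.smul_apply, Finset.sum_apply, map_smul, map_sum, evTwo_apply, hterm, smul_eq_mul,
    mul_ite, mul_zero, Finset.sum_ite_eq', Finset.mem_univ, if_true, Finset.sum_const,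
    Finset.card_univ, Fintype.card_perm, Fintype.card_fin, nsmul_eq_mul, Equiv.Perm.sign_one,
    Units.val_one, Int.cast_one, one_mul]
  have h1 : ((r + 1).factorial : ℝ) ≠ 0 := Nat.cast_ne_zero.2 (Nat.factorial_ne_zero _)
  have h2 : (r.factorial : ℝ) ≠ 0 := Nat.cast_ne_zero.2 (Nat.factorial_ne_zero _)
  have h3 : ((q + 1).factorial : ℝ) ≠ 0 := Nat.cast_ne_zero.2 (Nat.factorial_ne_zero _)
  have h4 : ((-2 : ℝ)) ^ (r + 1) ≠ 0 := pow_ne_zero _ (by norm_num)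
  simp [h1, h2, h3]

/-- Every η-term joins two positions of the first group, and the vectors `n₊, …, n₊, e_J` at
distinct positions have vanishing scalar products. -/
theorem ev_ev_etaTerms_flag {f : Pt (D + 2) → Idx (D + 2) r q → Idx (D + 2) r q → ℝ}
    (hf : f ∈ etaTerms (D + 2) r q) {J : Fin q → Fin D} (hJ : Function.Injective J) :
    ev (ev (f 0) (flag nplus fun k => etr (J k))) (flag nminus fun k => etr (J k)) = 0 := by
  rw [← evTwo_apply]
  induction hf using Submodule.span_induction with
  | mem f hf =>
    obtain ⟨e, he, rfl⟩ := hf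
    rw [evTwo_apply, ev_ev_pairingTerm]
    obtain ⟨k, h1, h2⟩ := exists_left_pair e he
    obtain ⟨i, hi⟩ := Sum.isLeft_iff.1 h1
    obtain ⟨j, hj⟩ := Sum.isLeft_iff.1 h2
    have hij : i ≠ j := by
      rintro rfl
      have := e.injective (hi.trans hj.symm)
      simp at this
    refine Finset.prod_eq_zero (Finset.mem_univ k) ?_
    rw [if_pos (h1.trans h2.symm), hi, hj, Sum.elim_inl, Sum.elim_inl]
    rcases i with i | i <;> rcases j with j | j
    · exact dot_nplus_nplus
    · exact dot_nplus_etr _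
    · rw [dot_comm]; exact dot_nplus_etr _
    · rw [flag_inr, flag_inr, dot_etr_etr, if_neg (hJ.ne fun e => hij (congrArg _ e))]
  | zero => simp
  | add f g _ _ hf hg => rw [Pi.add_apply, map_add, hf, hg, add_zero]
  | smul c f _ hf => rw [Pi.smul_apply, map_smul, hf, smul_zero]

theorem IsNumerator.flag_ne_zero {Pi : Pt (D + 2) → Idx (D + 2) r q → Idx (D + 2) r q → ℝ}
    (h : IsNumerator Pi) {J : Fin q → Fin D} (hJ : Function.Injective J) :
    ev (ev (Pi 0) (flag nplus fun k => etr (J k))) (flag nminus fun k => etr (J k)) ≠ 0 := by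
  have h1 := ev_ev_etaTerms_flag h.eta_terms hJ
  rw [← evTwo_apply, _root_.Pi.sub_apply, map_sub, sub_eq_zero] at h1
  rw [← evTwo_apply, h1]
  exact ev_ev_leading_flag hJ

theorem IsNumerator.ne_zero {Pi : Pt (D + 2) → Idx (D + 2) r q → Idx (D + 2) r q → ℝ}
    (h : IsNumerator Pi) (hq : q ≤ D) (x : Pt (D + 2)) : Pi x ≠ 0 := by
  intro h0
  have h1 := h.flag_ne_zero (J := Fin.castLE hq) (Fin.castLE_injective hq)
  have h2 := ev_ev_of_mem h.mem_pairings x (flag nplus fun k => etr (Fin.castLE hq k))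
    (fun k => refl x (flag nminus (fun k => etr (Fin.castLE hq k)) k))
  simp only [refl_refl] at h2
  rw [← h2, h0, ← evTwo_apply, map_zero] at h1
  exact h1 rfl

theorem ev_ofReal {d : ℕ} (M : Idx d r q → Idx d r q → ℝ) (C : ℂ) (u v : Pos r q → Pt d) :
    ev (ev (fun a b => C * (M a b : ℂ)) u) v = C * ((ev (ev M u) v : ℝ) : ℂ) := by
  let L : ℝ →ₗ[ℝ] ℂ := (LinearMap.mulLeft ℝ C) ∘ₗ Complex.ofRealCLM.toLinearMap
  have h1 : ∀ x : ℝ, C * (x : ℂ) = L x := fun x => rfl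
  simp only [h1]
  rw [← ev_map L]
  refine congrArg (fun T => ev T v) (funext fun b => ?_)
  rw [ev_ev_apply, ev_ev_apply]
  exact ev_map L _ u

/-- Invariant tensors of traceless hook type are multiples of the numerator. -/
theorem IsNumerator.eq_mul {Pi : Pt (D + 2) → Idx (D + 2) r q → Idx (D + 2) r q → ℝ}
    (h : IsNumerator Pi) (hq : q ≤ D) {M : Idx (D + 2) r q → Idx (D + 2) r q → ℂ}
    (hL : ∀ b, IsTracelessHook (fun a => M a b)) (hR : ∀ a, IsTracelessHook (M a))
    (hlie : LieInvariant M) (h1 : ReflInvariant M (bas 1))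
    (hflip : ∀ j : Fin D, ReflInvariant M (etr j))
    (hswap : ∀ i j : Fin D, i ≠ j → ReflInvariant M (etr i - etr j)) :
    ∃ C : ℂ, M = fun a b => C * (Pi 0 a b : ℂ) := by
  have hJ : Function.Injective (Fin.castLE hq) := Fin.castLE_injective hq
  set u : Pos r q → Pt (D + 2) := flag nplus fun k => etr (Fin.castLE hq k)
  set v : Pos r q → Pt (D + 2) := flag nminus fun k => etr (Fin.castLE hq k)
  have hne : ev (ev (Pi 0) u) v ≠ 0 := h.flag_ne_zero hJ
  -- The constant is read off from the flag component, so that `M - C · Pi 0` has vanishing flag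
  -- component.
  set C : ℂ := ev (ev M u) v / ((ev (ev (Pi 0) u) v : ℝ) : ℂ) with hC
  obtain ⟨hPL, hPR⟩ := h.hook_zero (by omega)
  let N : Idx (D + 2) r q → Idx (D + 2) r q → ℂ := fun a b => C * (Pi 0 a b : ℂ)
  have hN : ∀ u v, ev (ev N u) v = C * ((ev (ev (Pi 0) u) v : ℝ) : ℂ) := ev_ofReal (Pi 0) C
  let L : ℝ →ₗ[ℝ] ℂ := (LinearMap.mulLeft ℝ C) ∘ₗ Complex.ofRealCLM.toLinearMap
  have hsub : ∀ u v, ev (ev (M - N) u) v = ev (ev M u) v - ev (ev N u) v := by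
    intro u v; simp only [← evTwo_apply, map_sub]
  have hrefl : ∀ x, ReflInvariant M x → ReflInvariant (M - N) x := by
    intro x hx u v
    rw [hsub, hsub, hx u v, hN, hN, ReflInvariant.of_mem h.mem_pairings x u v]
  have hz : M - N = 0 := by
    refine eq_zero_of_flag_eq_zero hq (fun b => (hL b).sub ((hPL b).map L))
      (fun a => (hR a).sub ((hPR a).map L)) ?_ (hrefl _ h1) (fun j => hrefl _ (hflip j))
      (fun i j hij => hrefl _ (hswap i j hij)) hJ ?_
    · intro ω hω u v
      have e1 := hlie ω hω u v
      have e2 := LieInvariant.of_mem h.mem_pairings ω hω u v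
      simp only [hsub, hN, Finset.sum_sub_distrib, ← Finset.mul_sum, ← Complex.ofReal_sum]
      rw [sub_add_sub_comm, e1, ← mul_add, ← Complex.ofReal_add, e2]
      simp
    · change ev (ev (M - N) u) v = 0
      rw [hsub, hN, hC, div_mul_cancel₀ _ (Complex.ofReal_ne_zero.2 hne), sub_self]
  exact ⟨C, sub_eq_zero.1 hz⟩

end Nonvanishing

/-! ### Conformal Killing vectors -/

section KillingVectors

variable {d : ℕ}

namespace Killing

variable (ξ : Killing d)

/-- The special conformal parameter with raised index. -/
def Kup : Pt d := fun m => eta m * ξ.K m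

/-- The translation parameter with raised index. -/
def Pup : Pt d := fun m => eta m * ξ.P m

theorem low_Kup (m : Fin d) : low ξ.Kup m = ξ.K m := by
  rw [low, Kup, ← mul_assoc, eta_mul_self, one_mul]

theorem Kdot_eq (x : Pt d) : ξ.Kdot x = dot ξ.Kup x := by
  simp only [Kdot, dot, low_Kup]

theorem rot_antisymm (x : Pt d) (m n : Fin d) : ξ.rot x m n = -ξ.rot x n m := by
  rw [rot, rot, ξ.L_antisymm m n]; ring

theorem gen_rot (x u : Pt d) :
    gen (ξ.rot x) u = gen ξ.L u + (2 * dot ξ.Kup u) • x - (2 * dot x u) • ξ.Kup := by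
  have h : gen (ξ.rot x) u = gen ξ.L u + (2 : ℝ) • gen (wedge ξ.Kup x) u := by
    ext n
    simp only [gen_apply, rot, wedge, low_Kup, Pi.add_apply, Pi.smul_apply, smul_eq_mul,
      Finset.mul_sum, ← Finset.sum_add_distrib]
    exact Finset.sum_congr rfl fun m _ => by ring
  rw [h, gen_wedge]; module

theorem vec_eq (x : Pt d) :
    ξ.vec x = ξ.Pup - gen ξ.L x + ξ.D • x + sq x • ξ.Kup - (2 * dot ξ.Kup x) • x := by
  ext m
  have h1 : gen ξ.L x m = -(eta m * ∑ n, ξ.L m n * x n) := by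
    rw [gen_apply, Finset.mul_sum, ← Finset.sum_neg_distrib]
    refine Finset.sum_congr rfl fun n _ => ?_
    rw [ξ.L_antisymm m n]; ring
  simp only [vec, lowVec, Pi.add_apply, Pi.sub_apply, Pi.smul_apply, smul_eq_mul, h1, Kdot_eq,
    Kup, Pup, low]
  linear_combination (ξ.D * x m - 2 * x m * dot ξ.Kup x) * eta_mul_self m

theorem dot_gen_L (u v : Pt d) : dot u (gen ξ.L v) = -dot (gen ξ.L u) v := by
  have := dot_gen ξ.L_antisymm u v
  linarith

theorem dot_gen_L_self (u : Pt d) : dot u (gen ξ.L u) = 0 := by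
  have := ξ.dot_gen_L u u
  rw [dot_comm (gen ξ.L u)] at this
  linarith

/-- The Killing vector changes distances by the mean of the local scale factors. -/
theorem two_dot_vec_sub (x y : Pt d) :
    2 * dot (x - y) (ξ.vec x - ξ.vec y) = (ξ.scale x + ξ.scale y) * sq (x - y) := by
  obtain ⟨z, rfl⟩ : ∃ z, x = y + z := ⟨x - y, by abel⟩
  simp only [add_sub_cancel_left, vec_eq, scale, Kdot_eq, map_add, sq_add, dot_add_right,
    dot_sub_right, dot_smul_right, dot_gen_L_self, dot_self, dot_comm z ξ.Kup, dot_comm z y]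
  ring

end Killing

/-- The derivative of `refl z v` in the direction `z'`. -/
def reflDeriv (z z' v : Pt d) : Pt d :=
  -((2 / sq z) • (dot z' v • z + dot z v • z' - (2 * dot z v * dot z z' / sq z) • z))

theorem reflDeriv_neg (z z' v : Pt d) : reflDeriv (-z) (-z') v = reflDeriv z z' v := by
  have h : sq (-z) = sq z := by rw [← dot_self, dot_neg_left, dot_neg_right, neg_neg, dot_self]
  simp only [reflDeriv, h, dot_neg_left, dot_neg_right]
  module

theorem refl_neg (z v : Pt d) : refl (-z) v = refl z v := by
  rw [← neg_one_smul ℝ z, refl_smul (by norm_num)]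

/-- The inversion matrix intertwines the local Lorentz rotations at the two points. -/
theorem reflDeriv_eq (ξ : Killing d) {x y : Pt d} (hz : sq (x - y) ≠ 0) (v : Pt d) :
    reflDeriv (x - y) (ξ.vec x - ξ.vec y) v =
      refl (x - y) (gen (ξ.rot x) v) - gen (ξ.rot y) (refl (x - y) v) := by
  obtain ⟨z, rfl⟩ : ∃ z, x = y + z := ⟨x - y, by abel⟩
  rw [add_sub_cancel_left] at *
  simp only [refl_apply, ξ.gen_rot, map_sub, map_smul, reflDeriv, ξ.vec_eq, map_add, sq_add,
    dot_add_right, dot_add_left, dot_sub_left, dot_sub_right, dot_smul_right, dot_smul_left,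
    ξ.dot_gen_L_self, ξ.dot_gen_L z v, dot_self, dot_comm z ξ.Kup, dot_comm z y]
  generalize gen ξ.L z = h
  generalize gen ξ.L v = g
  generalize gen ξ.L y = h'
  generalize ξ.Kup = K
  generalize ξ.Pup = P'
  ext m
  simp only [Pi.add_apply, Pi.sub_apply, Pi.smul_apply, Pi.neg_apply, smul_eq_mul]
  field_simp
  ring

/-- Exchange the two points in `reflDeriv_eq`; reflections and their derivatives are even in the
displacement. -/
theorem reflDeriv_eq' (ξ : Killing d) {x y : Pt d} (hz : sq (x - y) ≠ 0) (v : Pt d) :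
    reflDeriv (x - y) (ξ.vec x - ξ.vec y) v =
      refl (x - y) (gen (ξ.rot y) v) - gen (ξ.rot x) (refl (x - y) v) := by
  have hz' : sq (y - x) ≠ 0 := by
    rwa [← neg_sub, ← neg_one_smul ℝ (x - y), sq_smul, neg_one_sq, one_mul]
  rw [← reflDeriv_neg, neg_sub, neg_sub, reflDeriv_eq ξ hz', ← neg_sub x y]
  simp only [refl_neg]

end KillingVectors

/-! ### Derivatives along curves -/

section Derivatives

variable {d : ℕ}

theorem hasDerivAt_dot {p p' : ℝ → Pt d} {v v' : Pt d} {t : ℝ} (h : HasDerivAt p v t)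
    (h' : HasDerivAt p' v' t) :
    HasDerivAt (fun t => dot (p t) (p' t)) (dot v (p' t) + dot (p t) v') t := by
  simp only [dot, low, ← Finset.sum_add_distrib]
  refine HasDerivAt.fun_sum fun m _ => ?_
  exact (((hasDerivAt_pi.1 h m).const_mul (eta m)).mul (hasDerivAt_pi.1 h' m))

theorem hasDerivAt_line (z z' : Pt d) (t : ℝ) : HasDerivAt (fun t : ℝ => z + t • z') z' t := by
  simpa using ((hasDerivAt_id t).smul_const z').const_add z

theorem hasDerivAt_sq_line (z z' : Pt d) :
    HasDerivAt (fun t : ℝ => sq (z + t • z')) (2 * dot z z') 0 := by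
  have := hasDerivAt_dot (hasDerivAt_line z z' 0) (hasDerivAt_line z z' 0)
  simp only [zero_smul, add_zero, dot_comm z' z, ← two_mul] at this
  exact this

theorem hasDerivAt_refl_line {z : Pt d} (hz : sq z ≠ 0) (z' v : Pt d) :
    HasDerivAt (fun t : ℝ => refl (z + t • z') v) (reflDeriv z z' v) 0 := by
  have h1 := hasDerivAt_dot (hasDerivAt_line z z' 0) (hasDerivAt_const (0 : ℝ) v)
  have h2 := ((h1.const_mul 2).div (hasDerivAt_sq_line z z') (by simpa using hz)).smul
    (hasDerivAt_line z z' 0)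
  have h3 := h2.const_sub v
  refine h3.congr_deriv ?_
  simp only [zero_smul, add_zero, dot_zero_right, reflDeriv, Pi.div_apply]
  ext m
  simp only [Pi.add_apply, Pi.sub_apply, Pi.smul_apply, Pi.neg_apply, smul_eq_mul]
  field_simp
  ring

theorem mabs_pos {z : Pt d} (hz : sq z ≠ 0) : 0 < mabs z := Real.sqrt_pos.2 (abs_pos.2 hz)

/-- The logarithmic derivative of `z²` is `s`, hence that of `|z|^p` is `p s / 2`; the sign from
`|z²|` drops out. -/
theorem hasDerivAt_mabs_rpow {z z' : Pt d} (hz : sq z ≠ 0) {s : ℝ} (hs : 2 * dot z z' = s * sq z)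
    (p : ℝ) :
    HasDerivAt (fun t : ℝ => mabs (z + t • z') ^ p) (p / 2 * s * mabs z ^ p) 0 := by
  have h0 : sq (z + (0 : ℝ) • z') = sq z := by simp
  have h1 := (hasDerivAt_abs (x := sq (z + (0 : ℝ) • z')) (by rwa [h0])).comp (0 : ℝ)
    (hasDerivAt_sq_line z z')
  have h2 := h1.sqrt (by simpa using hz)
  have h3 := h2.rpow_const (p := p) (Or.inl (by simpa using hz))
  refine h3.congr_deriv ?_
  simp only [Function.comp, h0, hs]
  change _ * _ * mabs z ^ (p - 1) = _
  have hm := mabs_pos hz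
  have hm2 : mabs z * mabs z = |sq z| := Real.mul_self_sqrt (abs_nonneg _)
  rw [Real.rpow_sub_one hm.ne', show √|sq z| = mabs z from rfl]
  have h4 : (SignType.sign (sq z) : ℝ) * (s * sq z) = s * (mabs z * mabs z) := by
    rw [hm2, mul_left_comm, sign_mul_self]
  rw [h4]
  field_simp

theorem hasDerivAt_ev {P : Type*} [Fintype P] [DecidableEq P] {T : ℝ → (P → Fin d) → ℂ}
    {T' : (P → Fin d) → ℂ} {w : ℝ → P → Pt d} {w' : P → Pt d} {t : ℝ} (hT : HasDerivAt T T' t)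
    (hw : ∀ k, HasDerivAt (fun t => w t k) (w' k) t) :
    HasDerivAt (fun t => ev (T t) (w t))
      (ev T' (w t) + ∑ k, ev (T t) (Function.update (w t) k (w' k))) t := by
  simp only [ev_apply]
  rw [Finset.sum_comm, ← Finset.sum_add_distrib]
  refine HasDerivAt.fun_sum fun a _ => ?_
  have h1 : HasDerivAt (fun t => ∏ k, w t k (a k))
      (∑ k, (∏ j ∈ Finset.univ.erase k, w t j (a j)) • w' k (a k)) t :=
    HasDerivAt.fun_finsetProd fun k _ => hasDerivAt_pi.1 (hw k) (a k)
  refine (h1.smul (hasDerivAt_pi.1 hT a)).congr_deriv ?_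
  congr 1
  rw [Finset.sum_smul]
  refine Finset.sum_congr rfl fun k _ => ?_
  congr 1
  rw [← Finset.mul_prod_erase _ _ (Finset.mem_univ k), Function.update_self, smul_eq_mul, mul_comm]
  congr 1
  exact Finset.prod_congr rfl fun j hj => by
    rw [Function.update_of_ne (Finset.ne_of_mem_erase hj)]

end Derivatives

/-! ### Ward identities in multilinear form -/

section Ward

variable {d r q : ℕ}

theorem ev_swap {E : Type*} [AddCommGroup E] [Module ℝ E] (M : Idx d r q → Idx d r q → E)
    (u v : Pos r q → Pt d) : ev (ev M u) v = ev (fun a => ev (M a) v) u :=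
  (ev_map (evLin v) M u).symm

theorem gen_bas (ω : Fin d → Fin d → ℝ) (m : Fin d) :
    gen ω (bas m) = ∑ n, (ω m n * eta n) • bas n := by
  ext n
  simp [gen_apply, Pi.single_apply, Finset.sum_apply]

/-- Both sides are multilinear in `u`, so they need only be compared on basis vectors. -/
theorem ev_rotAct (ω : Fin d → Fin d → ℝ) (T : Idx d r q → ℂ) (u : Pos r q → Pt d) :
    ev (rotAct ω T) u = ∑ k, ev T (Function.update u k (gen ω (u k))) := by
  let F : MultilinearMap ℝ (fun _ : Pos r q => Pt d) ℂ :=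
    ∑ k, (ev T).compLinearMap (Function.update (fun _ => LinearMap.id) k (gen ω))
  have hF : ∀ u, F u = ∑ k, ev T (Function.update u k (gen ω (u k))) := by
    intro u
    simp only [F, sum_apply, MultilinearMap.compLinearMap_apply]
    refine Finset.sum_congr rfl fun k _ => congrArg _ (funext fun j => ?_)
    rcases eq_or_ne j k with rfl | hj
    · simp
    · simp [hj]
  rw [← hF]
  refine congrArg (fun G : MultilinearMap ℝ (fun _ : Pos r q => Pt d) ℂ => G u) ?_
  refine Module.Basis.ext_multilinear (fun _ => Pi.basisFun ℝ (Fin d)) fun a => ?_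
  simp only [Pi.basisFun_apply]
  rw [hF]
  refine (ev_bas _ a).trans ?_
  rw [rotAct]
  refine Finset.sum_congr rfl fun k _ => ?_
  change _ = ev T (Function.update (fun j => bas (a j)) k (gen ω (bas (a k))))
  rw [gen_bas, MultilinearMap.map_update_sum]
  refine Finset.sum_congr rfl fun n _ => ?_
  rw [MultilinearMap.map_update_smul, Complex.real_smul]
  congr 1
  rw [← ev_bas T]
  refine congrArg _ (funext fun j => ?_)
  rcases eq_or_ne j k with rfl | hj
  · simp
  · simp [hj]

/-- The left-hand side of a Ward identity, evaluated on vectors. -/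
theorem ev_ward (H' H : Idx d r q → Idx d r q → ℂ) (c : ℝ) (ω ω' : Fin d → Fin d → ℝ)
    (u v : Pos r q → Pt d) :
    ev (ev (fun a b => H' a b + (c : ℂ) * H a b - rotAct ω (fun a' => H a' b) a
      - rotAct ω' (fun b' => H a b') b) u) v =
    ev (ev H' u) v + (c : ℂ) * ev (ev H u) v
      - ∑ k, ev (ev H (Function.update u k (gen ω (u k)))) v
      - ∑ k, ev (ev H u) (Function.update v k (gen ω' (v k))) := by
  have e1 : ev (ev (fun a b => rotAct ω (fun a' => H a' b) a) u) v =
      ∑ k, ev (ev H (Function.update u k (gen ω (u k)))) v := by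
    have : ev (fun a b => rotAct ω (fun a' => H a' b) a) u =
        fun b => ∑ k, ev H (Function.update u k (gen ω (u k))) b := by
      ext b
      rw [ev_ev_apply]
      refine (ev_rotAct ω _ u).trans (Finset.sum_congr rfl fun k _ => (ev_ev_apply H _ b).symm)
    rw [this, ev_sum]
  have e2 : ev (ev (fun a b => rotAct ω' (fun b' => H a b') b) u) v =
      ∑ k, ev (ev H u) (Function.update v k (gen ω' (v k))) := by
    rw [ev_swap]
    have : ∀ a, ev (fun b => rotAct ω' (fun b' => H a b') b) v =
        ∑ k, ev (H a) (Function.update v k (gen ω' (v k))) := fun a => ev_rotAct ω' _ v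
    simp only [this]
    rw [ev_sum]
    exact Finset.sum_congr rfl fun k _ => (ev_swap H u _).symm
  rw [← e1, ← e2]
  simp only [← evTwo_apply]
  rw [← Complex.real_smul, ← map_smul, ← map_add, ← map_sub, ← map_sub]
  rfl

/-- Multiplication by a scalar and by `I(z)` on the second group of indices. -/
def twist (c : ℝ) (z : Pt d) (M : Idx d r q → Idx d r q → ℂ) (a b : Idx d r q) : ℂ :=
  (c : ℂ) * ev (M a) (fun k => refl z (bas (b k)))

theorem ev_of_multilinear (F : MultilinearMap ℝ (fun _ : Pos r q => Pt d) ℂ)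
    (v : Pos r q → Pt d) : ev (fun b => F fun k => bas (b k)) v = F v := by
  refine congrArg (fun G : MultilinearMap ℝ (fun _ : Pos r q => Pt d) ℂ => G v) ?_
  refine Module.Basis.ext_multilinear (fun _ => Pi.basisFun ℝ (Fin d)) fun a => ?_
  simp only [Pi.basisFun_apply]
  exact ev_bas _ a

theorem ev_twist_apply (c : ℝ) (z : Pt d) (M : Idx d r q → Idx d r q → ℂ) (a : Idx d r q)
    (v : Pos r q → Pt d) : ev (twist c z M a) v = (c : ℂ) * ev (M a) (fun k => refl z (v k)) :=
  ev_of_multilinear (c • (ev (M a)).compLinearMap fun _ => refl z) v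

theorem ev_twist (c : ℝ) (z : Pt d) (M : Idx d r q → Idx d r q → ℂ) (u v : Pos r q → Pt d) :
    ev (ev (twist c z M) u) v = (c : ℂ) * ev (ev M u) (fun k => refl z (v k)) := by
  rw [ev_swap, ev_swap M]
  simp only [ev_twist_apply]
  exact ev_map (c • (LinearMap.id : ℂ →ₗ[ℝ] ℂ)) _ u

theorem eq_of_ev_ev {M N : Idx d r q → Idx d r q → ℂ}
    (h : ∀ u v, ev (ev M u) v = ev (ev N u) v) : M = N :=
  ev_injective fun u => ev_injective fun v => h u v

theorem twist_twist {c c' : ℝ} (h : c * c' = 1) (z : Pt d) (M : Idx d r q → Idx d r q → ℂ) :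
    twist c z (twist c' z M) = M := by
  refine eq_of_ev_ev fun u v => ?_
  simp only [ev_twist, refl_refl]
  rw [← mul_assoc, ← Complex.ofReal_mul, h, Complex.ofReal_one, one_mul]

theorem twist_hook_left {M : Idx d r q → Idx d r q → ℂ}
    (h : ∀ b, IsTracelessHook (fun a => M a b)) (c : ℝ) (z : Pt d) (b : Idx d r q) :
    IsTracelessHook (fun a => twist c z M a b) :=
  (isTracelessHook_pi h).map (c • evLin fun k => refl z (bas (b k)))

theorem twist_hook_right {M : Idx d r q → Idx d r q → ℂ}
    (h : ∀ a, IsTracelessHook (M a)) (c : ℝ) (z : Pt d) (a : Idx d r q) :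
    IsTracelessHook (twist c z M a) := by
  have h1 := ((h a).mhook.comp_refl z)
  have h2 : IsTracelessHook (fun b : Idx d r q => ev (M a) fun k => refl z (bas (b k))) := by
    rw [← mhook_ev_iff]
    have : ev (fun b : Idx d r q => ev (M a) fun k => refl z (bas (b k))) =
        (ev (M a)).compLinearMap fun _ => refl z :=
      MultilinearMap.ext fun v => ev_of_multilinear ((ev (M a)).compLinearMap fun _ => refl z) v
    rw [this]; exact h1
  exact h2.map (c • (LinearMap.id : ℂ →ₗ[ℝ] ℂ))

/-- The Ward identity of a twisted tensor. -/
theorem hasDerivAt_twist {H : ℝ → Idx d r q → Idx d r q → ℂ} {H' : Idx d r q → Idx d r q → ℂ}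
    (hH : HasDerivAt H H' 0) {z z' : Pt d} (hz : sq z ≠ 0) {f : ℝ → ℝ} {κ : ℝ}
    (hf : HasDerivAt f (κ * f 0) 0) {c : ℝ} {ω₁ ω₂ ω₃ : Fin d → Fin d → ℝ}
    (hw : ∀ u v, ev (ev H' u) v + (c : ℂ) * ev (ev (H 0) u) v
      - ∑ k, ev (ev (H 0) (Function.update u k (gen ω₁ (u k)))) v
      - ∑ k, ev (ev (H 0) u) (Function.update v k (gen ω₂ (v k))) = 0)
    (hR : ∀ v, reflDeriv z z' v = refl z (gen ω₃ v) - gen ω₂ (refl z v))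
    (u v : Pos r q → Pt d) :
    HasDerivAt (fun t => ev (ev (twist (f t) (z + t • z') (H t)) u) v)
      (((κ - c : ℝ) : ℂ) * ev (ev (twist (f 0) z (H 0)) u) v
        + ∑ k, ev (ev (twist (f 0) z (H 0)) (Function.update u k (gen ω₁ (u k)))) v
        + ∑ k, ev (ev (twist (f 0) z (H 0)) u) (Function.update v k (gen ω₃ (v k)))) 0 := by
  have hT : HasDerivAt (fun t => ev (H t) u) (ev H' u) 0 := by
    refine hasDerivAt_pi.2 fun b => ?_
    simp only [ev_ev_apply]
    have h1 : HasDerivAt (fun t => fun a => H t a b) (fun a => H' a b) 0 :=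
      hasDerivAt_pi.2 fun a => hasDerivAt_pi.1 (hasDerivAt_pi.1 hH a) b
    have := hasDerivAt_ev (w := fun _ => u) (w' := fun _ => 0) h1 fun k => hasDerivAt_const _ _
    simpa only [MultilinearMap.map_update_zero, Finset.sum_const_zero, add_zero] using this
  have hE := hasDerivAt_ev (w := fun t k => refl (z + t • z') (v k)) hT
    (fun k => hasDerivAt_refl_line hz z' (v k))
  have hK := (hf.ofReal_comp).mul hE
  simp only [ev_twist]
  refine hK.congr_deriv ?_
  simp only [zero_smul, add_zero]
  have h1 := hw u (fun k => refl z (v k))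
  set Rv : Pos r q → Pt d := fun k => refl z (v k) with hRv
  -- The derivative of the reflection trades the rotation `ω₂` for `ω₃`; the `ω₂` terms cancel
  -- against those of the Ward identity of `H`.
  have h2 : ∀ k, ev (ev (H 0) u) (Function.update Rv k (reflDeriv z z' (v k))) =
      ev (ev (H 0) u) (fun j => refl z (Function.update v k (gen ω₃ (v k)) j)) -
        ev (ev (H 0) u) (Function.update Rv k (gen ω₂ (Rv k))) := by
    intro k
    rw [hR, MultilinearMap.map_update_sub]
    congr 2
    ext1 j
    rcases eq_or_ne j k with rfl | hj
    · simp
    · simp [hj, hRv]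
  simp only [h2, Finset.sum_sub_distrib, ← Finset.mul_sum]
  push_cast
  linear_combination ((f 0 : ℂ)) * h1

end Ward

/-! ### Two-point functions transported to a single point -/

section Normalized

variable {d r q : ℕ}

/-- The pairs of points whose squared distance lies in `S`. -/
def sepPairs (d : ℕ) (S : Set ℝ) : Set (Pt d × Pt d) := {p | sq (p.1 - p.2) ∈ S}

/-- Open cones of nonzero squared distances. -/
structure IsSeparation (S : Set ℝ) : Prop where
  isOpen : IsOpen S
  zero_notMem : (0 : ℝ) ∉ S
  mul_mem : ∀ c > 0, ∀ a ∈ S, c * a ∈ S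

theorem IsSeparation.ne_zero {S : Set ℝ} (hS : IsSeparation S) {a : ℝ} (ha : a ∈ S) : a ≠ 0 :=
  fun h => hS.zero_notMem (h ▸ ha)

theorem continuous_sq : Continuous (sq : Pt d → ℝ) := by
  unfold sq low
  fun_prop

theorem isOpen_sepPairs {S : Set ℝ} (hS : IsSeparation S) : IsOpen (sepPairs d S) :=
  hS.isOpen.preimage (continuous_sq.comp (continuous_fst.sub continuous_snd))

/-- Every displacement of a pair of points is produced by a Killing vector without rotation at the
first point. -/
theorem exists_killing {x y : Pt d} (hz : sq (x - y) ≠ 0) (h₁ h₂ : Pt d) :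
    ∃ ξ : Killing d, ξ.vec x = h₁ ∧ ξ.vec y = h₂ ∧ ∀ u, gen (ξ.rot x) u = 0 := by
  -- Requiring no rotation at `x` ties the Lorentz parameter to the special conformal one, `κ`. With
  -- `D = 2 κ·y` one finds `ξ(x) - ξ(y) = -(x-y)² κ`, which fixes `κ`; the translation then adjusts
  -- the value at `y`.
  set κ : Pt d := -(sq (x - y))⁻¹ • (h₁ - h₂) with hκ
  let ξ₀ : Killing d :=
    { P := 0
      L := fun m n => -2 * wedge κ x m n
      L_antisymm := fun m n => by rw [wedge_antisymm κ x m n]; ring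
      D := 2 * dot κ y
      K := low κ }
  let ξ : Killing d := { ξ₀ with P := low (h₂ - ξ₀.vec y) }
  have hL : ∀ u, gen ξ₀.L u = (-2 : ℝ) • (dot κ u • x - dot x u • κ) := by
    intro u
    rw [← gen_wedge]
    ext n
    simp only [gen_apply, Pi.smul_apply, smul_eq_mul, Finset.mul_sum, ξ₀]
    exact Finset.sum_congr rfl fun m _ => by ring
  have hK : ξ₀.Kup = κ := by
    ext m; rw [Killing.Kup]; change eta m * (eta m * κ m) = _; rw [← mul_assoc, eta_mul_self, one_mul]
  have hP : ξ₀.Pup = 0 := by ext m; simp [Killing.Pup, ξ₀]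
  have hvec : ∀ w, ξ.vec w = (h₂ - ξ₀.vec y) + ξ₀.vec w := by
    intro w
    have hP' : ξ.Pup = h₂ - ξ₀.vec y := by
      ext m; rw [Killing.Pup]
      change eta m * (eta m * _) = _
      rw [← mul_assoc, eta_mul_self, one_mul]
    rw [ξ.vec_eq, hP', ξ₀.vec_eq w, hP]
    change _ - gen ξ₀.L w + ξ₀.D • w + sq w • ξ₀.Kup - (2 * dot ξ₀.Kup w) • w = _
    abel
  refine ⟨ξ, ?_, ?_, fun u => ?_⟩
  · rw [hvec]
    have h1 : ξ₀.vec x - ξ₀.vec y = h₁ - h₂ := by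
      have h2 : h₁ - h₂ = -(sq (x - y)) • κ := by
        rw [hκ, smul_smul, neg_mul_neg, mul_inv_cancel₀ hz, one_smul]
      rw [h2, ξ₀.vec_eq, ξ₀.vec_eq, hL, hL, hK, hP, show ξ₀.D = 2 * dot κ y from rfl, sq_sub,
        dot_self]
      module
    rw [sub_eq_iff_eq_add.1 h1]; abel
  · rw [hvec]; abel
  · rw [ξ.gen_rot]
    change gen ξ₀.L u + (2 * dot ξ₀.Kup u) • x - (2 * dot x u) • ξ₀.Kup = 0
    rw [hL, hK]
    module

/-- The two-point function with its scale dependence removed and its second group of indices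
transported to the first point. -/
def normalized (Δ : ℝ) (G : Pt d × Pt d → Idx d r q → Idx d r q → ℂ) (p : Pt d × Pt d) :
    Idx d r q → Idx d r q → ℂ :=
  twist (mabs (p.1 - p.2) ^ (2 * Δ)) (p.1 - p.2) (G p)

variable {Δ : ℝ} {S : Set ℝ} {G : Pt d × Pt d → Idx d r q → Idx d r q → ℂ}

theorem hasDerivAt_comp_line {p w : Pt d × Pt d} (hG : DifferentiableAt ℝ G p) :
    HasDerivAt (fun t : ℝ => G (p + t • w)) (fderiv ℝ G p w) 0 := by
  have h1 : HasDerivAt (fun t : ℝ => p + t • w) w 0 := by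
    simpa using ((hasDerivAt_id (0 : ℝ)).smul_const w).const_add p
  have h2 : HasFDerivAt G (fderiv ℝ G p) (p + (0 : ℝ) • w) := by simpa using hG.hasFDerivAt
  exact h2.comp_hasDerivAt 0 h1

theorem line_sub (p w : Pt d × Pt d) (t : ℝ) :
    (p + t • w).1 - (p + t • w).2 = (p.1 - p.2) + t • (w.1 - w.2) := by
  simp only [Prod.fst_add, Prod.snd_add, Prod.smul_fst, Prod.smul_snd]
  module

theorem IsConformalTwoPoint.differentiableAt (hG : IsConformalTwoPoint Δ (sepPairs d S) G)
    (hS : IsSeparation S) {p : Pt d × Pt d} (hp : p ∈ sepPairs d S) : DifferentiableAt ℝ G p :=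
  hG.differentiable.differentiableAt ((isOpen_sepPairs hS).mem_nhds hp)

/-- The power of `|x-y|` cancels the scale factors, and the reflection converts the rotation at `y`
into the rotation at `x`. -/
theorem IsConformalTwoPoint.hasDerivAt_normalized (hG : IsConformalTwoPoint Δ (sepPairs d S) G)
    (hS : IsSeparation S) {x y : Pt d} (hp : (x, y) ∈ sepPairs d S) (ξ : Killing d)
    (u v : Pos r q → Pt d) :
    HasDerivAt (fun t : ℝ => ev (ev (normalized Δ G ((x, y) + t • (ξ.vec x, ξ.vec y))) u) v)
      (∑ k, ev (ev (normalized Δ G (x, y)) (Function.update u k (gen (ξ.rot x) (u k)))) v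
        + ∑ k, ev (ev (normalized Δ G (x, y)) u) (Function.update v k (gen (ξ.rot x) (v k)))) 0 := by
  have hz : sq (x - y) ≠ 0 := hS.ne_zero hp
  have hH := hasDerivAt_comp_line (w := (ξ.vec x, ξ.vec y)) (hG.differentiableAt hS hp)
  have hf := hasDerivAt_mabs_rpow hz (ξ.two_dot_vec_sub x y) (2 * Δ)
  have hf' : HasDerivAt (fun t : ℝ => mabs (x - y + t • (ξ.vec x - ξ.vec y)) ^ (2 * Δ))
      (Δ * (ξ.scale x + ξ.scale y) *
        mabs (x - y + (0 : ℝ) • (ξ.vec x - ξ.vec y)) ^ (2 * Δ)) 0 := by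
    refine hf.congr_deriv ?_
    simp only [zero_smul, add_zero]
    ring
  have hw : ∀ u v, ev (ev (fderiv ℝ G (x, y) (ξ.vec x, ξ.vec y)) u) v
      + ((Δ * (ξ.scale x + ξ.scale y) : ℝ) : ℂ)
        * ev (ev (G ((x, y) + (0 : ℝ) • (ξ.vec x, ξ.vec y))) u) v
      - ∑ k, ev (ev (G ((x, y) + (0 : ℝ) • (ξ.vec x, ξ.vec y)))
          (Function.update u k (gen (ξ.rot x) (u k)))) v
      - ∑ k, ev (ev (G ((x, y) + (0 : ℝ) • (ξ.vec x, ξ.vec y))) u)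
          (Function.update v k (gen (ξ.rot y) (v k))) = 0 := by
    intro u v
    rw [zero_smul, add_zero, ← ev_ward]
    have : (fun a b => fderiv ℝ G (x, y) (ξ.vec x, ξ.vec y) a b
      + ((Δ * (ξ.scale x + ξ.scale y) : ℝ) : ℂ) * G (x, y) a b
      - rotAct (ξ.rot x) (fun a' => G (x, y) a' b) a
      - rotAct (ξ.rot y) (fun b' => G (x, y) a b') b) = 0 := by
      funext a b; exact hG.ward ξ x y hp a b
    rw [this, ← evTwo_apply, map_zero]
  have := hasDerivAt_twist hH hz hf' hw (reflDeriv_eq ξ hz) u v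
  simp only [zero_smul, add_zero, sub_self, Complex.ofReal_zero, zero_mul, zero_add] at this
  simp only [normalized, line_sub]
  exact this

theorem IsConformalTwoPoint.hasDerivAt_normalized_zero
    (hG : IsConformalTwoPoint Δ (sepPairs d S) G)
    (hS : IsSeparation S) {p : Pt d × Pt d} (hp : p ∈ sepPairs d S) (w : Pt d × Pt d)
    (u v : Pos r q → Pt d) :
    HasDerivAt (fun t : ℝ => ev (ev (normalized Δ G (p + t • w)) u) v) 0 0 := by
  obtain ⟨x, y⟩ := p
  obtain ⟨h₁, h₂⟩ := w
  obtain ⟨ξ, e1, e2, e3⟩ := exists_killing (hS.ne_zero hp) h₁ h₂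
  have := hG.hasDerivAt_normalized hS hp ξ u v
  have h0 : ev (0 : Idx d r q → ℂ) v = 0 := (evLin v).map_zero
  simpa only [e1, e2, e3, MultilinearMap.map_update_zero, h0, Finset.sum_const_zero,
    add_zero] using this

/-- For a pure Lorentz transformation the derivative is the rotation by `ω`, yet all derivatives
vanish. -/
theorem IsConformalTwoPoint.lieInvariant (hG : IsConformalTwoPoint Δ (sepPairs d S) G)
    (hS : IsSeparation S) {p : Pt d × Pt d} (hp : p ∈ sepPairs d S) :
    LieInvariant (normalized Δ G p) := by
  intro ω hω u v
  obtain ⟨x, y⟩ := p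
  let ξ : Killing d := ⟨0, ω, hω, 0, 0⟩
  have h1 := hG.hasDerivAt_normalized hS hp ξ u v
  have h2 := h1.unique (hG.hasDerivAt_normalized_zero hS hp _ u v)
  have h3 : ξ.rot x = ω := by ext m n; simp [Killing.rot, ξ]
  rwa [h3] at h2

theorem IsConformalTwoPoint.normalized_add (hG : IsConformalTwoPoint Δ (sepPairs d S) G)
    (hS : IsSeparation S) {p w : Pt d × Pt d}
    (hp : ∀ t ∈ Set.Icc (0 : ℝ) 1, p + t • w ∈ sepPairs d S) :
    normalized Δ G (p + w) = normalized Δ G p := by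
  refine eq_of_ev_ev fun u v => ?_
  have hd : ∀ t ∈ Set.Icc (0 : ℝ) 1,
      HasDerivAt (fun t : ℝ => ev (ev (normalized Δ G (p + t • w)) u) v) 0 t := by
    intro t ht
    have h1 := hG.hasDerivAt_normalized_zero hS (hp t ht) w u v
    have h2 : HasDerivAt (fun s : ℝ => s - t) 1 t := (hasDerivAt_id t).sub_const t
    -- The vanishing derivative is known at parameter zero from any base point; restart the line at
    -- `p + t w`.
    have h3 : HasDerivAt (fun t' : ℝ => ev (ev (normalized Δ G (p + t • w + t' • w)) u) v) 0
        (t - t) := by rwa [sub_self]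
    have h4 := HasDerivAt.scomp (h := fun s : ℝ => s - t) t h3 h2
    simp only [smul_zero, Function.comp_def] at h4
    refine h4.congr_of_eventuallyEq (Filter.Eventually.of_forall fun s => ?_)
    beta_reduce
    rw [show p + s • w = p + t • w + (s - t) • w by module]
  have := constant_of_has_deriv_right_zero (fun t ht => (hd t ht).continuousAt.continuousWithinAt)
    (fun t ht => (hd t ⟨ht.1, ht.2.le⟩).hasDerivWithinAt) 1 ⟨zero_le_one, le_rfl⟩
  simpa using this

theorem IsConformalTwoPoint.normalized_eq (hG : IsConformalTwoPoint Δ (sepPairs d S) G)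
    (hS : IsSeparation S) {x y : Pt d} (hp : (x, y) ∈ sepPairs d S) :
    normalized Δ G (x, y) = normalized Δ G (x - y, 0) := by
  have h : ((x, y) : Pt d × Pt d) + (-y, -y) = (x - y, 0) := by
    ext <;> simp [sub_eq_add_neg]
  rw [← h]
  refine (hG.normalized_add hS fun t _ => ?_).symm
  change sq _ ∈ S
  rw [line_sub]
  simpa using (show sq (x - y) ∈ S from hp)

theorem refl_bas (x : Pt d) (m n : Fin d) : refl x (bas m) n = invMat x m n * eta n := by
  rw [refl_eq_sum]; simp [Pi.single_apply]

theorem invAct_sum_eq (x y : Pt d) (M : Idx d r q → Idx d r q → ℂ) (a b : Idx d r q) :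
    ∑ a' : Idx d r q, ∑ b' : Idx d r q, ((invAct x a a' * invAct y b b' : ℝ) : ℂ) * M a' b' =
      ev (ev M fun k => refl x (bas (a k))) (fun k => refl y (bas (b k))) := by
  rw [ev_swap, ev_apply]
  refine Finset.sum_congr rfl fun a' _ => ?_
  rw [ev_apply, Finset.smul_sum]
  refine Finset.sum_congr rfl fun b' _ => ?_
  simp only [refl_bas]
  rw [smul_smul, Complex.real_smul]
  rfl

theorem ev_ev_invAct_sum (x y : Pt d) (M : Idx d r q → Idx d r q → ℂ) (u v : Pos r q → Pt d) :
    ev (ev (fun a b => ∑ a' : Idx d r q, ∑ b' : Idx d r q,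
      ((invAct x a a' * invAct y b b' : ℝ) : ℂ) * M a' b') u) v =
      ev (ev M fun k => refl x (u k)) (fun k => refl y (v k)) := by
  simp only [invAct_sum_eq]
  rw [ev_swap]
  have h1 : ∀ a : Idx d r q, ev (fun b : Idx d r q => ev (ev M fun k => refl x (bas (a k)))
      (fun k => refl y (bas (b k)))) v =
      ev (ev M fun k => refl x (bas (a k))) (fun k => refl y (v k)) := fun a =>
    ev_of_multilinear ((ev (ev M fun k => refl x (bas (a k)))).compLinearMap fun _ => refl y) v
  simp only [h1]
  exact ev_of_multilinear (((evLin fun k => refl y (v k)).compMultilinearMap (ev M)).compLinearMap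
    fun _ => refl x) u

theorem mabs_nonneg (x : Pt d) : 0 ≤ mabs x := Real.sqrt_nonneg _

theorem mabs_inversion_sub {x y : Pt d} (hx : sq x ≠ 0) (hy : sq y ≠ 0) :
    mabs (inversion x - inversion y) * mabs x * mabs y = mabs (x - y) := by
  rw [mabs, mabs, mabs, mabs, ← Real.sqrt_mul (abs_nonneg _), ← Real.sqrt_mul (by positivity),
    sq_inversion_sub hx hy, ← abs_mul, ← abs_mul]
  congr 2
  field_simp

/-- The reflection along the inverted displacement factorizes into those along `x`, `x - y` and `y`.
The one along `y` cancels against the inversion acting on the second field, leaving the reflection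
along `x` in both groups; the powers of `|x|` and `|y|` cancel as well. -/
theorem IsConformalTwoPoint.normalized_inversion (hG : IsConformalTwoPoint Δ (sepPairs d S) G)
    (hS : IsSeparation S) {x y : Pt d} (hx : sq x ≠ 0) (hy : sq y ≠ 0) (hz : sq (x - y) ∈ S)
    (hw : sq (inversion x - inversion y) ∈ S) (u v : Pos r q → Pt d) :
    ev (ev (normalized Δ G (inversion x - inversion y, 0)) u) v =
      ev (ev (normalized Δ G (x - y, 0)) fun k => refl x (u k)) (fun k => refl x (v k)) := by
  rw [← hG.normalized_eq hS hz, ← hG.normalized_eq (x := inversion x) (y := inversion y) hS hw,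
    normalized, normalized, ev_twist,
    ev_twist]
  have h1 : ∀ u v, ev (ev (G (inversion x, inversion y)) u) v =
      ((mabs x ^ (2 * Δ) * mabs y ^ (2 * Δ) : ℝ) : ℂ) *
        ev (ev (G (x, y)) fun k => refl x (u k)) (fun k => refl y (v k)) := by
    intro u v
    rw [← ev_ev_invAct_sum, ← evTwo_apply, ← evTwo_apply, ← Complex.real_smul, ← map_smul]
    refine congrArg _ (funext fun a => funext fun b => ?_)
    rw [hG.inversion_invariant x y hz hx hy hw a b]
    rfl
  rw [h1, ← mul_assoc, ← Complex.ofReal_mul]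
  simp only [refl_inversion_sub hx hy (hS.ne_zero hz), refl_refl]
  congr 2
  rw [← mabs_inversion_sub hx hy, ← mul_assoc,
    Real.mul_rpow (mul_nonneg (mabs_nonneg _) (mabs_nonneg _)) (mabs_nonneg _),
    Real.mul_rpow (mabs_nonneg _) (mabs_nonneg _)]

end Normalized

/-! ### Propagation along segments and inversions -/

section Propagation

/-- Properties of displacement vectors that are preserved along segments and by inversions. -/
structure Propagates {d : ℕ} (S : Set ℝ) (E : Pt d → Prop) : Prop where
  segment : ∀ z h : Pt d, (∀ t ∈ Set.Icc (0 : ℝ) 1, sq (z + t • h) ∈ S) → E z → E (z + h)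
  of_inversion : ∀ x y : Pt d, sq x ≠ 0 → sq y ≠ 0 → sq (x - y) ∈ S →
    sq (inversion x - inversion y) ∈ S → E (x - y) → E (inversion x - inversion y)

theorem sq_neg {d : ℕ} (z : Pt d) : sq (-z) = sq z := by
  rw [← dot_self, dot_neg_left, dot_neg_right, neg_neg, dot_self]

theorem sq_sub_of_two_dot_eq {d : ℕ} {x z : Pt d} (h : 2 * dot x z = sq z) :
    sq (x - z) = sq x := by
  rw [sq_sub]; linarith

/-- The points `x` and `x - z` have equal squares, so the inversion rescales both by the same factor
and the displacement keeps its line. -/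
theorem inversion_sub_of_two_dot_eq {d : ℕ} {x z : Pt d} (h : 2 * dot x z = sq z) :
    inversion x - inversion (x - z) = (sq x)⁻¹ • z := by
  rw [inversion_eq_smul, inversion_eq_smul, sq_sub_of_two_dot_eq h]; module

namespace Propagates

section General

variable {d : ℕ} {S : Set ℝ} {E : Pt d → Prop}

theorem smul_inv (hE : Propagates S E) (hS : IsSeparation S) {x z : Pt d}
    (h : 2 * dot x z = sq z) (hx : sq x ≠ 0) (hz : sq z ∈ S) (hEz : E z) :
    E ((sq x)⁻¹ • z) := by
  rw [← inversion_sub_of_two_dot_eq h]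
  refine hE.of_inversion x (x - z) hx (by rwa [sq_sub_of_two_dot_eq h]) ?_ ?_ ?_
  · rwa [sub_sub_cancel]
  · rw [inversion_sub_of_two_dot_eq h, sq_smul]
    exact hS.mul_mem _ (by positivity) _ hz
  · rwa [sub_sub_cancel]

theorem sq_segment (a b : Pt d) (t : ℝ) :
    sq (a + t • (b - a)) = (1 - t) ^ 2 * sq a + 2 * (t * (1 - t)) * dot a b + t ^ 2 * sq b := by
  rw [sq_add, sq_smul, dot_smul_right, dot_sub_right, dot_self, sq_sub, dot_comm b a]; ring

/-- With a nonnegative scalar product the square stays positive along the segment from `a` to `b`.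
-/
theorem of_spacelike (hE : Propagates S E) (hS : Set.Ioi 0 ⊆ S) {a b : Pt d} (ha : 0 < sq a)
    (hb : 0 < sq b) (hab : 0 ≤ dot a b) (h : E a) : E b := by
  rw [← add_sub_cancel a b]
  refine hE.segment a (b - a) (fun t ht => hS ?_) h
  rw [Set.mem_Ioi, sq_segment]
  have h1 : 0 ≤ 2 * (t * (1 - t)) * dot a b :=
    mul_nonneg (mul_nonneg zero_le_two (mul_nonneg ht.1 (by linarith [ht.2]))) hab
  rcases ht.1.eq_or_lt with rfl | h0
  · simpa using ha
  · have := mul_pos (pow_pos h0 2) hb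
    have := mul_nonneg (sq_nonneg (1 - t)) ha.le
    linarith

theorem of_timelike (hE : Propagates S E) (hS : Set.Iio 0 ⊆ S) {a b : Pt d} (ha : sq a < 0)
    (hb : sq b < 0) (hab : dot a b ≤ 0) (h : E a) : E b := by
  rw [← add_sub_cancel a b]
  refine hE.segment a (b - a) (fun t ht => hS ?_) h
  rw [Set.mem_Iio, sq_segment]
  have h1 : 2 * (t * (1 - t)) * dot a b ≤ 0 :=
    mul_nonpos_of_nonneg_of_nonpos
      (mul_nonneg zero_le_two (mul_nonneg ht.1 (by linarith [ht.2]))) hab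
  rcases ht.1.eq_or_lt with rfl | h0
  · simpa using ha
  · have := mul_neg_of_pos_of_neg (pow_pos h0 2) hb
    have := mul_nonpos_of_nonneg_of_nonpos (sq_nonneg (1 - t)) ha.le
    linarith

end General

variable {D : ℕ} {S : Set ℝ} {E : Pt (D + 2) → Prop}

theorem sq_bas_zero : sq (bas 0 : Pt (D + 2)) = -1 := by
  rw [← dot_self, dot_bas_bas, metric_self, eta_zero]

theorem sq_bas_one : sq (bas 1 : Pt (D + 2)) = 1 := by
  rw [← dot_self, dot_bas_bas, metric_self, eta_one]

/-- An inversion at a pair with `x² = -1` reverses the displacement. This is indispensable in two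
dimensions, where spacelike displacements are disconnected; it also treats all dimensions uniformly.
-/
theorem neg_of_spacelike (hE : Propagates S E) (hS : IsSeparation S) (hS' : Set.Ioi 0 ⊆ S)
    {z : Pt (D + 2)} (hz : 0 < sq z) (h0 : dot z (bas 0) = 0) (h : E z) : E (-z) := by
  -- The point `x = z/2 + c e_0` satisfies `2 x·z = z²`, and `x² = z²/4 - c²` equals `-1` for this
  -- `c`.
  set c := Real.sqrt (sq z / 4 + 1) with hc
  have hc2 : c ^ 2 = sq z / 4 + 1 := Real.sq_sqrt (by positivity)
  have hx : sq ((1 / 2 : ℝ) • z + c • bas 0) = -1 := by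
    rw [sq_add, sq_smul, sq_smul, dot_smul_left, dot_smul_right, h0, sq_bas_zero, hc2]; ring
  have h2 : 2 * dot ((1 / 2 : ℝ) • z + c • bas 0) z = sq z := by
    rw [dot_add_left, dot_smul_left, dot_smul_left, dot_comm (bas 0), h0, dot_self]; ring
  have := hE.smul_inv hS h2 (by rw [hx]; norm_num) (hS' hz) h
  rw [hx] at this
  convert this using 1
  module

theorem spacelike (hE : Propagates S E) (hS : IsSeparation S) (hS' : Set.Ioi 0 ⊆ S)
    {z z' : Pt (D + 2)} (hz : 0 < sq z) (hz' : 0 < sq z') (h : E z) : E z' := by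
  -- Removing the time component stays within the spacelike region; two purely spatial vectors are
  -- then joined directly or after a change of sign.
  let sp : Pt (D + 2) → Pt (D + 2) := fun z => z + dot z (bas 0) • bas 0
  have hsp0 : ∀ z, dot (sp z) (bas 0) = 0 := fun z => by
    simp only [sp, dot_add_left, dot_smul_left, dot_self, sq_bas_zero]; ring
  have hsq : ∀ z, sq (sp z) = sq z + dot z (bas 0) ^ 2 := fun z => by
    simp only [sp, sq_add, sq_smul, dot_smul_right, sq_bas_zero]; ring
  have hdot : ∀ z, dot z (sp z) = sq z + dot z (bas 0) ^ 2 := fun z => by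
    simp only [sp, dot_add_right, dot_smul_right, dot_self]; ring
  have hpos : ∀ z, 0 < sq z → 0 < sq (sp z) := fun z hz => by rw [hsq]; positivity
  have h1 : E (sp z) := hE.of_spacelike hS' hz (hpos z hz) (by rw [hdot]; positivity) h
  have h2 : E (sp z') := by
    rcases le_total 0 (dot (sp z) (sp z')) with hc | hc
    · exact hE.of_spacelike hS' (hpos z hz) (hpos z' hz') hc h1
    · refine hE.of_spacelike hS' (by rw [sq_neg]; exact hpos z hz) (hpos z' hz') ?_
        (hE.neg_of_spacelike hS hS' (hpos z hz) (hsp0 z) h1)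
      rw [dot_neg_left]; linarith
  exact hE.of_spacelike hS' (hpos z' hz') hz' (by rw [dot_comm, hdot]; positivity) h2

theorem timelike (hE : Propagates S E) (hS : IsSeparation S) (hS' : Set.Iio 0 ⊆ S)
    {z z' : Pt (D + 2)} (hz : sq z < 0) (hz' : sq z' < 0) (h : E z) : E z' := by
  have hflip : ∀ z : Pt (D + 2), sq z < 0 → E z → E (-z) := by
    intro z hz h
    have hx : sq ((1 / 2 : ℝ) • z) = sq z / 4 := by rw [sq_smul]; ring
    -- For `x = z/2` the inverted displacement is `(4/z²) z`, a negative multiple of `z`; this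
    -- connects future and past.
    have h1 := hE.smul_inv hS (x := (1 / 2 : ℝ) • z) (by rw [dot_smul_left, dot_self]; ring)
      (by rw [hx]; linarith) (hS' hz) h
    rw [hx] at h1
    refine hE.of_timelike hS' ?_ (by rwa [sq_neg]) ?_ h1
    · rw [sq_smul]
      exact mul_neg_of_pos_of_neg (by have := hz.ne; positivity) hz
    · rw [dot_smul_left, dot_neg_right, dot_self]
      have : (sq z / 4)⁻¹ * -sq z = -4 := by
        have := hz.ne
        field_simp
      rw [this]; norm_num
  have hb : sq (bas 0 : Pt (D + 2)) < 0 := by rw [sq_bas_zero]; norm_num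
  have h0 : E (bas 0) := by
    rcases le_total (dot z (bas 0)) 0 with hc | hc
    · exact hE.of_timelike hS' hz hb hc h
    · refine hE.of_timelike hS' (by rwa [sq_neg]) hb ?_ (hflip z hz h)
      rw [dot_neg_left]; linarith
  rcases le_total (dot (bas 0) z') 0 with hc | hc
  · exact hE.of_timelike hS' hb hz' hc h0
  · refine hE.of_timelike hS' (by rwa [sq_neg]) hz' ?_ (hflip _ hb h0)
    rw [dot_neg_left]; linarith

theorem spacelike_timelike (hE : Propagates S E) (hS : IsSeparation S) (hS' : {0}ᶜ ⊆ S)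
    {z z' : Pt (D + 2)} (hz : 0 < sq z) (hz' : sq z' < 0) (h : E z) : E z' := by
  have hS₁ : Set.Ioi 0 ⊆ S := fun a ha => hS' (ne_of_gt ha)
  have hS₂ : Set.Iio 0 ⊆ S := fun a ha => hS' (ne_of_lt ha)
  -- The points `2 e_1` and `e_0` have squares `4` and `-1` and a difference of square `3`, so
  -- inverting them gives a displacement of square `-3/4`: the inversion crosses from spacelike to
  -- timelike.
  have h1 : sq ((2 : ℝ) • bas 1 : Pt (D + 2)) = 4 := by rw [sq_smul, sq_bas_one]; norm_num
  have h2 : sq ((2 : ℝ) • bas 1 - bas 0 : Pt (D + 2)) = 3 := by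
    rw [sq_sub, h1, sq_bas_zero, dot_smul_left, dot_bas_bas, metric_of_ne (by simp)]; norm_num
  have h0 := sq_bas_zero (D := D)
  have h1' : sq ((2 : ℝ) • bas 1 : Pt (D + 2)) ≠ 0 := by rw [h1]; norm_num
  have h0' : sq (bas 0 : Pt (D + 2)) ≠ 0 := by rw [h0]; norm_num
  have h3 : sq (inversion ((2 : ℝ) • bas 1) - inversion (bas 0) : Pt (D + 2)) < 0 := by
    rw [sq_inversion_sub h1' h0', h1, h2, h0]; norm_num
  have h4 := hE.spacelike hS hS₁ hz (show 0 < sq ((2 : ℝ) • bas 1 - bas 0 : Pt (D + 2)) by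
    rw [h2]; norm_num) h
  have h5 := hE.of_inversion _ _ h1' h0' (hS' (by rw [h2]; norm_num)) (hS₂ h3) h4
  exact hE.timelike hS hS₂ h3 hz' h5

end Propagates

end Propagation

/-! ### Uniqueness of the two-point function -/

section Forward

theorem normalized_hook_left {d r q : ℕ} {Δ : ℝ} {U : Set (Pt d × Pt d)}
    {G : Pt d × Pt d → Idx d r q → Idx d r q → ℂ} (hG : IsConformalTwoPoint Δ U G)
    {p : Pt d × Pt d} (hp : p ∈ U) (b : Idx d r q) :
    IsTracelessHook (fun a => normalized Δ G p a b) :=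
  twist_hook_left (hG.hook_left p hp) _ _ b

theorem normalized_hook_right {d r q : ℕ} {Δ : ℝ} {U : Set (Pt d × Pt d)}
    {G : Pt d × Pt d → Idx d r q → Idx d r q → ℂ} (hG : IsConformalTwoPoint Δ U G)
    {p : Pt d × Pt d} (hp : p ∈ U) (a : Idx d r q) :
    IsTracelessHook (normalized Δ G p a) :=
  twist_hook_right (hG.hook_right p hp) _ _ a

theorem mem_sepPairs_zero {d : ℕ} {S : Set ℝ} {z : Pt d} (hz : sq z ∈ S) :
    (z, (0 : Pt d)) ∈ sepPairs d S := by
  change sq (z - 0) ∈ S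
  rwa [sub_zero]

theorem IsConformalTwoPoint.normalized_add_zero {d r q : ℕ} {Δ : ℝ} {S : Set ℝ}
    {G : Pt d × Pt d → Idx d r q → Idx d r q → ℂ} (hG : IsConformalTwoPoint Δ (sepPairs d S) G)
    (hS : IsSeparation S) {z h : Pt d} (hz : ∀ t ∈ Set.Icc (0 : ℝ) 1, sq (z + t • h) ∈ S) :
    normalized Δ G (z + h, 0) = normalized Δ G (z, 0) := by
  have h1 : ((z, 0) : Pt d × Pt d) + (h, 0) = (z + h, 0) := by simp
  rw [← h1]
  refine hG.normalized_add hS fun t ht => ?_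
  change sq _ ∈ S
  rw [line_sub]
  simpa using hz t ht

/-- Rescale `x` so that `2 x·z = z²`, which does not change the reflection. Inverting the pair `x`,
`x - z` then maps `z` to the positive multiple `z/x²`, where the normalized function has the same
value as at `z`. -/
theorem IsConformalTwoPoint.reflInvariant {d r q : ℕ} {Δ : ℝ} {S : Set ℝ}
    {G : Pt d × Pt d → Idx d r q → Idx d r q → ℂ} (hG : IsConformalTwoPoint Δ (sepPairs d S) G)
    (hS : IsSeparation S) {z x : Pt d} (hz : sq z ∈ S) (hx : 0 < sq x) (hxz : dot x z ≠ 0) :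
    ReflInvariant (normalized Δ G (z, 0)) x := by
  have hz0 := hS.ne_zero hz
  set t : ℝ := sq z / (2 * dot x z) with ht
  have ht0 : t ≠ 0 := div_ne_zero hz0 (mul_ne_zero two_ne_zero hxz)
  have h2 : 2 * dot (t • x) z = sq z := by rw [dot_smul_left, ht]; field_simp
  have hx' : 0 < sq (t • x) := by rw [sq_smul]; positivity
  set c : ℝ := (sq (t • x))⁻¹ with hc
  have hc0 : 0 < c := inv_pos.2 hx'
  have hcz : sq (c • z) ∈ S := by
    rw [sq_smul]; exact hS.mul_mem _ (by positivity) _ hz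
  have h3 : normalized Δ G (c • z, 0) = normalized Δ G (z, 0) := by
    rw [show c • z = z + (c - 1) • z by module]
    refine hG.normalized_add_zero hS fun s hs => ?_
    rw [show z + s • (c - 1) • z = ((1 - s) + s * c) • z by module, sq_smul]
    refine hS.mul_mem _ (pow_pos ?_ 2) _ hz
    rcases hs.1.eq_or_lt with rfl | h0
    · norm_num
    · have := mul_pos h0 hc0
      linarith [hs.2]
  intro u v
  have h4 := hG.normalized_inversion hS (x := t • x) (y := t • x - z) hx'.ne'
    (by rw [sq_sub_of_two_dot_eq h2]; exact hx'.ne') (by rwa [sub_sub_cancel])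
    (by rwa [inversion_sub_of_two_dot_eq h2]) u v
  rw [inversion_sub_of_two_dot_eq h2, sub_sub_cancel, h3] at h4
  simp only [refl_smul ht0] at h4
  exact h4.symm

variable {D r q : ℕ} {Δ : ℝ} {S : Set ℝ}
  {G : Pt (D + 2) × Pt (D + 2) → Idx (D + 2) r q → Idx (D + 2) r q → ℂ}
  {Pi : Pt (D + 2) → Idx (D + 2) r q → Idx (D + 2) r q → ℝ}

/-- Distinct nonzero spatial components make `z` non-orthogonal to all the axes and axis differences
needed, so the required reflection invariances hold at this one displacement. -/
theorem IsConformalTwoPoint.exists_eq_mul (hG : IsConformalTwoPoint Δ (sepPairs (D + 2) S) G)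
    (hS : IsSeparation S) (hPi : IsNumerator Pi) (hq : q ≤ D) {z : Pt (D + 2)} (hz : sq z ∈ S)
    (hz' : ∀ m : Fin (D + 1), z m.succ = (m : ℕ) + 1) :
    ∃ C : ℂ, normalized Δ G (z, 0) = fun a b => C * (Pi 0 a b : ℂ) := by
  have hp := mem_sepPairs_zero hz
  have hd : ∀ m : Fin (D + 1), dot (bas m.succ) z = (m : ℕ) + 1 := by
    intro m; rw [dot_comm, dot_bas, low, eta_succ, hz', one_mul]
  refine hPi.eq_mul hq (normalized_hook_left hG hp) (normalized_hook_right hG hp)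
    (hG.lieInvariant hS hp) ?_ (fun j => ?_) (fun i j hij => ?_)
  · refine hG.reflInvariant hS hz ?_ ?_
    · rw [Propagates.sq_bas_one]; norm_num
    · have := hd 0
      rw [Fin.succ_zero_eq_one] at this
      rw [this]; simp
  · refine hG.reflInvariant hS hz ?_ ?_
    · rw [sq_etr]; norm_num
    · rw [etr, hd]; positivity
  · refine hG.reflInvariant hS hz ?_ ?_
    · rw [sq_sub, sq_etr, sq_etr, dot_etr_etr, if_neg hij]; norm_num
    · rw [dot_sub_left, etr, etr, hd, hd, sub_ne_zero]
      simpa [Fin.ext_iff] using hij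

theorem IsConformalTwoPoint.propagates (hG : IsConformalTwoPoint Δ (sepPairs (D + 2) S) G)
    (hS : IsSeparation S) (hPi : IsNumerator Pi) (C : ℂ) :
    Propagates S (fun z => normalized Δ G (z, 0) = fun a b => C * (Pi 0 a b : ℂ)) where
  segment z h hz he := by rw [hG.normalized_add_zero hS hz, he]
  of_inversion x y hx hy hz hw he := by
    refine eq_of_ev_ev fun u v => ?_
    rw [hG.normalized_inversion hS hx hy hz hw, he, ev_ofReal, ev_ofReal,
      ReflInvariant.of_mem hPi.mem_pairings x u v]

/-- A point with prescribed spatial components and arbitrary time component. -/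
def ramp (D : ℕ) (T : ℝ) : Pt (D + 2) := Fin.cons T fun m => (m : ℕ) + 1

theorem sq_ramp (D : ℕ) (T : ℝ) :
    sq (ramp D T) = -T ^ 2 + ∑ m : Fin (D + 1), ((m : ℕ) + 1 : ℝ) ^ 2 := by
  rw [sq, Fin.sum_univ_succ]
  simp only [low, eta_zero, eta_succ, ramp, Fin.cons_zero, Fin.cons_succ]
  ring_nf

theorem IsConformalTwoPoint.exists_forall_eq_mul
    (hG : IsConformalTwoPoint Δ (sepPairs (D + 2) S) G)
    (hS : S = Set.Ioi 0 ∨ S = Set.Iio 0 ∨ S = {0}ᶜ) (hS' : IsSeparation S)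
    (hPi : IsNumerator Pi) (hq : q ≤ D) :
    ∃ C : ℂ, ∀ z, sq z ∈ S → normalized Δ G (z, 0) = fun a b => C * (Pi 0 a b : ℂ) := by
  set A : ℝ := ∑ m : Fin (D + 1), ((m : ℕ) + 1 : ℝ) ^ 2 with hA
  have hA0 : 0 < A := Finset.sum_pos (fun m _ => by positivity) Finset.univ_nonempty
  have hs : 0 < sq (ramp D 0) := by rw [sq_ramp]; simpa using hA0
  -- A large enough time component makes the point timelike without touching its spatial components.
  have ht : sq (ramp D (Real.sqrt (A + 1))) < 0 := by
    rw [sq_ramp, ← hA, Real.sq_sqrt (by positivity)]; linarith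
  have hr : ∀ T, ∀ m : Fin (D + 1), ramp D T m.succ = (m : ℕ) + 1 := fun T m => by simp [ramp]
  rcases hS with rfl | rfl | rfl
  · obtain ⟨C, hC⟩ := hG.exists_eq_mul hS' hPi hq hs (hr _)
    exact ⟨C, fun z hz => (hG.propagates hS' hPi C).spacelike hS' le_rfl hs hz hC⟩
  · obtain ⟨C, hC⟩ := hG.exists_eq_mul hS' hPi hq ht (hr _)
    exact ⟨C, fun z hz => (hG.propagates hS' hPi C).timelike hS' le_rfl ht hz hC⟩
  · obtain ⟨C, hC⟩ := hG.exists_eq_mul hS' hPi hq hs.ne' (hr _)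
    refine ⟨C, fun z hz => ?_⟩
    have hE := hG.propagates hS' hPi C
    rcases lt_or_gt_of_ne (show sq z ≠ 0 from hz) with h | h
    · exact hE.spacelike_timelike hS' le_rfl hs h hC
    · exact hE.spacelike hS' (fun a ha => ne_of_gt ha) hs h hC

end Forward

/-! ### The conformally invariant two-point functions -/

section Backward

variable {d r q : ℕ} {Δ : ℝ} {S : Set ℝ} {Pi : Pt d → Idx d r q → Idx d r q → ℝ}

theorem IsNumerator.twist_apply (hPi : IsNumerator Pi) (c : ℝ) (z : Pt d) (C : ℂ)
    (a b : Idx d r q) :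
    twist c z (fun a b => C * (Pi 0 a b : ℂ)) a b = (c : ℂ) * (C * (Pi z a b : ℂ)) := by
  rw [twist, apply_eq_ev_refl hPi.mem_pairings z a b]
  congr 1
  exact ev_map ((LinearMap.mulLeft ℝ C) ∘ₗ Complex.ofRealCLM.toLinearMap) (Pi 0 a) _

theorem IsNumerator.twist_inv_apply (hPi : IsNumerator Pi) (z : Pt d) (C : ℂ)
    (a b : Idx d r q) :
    twist (mabs z ^ (-(2 * Δ))) z (fun a b => C * (Pi 0 a b : ℂ)) a b =
      C * (Pi z a b : ℂ) / ((mabs z ^ (2 * Δ) : ℝ) : ℂ) := by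
  rw [hPi.twist_apply, Real.rpow_neg (mabs_nonneg z), Complex.ofReal_inv]
  ring

theorem differentiableAt_sq (z : Pt d) : DifferentiableAt ℝ sq z := by
  unfold sq low
  fun_prop

theorem differentiableAt_refl {z : Pt d} (hz : sq z ≠ 0) (v : Pt d) :
    DifferentiableAt ℝ (fun z => refl z v) z := by
  have h1 : DifferentiableAt ℝ (fun z : Pt d => dot z v) z := by
    unfold dot low
    fun_prop
  simp only [refl_apply, div_eq_mul_inv]
  exact (((h1.const_mul 2).mul ((differentiableAt_sq z).inv hz)).smul
    differentiableAt_id).const_sub v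

theorem differentiableAt_mabs_rpow {z : Pt d} (hz : sq z ≠ 0) (p : ℝ) :
    DifferentiableAt ℝ (fun z => mabs z ^ p) z := by
  have h1 : DifferentiableAt ℝ (fun z : Pt d => |sq z|) z :=
    (differentiableAt_abs hz).comp z (differentiableAt_sq z)
  have h2 : DifferentiableAt ℝ (mabs : Pt d → ℝ) z := h1.sqrt (abs_ne_zero.2 hz)
  exact h2.rpow_const (Or.inl (mabs_pos hz).ne')

theorem differentiableAt_twist {z : Pt d} (hz : sq z ≠ 0) (p : ℝ)
    (M : Idx d r q → Idx d r q → ℂ) :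
    DifferentiableAt ℝ (fun z => twist (mabs z ^ p) z M) z := by
  refine differentiableAt_pi.2 fun a => differentiableAt_pi.2 fun b => ?_
  simp only [twist, ← Complex.real_smul, ev_apply]
  refine (differentiableAt_mabs_rpow hz p).smul (DifferentiableAt.fun_sum fun b' _ => ?_)
  exact (HasFDerivAt.finsetProd fun k _ => (differentiableAt_pi.1 (differentiableAt_refl hz
    (bas (b k))) (b' k)).hasFDerivAt).differentiableAt.smul_const _

/-- Lorentz invariance of the constant `M` is a Ward identity with the rotation at `x` in both
groups; twisting turns the second rotation into the one at `y`. -/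
theorem ev_ward_twist {M : Idx d r q → Idx d r q → ℂ} (hM : LieInvariant M) (ξ : Killing d)
    {x y : Pt d} (hz : sq (x - y) ≠ 0) (u v : Pos r q → Pt d) :
    HasDerivAt (fun t : ℝ => ev (ev (twist
        (mabs (x - y + t • (ξ.vec x - ξ.vec y)) ^ (-(2 * Δ)))
        (x - y + t • (ξ.vec x - ξ.vec y)) M) u) v)
      (((-(Δ * (ξ.scale x + ξ.scale y)) : ℝ) : ℂ)
          * ev (ev (twist (mabs (x - y) ^ (-(2 * Δ))) (x - y) M) u) v
        + ∑ k, ev (ev (twist (mabs (x - y) ^ (-(2 * Δ))) (x - y) M)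
            (Function.update u k (gen (ξ.rot x) (u k)))) v
        + ∑ k, ev (ev (twist (mabs (x - y) ^ (-(2 * Δ))) (x - y) M) u)
            (Function.update v k (gen (ξ.rot y) (v k)))) 0 := by
  have hf : HasDerivAt (fun t : ℝ => mabs (x - y + t • (ξ.vec x - ξ.vec y)) ^ (-(2 * Δ)))
      (-(Δ * (ξ.scale x + ξ.scale y)) *
        mabs (x - y + (0 : ℝ) • (ξ.vec x - ξ.vec y)) ^ (-(2 * Δ))) 0 := by
    refine (hasDerivAt_mabs_rpow hz (ξ.two_dot_vec_sub x y) (-(2 * Δ))).congr_deriv ?_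
    simp only [zero_smul, add_zero]
    ring
  have hw : ∀ u v, ev (ev (0 : Idx d r q → Idx d r q → ℂ) u) v + ((0 : ℝ) : ℂ) * ev (ev M u) v
      - ∑ k, ev (ev M (Function.update u k (gen (ξ.rot x) (u k)))) v
      - ∑ k, ev (ev M u) (Function.update v k (gen (ξ.rot x) (v k))) = 0 := by
    intro u v
    have h1 := hM (ξ.rot x) (ξ.rot_antisymm x) u v
    have h2 : ev (ev (0 : Idx d r q → Idx d r q → ℂ) u) v = 0 := by
      rw [← evTwo_apply, map_zero]
    rw [h2, Complex.ofReal_zero]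
    linear_combination -h1
  have := hasDerivAt_twist (hasDerivAt_const (0 : ℝ) M) hz hf hw (reflDeriv_eq' ξ hz) u v
  simpa only [zero_smul, add_zero, sub_zero] using this

/-- On the open set of separated pairs, `G` is the twist of the invariant tensor `C · Pi 0`. The
twist preserves hook type; Lorentz invariance yields the Ward identities and reflection invariance
the inversion property. -/
theorem IsNumerator.isConformalTwoPoint (hPi : IsNumerator Pi) (hd : 0 < d)
    (hS : IsSeparation S) (C : ℂ) {G : Pt d × Pt d → Idx d r q → Idx d r q → ℂ}
    (hG : ∀ x y : Pt d, (x, y) ∈ sepPairs d S → ∀ a b : Idx d r q,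
      G (x, y) a b = C * (Pi (x - y) a b : ℂ) / ((mabs (x - y) ^ (2 * Δ) : ℝ) : ℂ)) :
    IsConformalTwoPoint Δ (sepPairs d S) G := by
  set M : Idx d r q → Idx d r q → ℂ := fun a b => C * (Pi 0 a b : ℂ) with hM
  let L : ℝ →ₗ[ℝ] ℂ := (LinearMap.mulLeft ℝ C) ∘ₗ Complex.ofRealCLM.toLinearMap
  obtain ⟨hPL, hPR⟩ := hPi.hook_zero hd
  have hML : ∀ b, IsTracelessHook (fun a => M a b) := fun b => (hPL b).map L
  have hMR : ∀ a, IsTracelessHook (M a) := fun a => (hPR a).map L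
  have hMev : ∀ u v, ev (ev M u) v = C * ((ev (ev (Pi 0) u) v : ℝ) : ℂ) := ev_ofReal (Pi 0) C
  have hMlie : LieInvariant M := by
    intro ω hω u v
    have := LieInvariant.of_mem hPi.mem_pairings ω hω u v
    simp only [hMev, ← Finset.mul_sum, ← mul_add, ← Complex.ofReal_sum, ← Complex.ofReal_add]
    rw [this, Complex.ofReal_zero, mul_zero]
  have hGeq : ∀ p ∈ sepPairs d S, G p = twist (mabs (p.1 - p.2) ^ (-(2 * Δ))) (p.1 - p.2) M := by
    rintro ⟨x, y⟩ hp
    funext a b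
    rw [hG x y hp, ← hPi.twist_inv_apply]
  have hGev : ∀ p ∈ sepPairs d S, ∀ u v, ev (ev (G p) u) v =
      ((mabs (p.1 - p.2) ^ (-(2 * Δ)) : ℝ) : ℂ)
        * ev (ev M u) (fun k => refl (p.1 - p.2) (v k)) := by
    intro p hp u v
    rw [hGeq p hp, ev_twist]
  have hdiff : ∀ p ∈ sepPairs d S, DifferentiableAt ℝ G p := by
    intro p hp
    have h1 : DifferentiableAt ℝ
        (fun p : Pt d × Pt d => twist (mabs (p.1 - p.2) ^ (-(2 * Δ))) (p.1 - p.2) M) p :=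
      (differentiableAt_twist (hS.ne_zero hp) (-(2 * Δ)) M).comp p
        (differentiableAt_fst.sub differentiableAt_snd)
    refine h1.congr_of_eventuallyEq ?_
    filter_upwards [(isOpen_sepPairs hS).mem_nhds hp] with p' hp' using hGeq p' hp'
  refine ⟨fun p hp => (hdiff p hp).differentiableWithinAt, ?_, ?_, ?_, ?_⟩
  · intro p hp b
    rw [hGeq p hp]
    exact twist_hook_left hML _ _ b
  · intro p hp a
    rw [hGeq p hp]
    exact twist_hook_right hMR _ _ a
  · intro ξ x y hp
    have hz : sq (x - y) ≠ 0 := hS.ne_zero hp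
    have hzero : (fun a b => fderiv ℝ G (x, y) (ξ.vec x, ξ.vec y) a b
        + ((Δ * (ξ.scale x + ξ.scale y) : ℝ) : ℂ) * G (x, y) a b
        - rotAct (ξ.rot x) (fun a' => G (x, y) a' b) a
        - rotAct (ξ.rot y) (fun b' => G (x, y) a b') b) = 0 := by
      refine eq_of_ev_ev fun u v => ?_
      rw [ev_ward]
      have h1 := hasDerivAt_comp_line (w := (ξ.vec x, ξ.vec y)) (hdiff _ hp)
      have h2 : HasDerivAt (fun t : ℝ => ev (ev (G ((x, y) + t • (ξ.vec x, ξ.vec y))) u) v)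
          (ev (ev (fderiv ℝ G (x, y) (ξ.vec x, ξ.vec y)) u) v) 0 := by
        have := (LinearMap.toContinuousLinearMap (evTwo u v)).hasFDerivAt.comp_hasDerivAt 0 h1
        exact this
      have h3 : HasDerivAt (fun t : ℝ => ev (ev (G ((x, y) + t • (ξ.vec x, ξ.vec y))) u) v) _ 0 :=
        (ev_ward_twist (Δ := Δ) hMlie ξ hz u v).congr_of_eventuallyEq (by
          have hc : Continuous (fun t : ℝ => ((x, y) : Pt d × Pt d) + t • (ξ.vec x, ξ.vec y)) := by
            fun_prop
          have hm : ((x, y) : Pt d × Pt d) + (0 : ℝ) • (ξ.vec x, ξ.vec y) ∈ sepPairs d S := by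
            simpa using hp
          filter_upwards [hc.continuousAt.preimage_mem_nhds
            ((isOpen_sepPairs hS).mem_nhds hm)] with t ht
          rw [hGeq _ ht, line_sub])
      have h4 := h2.unique h3
      have h5 : twist (mabs (x - y) ^ (-(2 * Δ))) (x - y) M = G (x, y) := (hGeq _ hp).symm
      rw [h5] at h4
      have h6 : ev (ev (0 : Idx d r q → Idx d r q → ℂ) u) v = 0 := by
        rw [← evTwo_apply, map_zero]
      rw [h4, h6]
      push_cast
      ring
    intro a b
    exact congrFun (congrFun hzero a) b
  · intro x y hp hx hy hp'
    have hz : sq (x - y) ≠ 0 := hS.ne_zero hp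
    have hz' : sq (y - x) ≠ 0 := by rwa [← neg_sub, sq_neg]
    have key : G (inversion x, inversion y) =
        (mabs x ^ (2 * Δ) * mabs y ^ (2 * Δ)) • fun a b =>
          ∑ a' : Idx d r q, ∑ b' : Idx d r q,
            ((invAct x a a' * invAct y b b' : ℝ) : ℂ) * G (x, y) a' b' := by
      refine eq_of_ev_ev fun u v => ?_
      rw [← evTwo_apply (M := (mabs x ^ (2 * Δ) * mabs y ^ (2 * Δ)) • _), map_smul, evTwo_apply,
        ev_ev_invAct_sum, hGev _ hp, hGev _ hp', Complex.real_smul, ← mul_assoc,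
        ← Complex.ofReal_mul]
      have h1 : ∀ v, refl (inversion x - inversion y) v = refl x (refl (x - y) (refl y v)) := by
        intro v
        rw [← refl_neg, neg_sub, refl_inversion_sub hy hx hz', ← neg_sub x y, refl_neg]
      have h2 : ∀ u v, ev (ev M u) (fun k => refl x (v k)) =
          ev (ev M fun k => refl x (u k)) v := by
        intro u v
        have := ReflInvariant.of_mem hPi.mem_pairings x (fun k => refl x (u k)) v
        simp only [refl_refl] at this
        rw [hMev, hMev, this]
      simp only [h1, h2]
      congr 2
      have e := mabs_inversion_sub hx hy
      have p1 := mabs_pos hx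
      have p2 := mabs_pos hy
      have p3 : 0 < mabs (inversion x - inversion y) := mabs_pos (hS.ne_zero hp')
      rw [← e, Real.mul_rpow (by positivity) p2.le, Real.mul_rpow p3.le p1.le,
        Real.rpow_neg p3.le, Real.rpow_neg p1.le, Real.rpow_neg p2.le]
      have := (Real.rpow_pos_of_pos p1 (2 * Δ)).ne'
      have := (Real.rpow_pos_of_pos p2 (2 * Δ)).ne'
      field_simp
    intro a b
    rw [key]
    exact Complex.real_smul

theorem isConformalTwoPoint_iff {D : ℕ} {Pi : Pt (D + 2) → Idx (D + 2) r q → Idx (D + 2) r q → ℝ}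
    (hPi : IsNumerator Pi) (hq : q ≤ D) {U : Set (Pt (D + 2) × Pt (D + 2))}
    (hU : U ∈ ({spacelikePairs (D + 2), timelikePairs (D + 2), nonNullPairs (D + 2)} :
      Set (Set (Pt (D + 2) × Pt (D + 2)))))
    (G : Pt (D + 2) × Pt (D + 2) → Idx (D + 2) r q → Idx (D + 2) r q → ℂ) :
    IsConformalTwoPoint Δ U G ↔
      ∃ C : ℂ, ∀ x y : Pt (D + 2), (x, y) ∈ U → ∀ a b : Idx (D + 2) r q,
        G (x, y) a b = C * (Pi (x - y) a b : ℂ) / ((mabs (x - y) ^ (2 * Δ) : ℝ) : ℂ) := by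
  obtain ⟨S, hSc, hS, rfl⟩ : ∃ S : Set ℝ, (S = Set.Ioi 0 ∨ S = Set.Iio 0 ∨ S = {0}ᶜ) ∧
      IsSeparation S ∧ U = sepPairs (D + 2) S := by
    rcases hU with rfl | rfl | rfl
    · exact ⟨Set.Ioi 0, Or.inl rfl, ⟨isOpen_Ioi, lt_irrefl (0 : ℝ), fun c hc a ha => mul_pos hc ha⟩, rfl⟩
    · exact ⟨Set.Iio 0, Or.inr (Or.inl rfl),
        ⟨isOpen_Iio, lt_irrefl (0 : ℝ), fun c hc a ha => mul_neg_of_pos_of_neg hc ha⟩, rfl⟩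
    · exact ⟨{0}ᶜ, Or.inr (Or.inr rfl),
        ⟨isOpen_compl_singleton, fun h => h rfl, fun c hc a ha => mul_ne_zero (ne_of_gt hc) ha⟩, rfl⟩
  refine ⟨fun hG => ?_, fun ⟨C, hC⟩ => hPi.isConformalTwoPoint (by omega) hS C hC⟩
  obtain ⟨C, hC⟩ := hG.exists_forall_eq_mul hSc hS hPi hq
  refine ⟨C, fun x y hp a b => ?_⟩
  have hz : sq (x - y) ≠ 0 := hS.ne_zero hp
  have h1 := hC (x - y) hp
  rw [← hG.normalized_eq hS hp, normalized] at h1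
  -- Undo the normalization: a reflection is an involution and the two powers cancel.
  have h2 := congrArg (twist (mabs (x - y) ^ (-(2 * Δ))) (x - y)) h1
  rw [twist_twist (by rw [← Real.rpow_add (mabs_pos hz), neg_add_cancel, Real.rpow_zero])] at h2
  rw [h2, hPi.twist_inv_apply]

end Backward

/-! ### The simplest hook -/

section SimplestHook

variable {d : ℕ}

theorem eq_hookIdx (a : Idx d 1 1) :
    a = hookIdx (a (Sum.inl 0)) (a (Sum.inl 1)) (a (Sum.inr 0)) := by
  funext k
  rcases k with k | k
  · fin_cases k <;> rfl
  · fin_cases k; rfl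

/-- The explicit numerator of type `{2, 2}`, in the normalization of `leading`. -/
def hookPi (x : Pt d) (a b : Idx d 1 1) : ℝ :=
  1 / 4 * hookNumerator x (a (Sum.inl 0)) (a (Sum.inl 1)) (a (Sum.inr 0))
    (b (Sum.inl 0)) (b (Sum.inl 1)) (b (Sum.inr 0))

theorem sum_fin_one_add_one (f : Fin (1 + 1) → ℝ) : ∑ j, f j = f 0 + f 1 := Fin.sum_univ_two f

theorem prod_fin_one_add_one (f : Fin (1 + 1) → ℝ) : ∏ j, f j = f 0 * f 1 := Fin.prod_univ_two f

theorem sum_perm_fin_one_add_one (f : Equiv.Perm (Fin (1 + 1)) → ℝ) :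
    ∑ σ, f σ = f 1 + f (Equiv.swap 0 1) := by
  have h : (Finset.univ : Finset (Equiv.Perm (Fin (1 + 1)))) = {1, Equiv.swap 0 1} := by decide
  rw [h, Finset.sum_pair (by decide)]

theorem leading_hook (x : Pt d) (i j k m n l : Fin d) :
    leading x (hookIdx i j k) (hookIdx m n l) = 1 / 4 *
      ((invMat x i m * invMat x j n + invMat x i n * invMat x j m) * invMat x k l
        - 1 / 2 * (invMat x i m * invMat x k n + invMat x i n * invMat x k m) * invMat x j l
        - 1 / 2 * (invMat x j m * invMat x k n + invMat x j n * invMat x k m) * invMat x i l) := by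
  rw [leading]
  simp only [sum_perm_fin_one_add_one, symBlock, altBlock, hookIdx, Fintype.sum_unique,
    prod_fin_one_add_one, Fin.prod_univ_one]
  simp [Fin.last, Nat.factorial]
  ring

/-- A pairing with one trace in each group of indices. -/
def tracePair (π ρ : Equiv.Perm (Pos 1 1)) (x : Pt d) (a b : Idx d 1 1) : ℝ :=
  metric (a (π (Sum.inl 0))) (a (π (Sum.inl 1))) * metric (b (ρ (Sum.inl 0))) (b (ρ (Sum.inl 1))) *
    invMat x (a (π (Sum.inr 0))) (b (ρ (Sum.inr 0)))

theorem tracePair_mem (π ρ : Equiv.Perm (Pos 1 1)) :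
    (tracePair π ρ : Pt d → Idx d 1 1 → Idx d 1 1 → ℝ) ∈ etaTerms d 1 1 := by
  let e₀ : Equiv.Perm (Pos 1 1 ⊕ Pos 1 1) :=
    Equiv.swap (Sum.inr (Sum.inl 0)) (Sum.inl (Sum.inl 1))
  have h1 : e₀ (Sum.inl (Sum.inl 0)) = Sum.inl (Sum.inl 0) := by decide
  have h2 : e₀ (Sum.inr (Sum.inl 0)) = Sum.inl (Sum.inl 1) := by decide
  have h3 : e₀ (Sum.inl (Sum.inl 1)) = Sum.inr (Sum.inl 0) := by decide
  have h4 : e₀ (Sum.inr (Sum.inl 1)) = Sum.inr (Sum.inl 1) := by decide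
  have h5 : e₀ (Sum.inl (Sum.inr 0)) = Sum.inl (Sum.inr 0) := by decide
  have h6 : e₀ (Sum.inr (Sum.inr 0)) = Sum.inr (Sum.inr 0) := by decide
  refine Submodule.subset_span ⟨e₀.trans (Equiv.sumCongr π ρ), ⟨Sum.inl 0, ?_⟩, ?_⟩
  · simp [h1, h2]
  · funext x a b
    simp only [pairingTerm, Fintype.prod_sum_type, prod_fin_one_add_one, Fin.prod_univ_one,
      Equiv.trans_apply, h1, h2, h3, h4, h5, h6, Equiv.sumCongr_apply, Sum.map_inl, Sum.map_inr,
      Sum.elim_inl, Sum.elim_inr, Sum.isLeft_inl, Sum.isLeft_inr, if_true, tracePair]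
    simp

/-- The trace part carries the same combination of traces, with coefficients `1, -1/2, -1/2`, in
each of the two groups. -/
theorem hookTrace_eq (x : Pt d) (a b : Idx d 1 1) :
    hookTrace x (a (Sum.inl 0)) (a (Sum.inl 1)) (a (Sum.inr 0))
      (b (Sum.inl 0)) (b (Sum.inl 1)) (b (Sum.inr 0)) =
    ∑ s : Fin 3, ∑ t : Fin 3, (![1, -1 / 2, -1 / 2] s * ![1, -1 / 2, -1 / 2] t : ℝ) *
      tracePair (![1, Equiv.swap (Sum.inl 1) (Sum.inr 0), Equiv.swap (Sum.inl 0) (Sum.inr 0)] s)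
        (![1, Equiv.swap (Sum.inl 1) (Sum.inr 0), Equiv.swap (Sum.inl 0) (Sum.inr 0)] t) x a b := by
  have h1 : Equiv.swap (Sum.inl 1) (Sum.inr 0) (Sum.inl 0 : Pos 1 1) = Sum.inl 0 := by decide
  have h2 : Equiv.swap (Sum.inl 0) (Sum.inr 0) (Sum.inl 1 : Pos 1 1) = Sum.inl 1 := by decide
  simp only [Fin.sum_univ_three, tracePair, Matrix.cons_val_zero, Matrix.cons_val_one,
    Matrix.cons_val, h1, h2, Equiv.swap_apply_left, Equiv.swap_apply_right, Equiv.Perm.one_apply,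
    hookTrace, metric_comm (a (Sum.inr 0)) (a (Sum.inl 1)),
    metric_comm (b (Sum.inr 0)) (b (Sum.inl 1))]
  ring

theorem hookPi_sub_leading_mem : (hookPi : Pt d → Idx d 1 1 → Idx d 1 1 → ℝ) - leading ∈
    etaTerms d 1 1 := by
  have h : (hookPi : Pt d → Idx d 1 1 → Idx d 1 1 → ℝ) - leading =
      (-(1 / 4 * (2 / ((d : ℝ) - 1)))) •
      ∑ s : Fin 3, ∑ t : Fin 3, (![1, -1 / 2, -1 / 2] s * ![1, -1 / 2, -1 / 2] t : ℝ) •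
        tracePair (![1, Equiv.swap (Sum.inl 1) (Sum.inr 0), Equiv.swap (Sum.inl 0) (Sum.inr 0)] s)
          (![1, Equiv.swap (Sum.inl 1) (Sum.inr 0), Equiv.swap (Sum.inl 0) (Sum.inr 0)] t) := by
    funext x a b
    have h1 := leading_hook x (a (Sum.inl 0)) (a (Sum.inl 1)) (a (Sum.inr 0))
      (b (Sum.inl 0)) (b (Sum.inl 1)) (b (Sum.inr 0))
    rw [← eq_hookIdx, ← eq_hookIdx] at h1
    simp only [Pi.sub_apply, Pi.smul_apply, Finset.sum_apply, smul_eq_mul]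
    rw [← hookTrace_eq, h1, hookPi, hookNumerator]
    ring
  rw [h]
  exact Submodule.smul_mem _ _ (Submodule.sum_mem _ fun s _ => Submodule.sum_mem _ fun t _ =>
    Submodule.smul_mem _ _ (tracePair_mem _ _))

theorem sum_eta_invMat_invMat (x : Pt d) (m n : Fin d) :
    ∑ k, eta k * (invMat x k m * invMat x k n) = metric m n := by
  rw [← dot_bas_bas, ← dot_refl_refl x, dot]
  refine Finset.sum_congr rfl fun k _ => ?_
  rw [low, refl_bas, refl_bas, invMat_comm x k m, invMat_comm x k n]
  linear_combination -(eta k * invMat x m k * invMat x n k) * eta_mul_self k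

theorem sum_eta_metric_invMat (x : Pt d) (k l : Fin d) :
    ∑ n, eta n * (metric n k * invMat x n l) = invMat x k l := by
  rw [Finset.sum_eq_single k]
  · rw [metric_self, ← mul_assoc, eta_mul_self, one_mul]
  · intro n _ hn; rw [metric_of_ne hn]; ring
  · simp

theorem sum_eta_metric : ∑ n : Fin d, eta n * metric n n = d := by
  simp [metric_self, eta_mul_self]

/-- Let `B = η_{mn} I_{kl} - ½ η_{ml} I_{kn} - ½ η_{nl} I_{km}`. The trace of the terms without η is
`2B` and that of `T` is `(d-1)B`, where `d` comes from `η_{ij}` and `-1` from the mixed metrics;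
this explains the coefficient `2/(d-1)`. -/
theorem sum_eta_hookNumerator (hd : (d : ℝ) - 1 ≠ 0) (x : Pt d) (k m n l : Fin d) :
    ∑ i, eta i * hookNumerator x i i k m n l = 0 := by
  have h : ∀ i, eta i * hookNumerator x i i k m n l =
      2 * invMat x k l * (eta i * (invMat x i m * invMat x i n))
      - invMat x k n * (eta i * (invMat x i m * invMat x i l))
      - invMat x k m * (eta i * (invMat x i n * invMat x i l))
      - 2 / ((d : ℝ) - 1) * (metric m n * invMat x k l - 1 / 2 * metric m l * invMat x k n
          - 1 / 2 * metric n l * invMat x k m) * (eta i * metric i i)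
      + 2 / ((d : ℝ) - 1) * metric m n * (eta i * (metric i k * invMat x i l))
      - 1 / ((d : ℝ) - 1) * metric m l * (eta i * (metric i k * invMat x i n))
      - 1 / ((d : ℝ) - 1) * metric n l * (eta i * (metric i k * invMat x i m)) := by
    intro i
    rw [hookNumerator, hookTrace]
    ring
  simp only [h, Finset.sum_add_distrib, Finset.sum_sub_distrib, ← Finset.mul_sum,
    sum_eta_invMat_invMat, sum_eta_metric_invMat, sum_eta_metric]
  field_simp
  ring

theorem hookNumerator_swap (x : Pt d) (i j k m n l : Fin d) :
    hookNumerator x j i k m n l = hookNumerator x i j k m n l := by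
  rw [hookNumerator, hookNumerator, hookTrace, hookTrace, metric_comm j i]; ring

theorem hookNumerator_cyclic (x : Pt d) (i j k m n l : Fin d) :
    hookNumerator x i j k m n l + (hookNumerator x k j i m n l + hookNumerator x i k j m n l) =
      0 := by
  simp only [hookNumerator, hookTrace, metric_comm k i, metric_comm k j, metric_comm j i]; ring

theorem hookPi_isTracelessHook (hd : (d : ℝ) - 1 ≠ 0) (x : Pt d) (b : Idx d 1 1) :
    IsTracelessHook (fun a => hookPi x a b) where
  symm σ a := by
    have hσ : σ = 1 ∨ σ = Equiv.swap 0 1 := by revert σ; decide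
    rcases hσ with rfl | rfl
    · rfl
    · simp only [hookPi, Function.comp_apply, Sum.map_inl, Sum.map_inr, Equiv.swap_apply_left,
        Equiv.swap_apply_right, id]
      rw [hookNumerator_swap]
  antisymm τ a := by
    obtain rfl : τ = 1 := Subsingleton.elim _ _
    simp [hookPi]
  young k a := by
    obtain rfl : k = 0 := Subsingleton.elim _ _
    have h1 : Equiv.swap (Sum.inl 1) (Sum.inr 0) (Sum.inl 0 : Pos 1 1) = Sum.inl 0 := by decide
    have h2 : Equiv.swap (Sum.inl 0) (Sum.inr 0) (Sum.inl 1 : Pos 1 1) = Sum.inl 1 := by decide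
    simp only [sum_fin_one_add_one, hookPi, Function.comp_apply, h1, h2, Equiv.swap_apply_left,
      Equiv.swap_apply_right, ← mul_add]
    rw [hookNumerator_cyclic, mul_zero]
  traceless j j' hj a := by
    have h : ∀ n, hookPi x (Function.update (Function.update a (Sum.inl j) n) (Sum.inl j') n) b =
        1 / 4 * hookNumerator x n n (a (Sum.inr 0))
          (b (Sum.inl 0)) (b (Sum.inl 1)) (b (Sum.inr 0)) := by
      intro n
      have hj' : (j = 0 ∧ j' = 1) ∨ (j = 1 ∧ j' = 0) := by revert j j'; decide
      rcases hj' with ⟨rfl, rfl⟩ | ⟨rfl, rfl⟩ <;> simp [hookPi]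
    simp only [h, smul_eq_mul, mul_left_comm _ (1 / 4 : ℝ), ← Finset.mul_sum]
    rw [sum_eta_hookNumerator hd, mul_zero]

/-- The explicit formula divided by `4` has the same leading term and is of hook type in the first
group, which suffices for the uniqueness argument. -/
theorem IsNumerator.hookNumerator_eq (hd : 4 ≤ d) {Pi : Pt d → Idx d 1 1 → Idx d 1 1 → ℝ}
    (hPi : IsNumerator Pi) {x : Pt d} (hx : sq x ≠ 0) (i j k m n l : Fin d) :
    hookNumerator x i j k m n l = 4 * Pi x (hookIdx i j k) (hookIdx m n l) := by
  have hd' : (d : ℝ) - 1 ≠ 0 := by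
    have : (4 : ℝ) ≤ d := by exact_mod_cast hd
    linarith
  have h := eq_of_sub_leading_mem hPi.eta_terms hookPi_sub_leading_mem (hPi.hook_left x hx)
    (hookPi_isTracelessHook hd' x)
  rw [h, hookPi]
  simp [hookIdx]

end SimplestHook

end HookCFT

end

/-! ### Assembly of the main theorem -/

theorem mainTheorem7 :
    (∀ d r q : ℕ, 2 * (q + 1) ≤ d →
      (∃ Pi : HookCFT.Pt d → HookCFT.Idx d r q → HookCFT.Idx d r q → ℝ,
        HookCFT.IsNumerator Pi) ∧
      (∀ Pi Pi' : HookCFT.Pt d → HookCFT.Idx d r q → HookCFT.Idx d r q → ℝ,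
        HookCFT.IsNumerator Pi → HookCFT.IsNumerator Pi' →
        ∀ x, HookCFT.sq x ≠ 0 → Pi x = Pi' x) ∧
      (∀ Pi : HookCFT.Pt d → HookCFT.Idx d r q → HookCFT.Idx d r q → ℝ,
        HookCFT.IsNumerator Pi →
        (∀ x, HookCFT.sq x ≠ 0 → Pi x ≠ 0) ∧
        ∀ U ∈ ({HookCFT.spacelikePairs d, HookCFT.timelikePairs d, HookCFT.nonNullPairs d} :
            Set (Set (HookCFT.Pt d × HookCFT.Pt d))),
        ∀ (Δ : ℝ) (G : HookCFT.Pt d × HookCFT.Pt d → HookCFT.Idx d r q → HookCFT.Idx d r q → ℂ),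
          HookCFT.IsConformalTwoPoint Δ U G ↔
            ∃ C : ℂ, ∀ x y : HookCFT.Pt d, (x, y) ∈ U → ∀ a b : HookCFT.Idx d r q,
              G (x, y) a b =
                C * (Pi (x - y) a b : ℂ) / ((HookCFT.mabs (x - y) ^ (2 * Δ) : ℝ) : ℂ))) ∧
    (∀ d : ℕ, 4 ≤ d →
      (∀ Pi : HookCFT.Pt d → HookCFT.Idx d 1 1 → HookCFT.Idx d 1 1 → ℝ,
        HookCFT.IsNumerator Pi → ∀ x, HookCFT.sq x ≠ 0 → ∀ i j k m n l : Fin d,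
          HookCFT.hookNumerator x i j k m n l =
            4 * Pi x (HookCFT.hookIdx i j k) (HookCFT.hookIdx m n l)) ∧
      ∀ U ∈ ({HookCFT.spacelikePairs d, HookCFT.timelikePairs d, HookCFT.nonNullPairs d} :
          Set (Set (HookCFT.Pt d × HookCFT.Pt d))),
      ∀ (Δ : ℝ) (G : HookCFT.Pt d × HookCFT.Pt d → HookCFT.Idx d 1 1 → HookCFT.Idx d 1 1 → ℂ),
        HookCFT.IsConformalTwoPoint Δ U G ↔
          ∃ C : ℂ, ∀ x y : HookCFT.Pt d, (x, y) ∈ U → ∀ i j k m n l : Fin d,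
            G (x, y) (HookCFT.hookIdx i j k) (HookCFT.hookIdx m n l) =
              2 * C * (HookCFT.hookNumerator (x - y) i j k m n l : ℂ) /
                ((HookCFT.mabs (x - y) ^ (2 * Δ) : ℝ) : ℂ)) := by
  refine ⟨fun d r q hd => ?_, fun d hd => ⟨fun Pi hPi x hx => hPi.hookNumerator_eq hd hx, ?_⟩⟩
  · obtain ⟨D, rfl⟩ : ∃ D, d = D + 2 := ⟨d - 2, by omega⟩
    refine ⟨HookCFT.exists_numerator _ r q, fun Pi Pi' h h' x hx => ?_,
      fun Pi h => ⟨fun x _ => ?_, ?_⟩⟩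
    · exact HookCFT.eq_of_sub_leading_mem h.eta_terms h'.eta_terms (h.hook_left x hx)
        (h'.hook_left x hx)
    · exact h.ne_zero (by omega) x
    · intro U hU Δ G
      exact HookCFT.isConformalTwoPoint_iff h (by omega) hU G
  · intro U hU Δ G
    obtain ⟨D, rfl⟩ : ∃ D, d = D + 2 := ⟨d - 2, by omega⟩
    obtain ⟨Pi, hPi⟩ := HookCFT.exists_numerator (D + 2) 1 1
    have hU0 : ∀ x y, (x, y) ∈ U → HookCFT.sq (x - y) ≠ 0 := by
      rcases hU with rfl | rfl | rfl
      · exact fun x y h => ne_of_gt h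
      · exact fun x y h => ne_of_lt h
      · exact fun x y h => h
    rw [HookCFT.isConformalTwoPoint_iff hPi (by omega) hU G]
    constructor
    · rintro ⟨C, hC⟩
      -- The factor `8` is the `2` of the stated normalization times the `4` between the explicit
      -- numerator and `Pi`.
      refine ⟨C / 8, fun x y hp i j k m n l => ?_⟩
      rw [hC x y hp, hPi.hookNumerator_eq hd (hU0 x y hp)]
      push_cast
      ring
    · rintro ⟨C, hC⟩
      refine ⟨8 * C, fun x y hp a b => ?_⟩
      rw [HookCFT.eq_hookIdx a, HookCFT.eq_hookIdx b, hC x y hp,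
        hPi.hookNumerator_eq hd (hU0 x y hp)]
      push_cast
      ring
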